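/- Let $n\ge 4$. For $m\in\{n,n+1\}$ let $G^m=O(2,m-1)$ be the group of linear maps of $\mathbb R^{m+1}$ preserving $-t_1^2-t_2^2+x_1^2+\dots+x_{m-1}^2$, with coordinates $(t_1,t_2,x_1,\dots,x_{m-1})$ numbered $0,\dots,m$, standard basis $e_0,\dots,e_m$ and signs $\eta_0=\eta_1=-1$, $\eta_k=1$ for $k\ge2$. Let $i:G^n\to G^{n+1}$ be $g\mapsto\mathrm{diag}(g,1)$, let $K^m=O(2)\times O(m-1)\subset G^m$, and let $\mathrm{Ein}_{m-1}$ (resp. $\widehat{\mathrm{Ein}}_{m-1}$) be the manifold of lines through (resp. rays from) the origin in the null cone of $\mathbb R^{m+1}$; the map $v\mapsto(v,0)$ embeds $\mathrm{Ein}_{n-1}\subset\mathrm{Ein}_n$ and $\widehat{\mathrm{Ein}}_{n-1}\subset\widehat{\mathrm{Ein}}_n$. All function spaces are complex valued. For $a\ne b$ let $L_{ab}=\eta_bE_{ab}-\eta_aE_{ba}\in\mathfrak g_m=\mathfrak o(2,m-1)$, and put $H=L_{03}$, $A=\{\exp(tH):t\in\mathbb R\}$, $N^+=\exp\{X\in\mathfrak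 g_m:[H,X]=X\}$. Let $\hat M\cong O(1,m-2)$ be the subgroup of $G^m$ fixing $e_0$ and $e_3$, and $M=\{\pm1\}\hat M$; let $P=MAN^+$ and $\hat P=\hat MAN^+$, which are the stabilizers of the line and of the ray of $e_0+e_3$. For $\lambda\in\mathbb C$ let $\mathrm{Ind}_{P^m}^{G^m}(\xi_\lambda)$ be the space of all $u\in C^\infty(G^m)$ with $u(g\mu\exp(tH)\nu)=e^{\lambda t}u(g)$ for all $g\in G^m$, $\mu\in M$, $t\in\mathbb R$, $\nu\in N^+$, with $G^m$ acting by left translation, $(\pi(g)u)(x)=u(g^{-1}x)$; define $\mathrm{Ind}_{\hat P^m}^{G^m}(\xi_\lambda)$ in the same way with $\hat M$ in place of $M$. The compact realization $C^\infty(\mathrm{Ein}_{m-1})_\lambda$ (resp. $C^\infty(\widehat{\mathrm{Ein}}_{m-1})_\lambda$) is $C^\infty(\mathrm{Ein}_{m-1})$ (resp. $C^\infty(\widehat{\mathrm{Ein}}_{m-1})$) with the action $$(\pi^c_\lambda(g)F)([v])=F([g^{-1}v])\,\bigl(|g^{-1}v|/|v|\bigr)^{\lambda},$$ where $[v]$ is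 the line (resp. ray) of the null vector $v\neq0$ and $|\cdot|$ is the Euclidean norm. For $k\ne0,3$ let $I_k=L_{0k}-L_{3k}\in\mathfrak g_{n+1}$, a basis of the $(-1)$-eigenspace $\mathfrak n^-_{n+1}$ of $\mathrm{ad}\,H$. In the complexified enveloping algebra $\mathcal U(\mathfrak n^-_{n+1})$ put $\Delta=\sum_{k\in\{1,2,4,\dots,n\}}\eta_kI_k^2$ and $T=I_{n+1}$, and define the polynomial families $$\mathcal D^0_{2N}(\lambda)=\sum_{j=0}^Na_j(\lambda)\Delta^jT^{2N-2j},\qquad \mathcal D^0_{2N+1}(\lambda)=\sum_{j=0}^Nb_j(\lambda)\Delta^jT^{2N-2j+1},$$ where $a_N=b_N=1$ and, for $j=1,\dots,N$, $$(N-j+1)(2N-2j+1)a_{j-1}+j(n-1+2\lambda-4N+2j)a_j=0,$$ $$(N-j+1)(2N-2j+3)b_{j-1}+j(n-3+2\lambda-4N+2j)b_j=0.$$ Let $\mathcal U(\mathfrak g_{n+1})$ act on $C^\infty(G^{n+1})$ by the extension of $(Xu)(x)=\frac{d}{dt}|_{t=0}u(x\exp(tX))$, and let $i^*:C^\infty(G^{n+1})\to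 C^\infty(G^n)$ be the restriction. (a) For every even $N\ge0$ and every $\lambda\in\mathbb C$, the map $D_N(\lambda)=i^*\circ\mathcal D^0_N(\lambda)$ sends $\mathrm{Ind}_{P^{n+1}}^{G^{n+1}}(\xi_\lambda)$ into $\mathrm{Ind}_{P^n}^{G^n}(\xi_{\lambda-N})$. Restriction to $K^m$, $(\delta u)([k(e_0+e_3)])=u(k)$ for $k\in K^m$, defines isomorphisms $\delta$ of $G^m$-modules from $\mathrm{Ind}_{P^m}^{G^m}(\xi_\lambda)$ onto $C^\infty(\mathrm{Ein}_{m-1})_\lambda$ for $m=n,n+1$ and all $\lambda\in\mathbb C$; and the operators $D^c_N(\lambda)=\delta\circ D_N(\lambda)\circ\delta^{-1}$ are $G^n$-equivariant differential operators of order at most $N$ along the embedding $\mathrm{Ein}_{n-1}\subset\mathrm{Ein}_n$, $$D^c_N(\lambda):C^\infty(\mathrm{Ein}_n)_\lambda\to C^\infty(\mathrm{Ein}_{n-1})_{\lambda-N}$$ ($G^n$ acting on the source through $i$), and depend polynomially on $\lambda$. (b) For every $N\ge0$ the same holds with $\hat P$ and $\widehat{\mathrm{Ein}}$ in place of $P$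 and $\mathrm{Ein}$: $\hat D_N(\lambda)=i^*\circ\mathcal D^0_N(\lambda)$ sends $\mathrm{Ind}_{\hat P^{n+1}}^{G^{n+1}}(\xi_\lambda)$ into $\mathrm{Ind}_{\hat P^n}^{G^n}(\xi_{\lambda-N})$, and in the compact realizations it becomes a polynomial family of $G^n$-equivariant differential operators of order at most $N$, $$\hat D^c_N(\lambda):C^\infty(\widehat{\mathrm{Ein}}_n)_\lambda\to C^\infty(\widehat{\mathrm{Ein}}_{n-1})_{\lambda-N}.$$ -/

import Mathlib

open scoped ContDiff Matrix TensorProduct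

noncomputable section

namespace EinsteinFamilies

attribute [local instance] Matrix.linftyOpNormedRing Matrix.linftyOpNormedAlgebra
attribute [local instance 100] LieRing.ofAssociativeRing

/-! ### Smooth functions on embedded submanifolds -/

/-- A complex function on a subset of a normed space (given by an injective map `ι`) is smooth
if it extends, near every point, to a smooth function on an open set of the ambient space. -/
def SmoothVia {S E : Type*} [NormedAddCommGroup E] [NormedSpace ℝ E] (ι : S → E)
    (f : S → ℂ) : Prop :=
  ∀ s : S, ∃ U : Set E, IsOpen U ∧ ι s ∈ U ∧ ∃ F : E → ℂ, ContDiffOn ℝ ∞ F U ∧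
    ∀ s' : S, ι s' ∈ U → F (ι s') = f s'

theorem SmoothVia.comp {S T E E' : Type*} [NormedAddCommGroup E] [NormedSpace ℝ E]
    [NormedAddCommGroup E'] [NormedSpace ℝ E'] {ι : S → E} {κ : T → E'} {f : S → ℂ}
    (hf : SmoothVia ι f) (φ : T → S) (Φ : E' → E) (hΦ : ContDiff ℝ ∞ Φ)
    (h : ∀ t, ι (φ t) = Φ (κ t)) : SmoothVia κ (f ∘ φ) := by
  intro t
  obtain ⟨U, hU, hs, F, hF, hFf⟩ := hf (φ t)
  refine ⟨Φ ⁻¹' U, hU.preimage hΦ.continuous, by simpa [← h] using hs, F ∘ Φ,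
    hF.comp hΦ.contDiffOn (fun _ hx => hx), fun s' hs' => ?_⟩
  have : ι (φ s') ∈ U := by rw [h]; exact hs'
  simp [← h, hFf _ this]

theorem SmoothVia.mul {S E : Type*} [NormedAddCommGroup E] [NormedSpace ℝ E] {ι : S → E}
    {f g : S → ℂ} (hf : SmoothVia ι f) (hg : SmoothVia ι g) : SmoothVia ι (f * g) := by
  intro s
  obtain ⟨U, hU, hs, F, hF, hFf⟩ := hf s
  obtain ⟨U', hU', hs', F', hF', hFf'⟩ := hg s
  refine ⟨U ∩ U', hU.inter hU', ⟨hs, hs'⟩, F * F',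
    (hF.mono Set.inter_subset_left).mul (hF'.mono Set.inter_subset_right), fun t ht => ?_⟩
  simp [hFf _ ht.1, hFf' _ ht.2]

theorem SmoothVia.add {S E : Type*} [NormedAddCommGroup E] [NormedSpace ℝ E] {ι : S → E}
    {f g : S → ℂ} (hf : SmoothVia ι f) (hg : SmoothVia ι g) : SmoothVia ι (f + g) := by
  intro s
  obtain ⟨U, hU, hs, F, hF, hFf⟩ := hf s
  obtain ⟨U', hU', hs', F', hF', hFf'⟩ := hg s
  refine ⟨U ∩ U', hU.inter hU', ⟨hs, hs'⟩, F + F',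
    (hF.mono Set.inter_subset_left).add (hF'.mono Set.inter_subset_right), fun t ht => ?_⟩
  simp [hFf _ ht.1, hFf' _ ht.2]

theorem SmoothVia.const {S E : Type*} [NormedAddCommGroup E] [NormedSpace ℝ E] (ι : S → E)
    (c : ℂ) : SmoothVia ι (fun _ => c) :=
  fun _ => ⟨Set.univ, isOpen_univ, Set.mem_univ _, fun _ => c, contDiffOn_const, fun _ _ => rfl⟩

/-! ### The group `G^m = O(2, m-1)` and its Lie algebra

Vectors of `ℝ^{m+1}` are written `(t₁, t₂, x₁, …, x_{m-1})`, with the coordinates numbered from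
`0` to `m`; thus `0, 1` are the timelike ones and `(1,0,0,1,0,…,0) = e₀ + e₃`. -/

/-- The signs of the form `-t₁² - t₂² + x₁² + ⋯ + x_{m-1}²`. -/
def sgn (m : ℕ) (i : Fin (m + 1)) : ℝ := if i.val < 2 then -1 else 1

/-- The Gram matrix `diag(-1, -1, 1, …, 1)`. -/
def gram (m : ℕ) : Matrix (Fin (m + 1)) (Fin (m + 1)) ℝ := Matrix.diagonal (sgn m)

theorem gram_mul_gram (m : ℕ) : gram m * gram m = 1 := by
  rw [gram, Matrix.diagonal_mul_diagonal, ← Matrix.diagonal_one]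
  congr 1
  funext i
  unfold sgn
  split_ifs <;> norm_num

/-- The group `G^m = O(2, m-1)`. -/
def G (m : ℕ) : Subgroup (GL (Fin (m + 1)) ℝ) where
  carrier := {g | (g : Matrix (Fin (m + 1)) (Fin (m + 1)) ℝ)ᵀ * gram m *
    (g : Matrix (Fin (m + 1)) (Fin (m + 1)) ℝ) = gram m}
  one_mem' := by simp
  mul_mem' := by
    intro a b ha hb
    simp only [Set.mem_ofPred_eq, Units.val_mul, Matrix.transpose_mul] at *
    calc _ = (b : Matrix (Fin (m + 1)) (Fin (m + 1)) ℝ)ᵀ *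
          ((a : Matrix (Fin (m + 1)) (Fin (m + 1)) ℝ)ᵀ * gram m * a) * b := by
            simp only [mul_assoc]
      _ = _ := by rw [ha, hb]
  inv_mem' := by
    intro a ha
    simp only [Set.mem_ofPred_eq] at *
    have h1 : (a : Matrix (Fin (m + 1)) (Fin (m + 1)) ℝ) * (a⁻¹ : GL (Fin (m + 1)) ℝ) = 1 := by
      simp
    have h2 : ((a⁻¹ : GL (Fin (m + 1)) ℝ) : Matrix (Fin (m + 1)) (Fin (m + 1)) ℝ)ᵀ *
        (a : Matrix (Fin (m + 1)) (Fin (m + 1)) ℝ)ᵀ = 1 := by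
      rw [← Matrix.transpose_mul, h1, Matrix.transpose_one]
    calc _ = ((a⁻¹ : GL (Fin (m + 1)) ℝ) : Matrix (Fin (m + 1)) (Fin (m + 1)) ℝ)ᵀ *
          ((a : Matrix (Fin (m + 1)) (Fin (m + 1)) ℝ)ᵀ * gram m * a) *
            (a⁻¹ : GL (Fin (m + 1)) ℝ) := by rw [ha]
      _ = (((a⁻¹ : GL (Fin (m + 1)) ℝ) : Matrix (Fin (m + 1)) (Fin (m + 1)) ℝ)ᵀ *
          (a : Matrix (Fin (m + 1)) (Fin (m + 1)) ℝ)ᵀ) * gram m *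
            ((a : Matrix (Fin (m + 1)) (Fin (m + 1)) ℝ) * (a⁻¹ : GL (Fin (m + 1)) ℝ)) := by
            simp only [mul_assoc]
      _ = gram m := by rw [h1, h2, one_mul, mul_one]

/-- The matrix of an element of `G^m`. -/
def mat {m : ℕ} (g : G m) : Matrix (Fin (m + 1)) (Fin (m + 1)) ℝ :=
  ((g : GL (Fin (m + 1)) ℝ) : Matrix (Fin (m + 1)) (Fin (m + 1)) ℝ)

theorem mat_mul {m : ℕ} (g h : G m) : mat (g * h) = mat g * mat h := rfl

theorem mat_one {m : ℕ} : mat (1 : G m) = 1 := rfl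

theorem mat_injective {m : ℕ} : Function.Injective (mat : G m → _) :=
  fun _ _ h => Subtype.ext (Units.ext h)

theorem mat_gram {m : ℕ} (g : G m) : (mat g)ᵀ * gram m * mat g = gram m := g.2

/-- An element of `G^m` from a matrix that preserves the form. -/
def ofMat {m : ℕ} (A : Matrix (Fin (m + 1)) (Fin (m + 1)) ℝ) (hA : Aᵀ * gram m * A = gram m) :
    G m :=
  have h : (gram m * Aᵀ * gram m) * A = 1 := by
    rw [mul_assoc, mul_assoc, ← mul_assoc Aᵀ, hA, gram_mul_gram]
  ⟨⟨A, gram m * Aᵀ * gram m, mul_eq_one_comm.mp h, h⟩, hA⟩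

theorem mat_ofMat {m : ℕ} (A : Matrix (Fin (m + 1)) (Fin (m + 1)) ℝ)
    (hA : Aᵀ * gram m * A = gram m) : mat (ofMat A hA) = A := rfl

/-- The inclusion `i : O(2, m-1) → O(2, m)`, `M ↦ diag(M, 1)`, on matrices. -/
def blockIncl {m : ℕ} (A : Matrix (Fin (m + 1)) (Fin (m + 1)) ℝ) :
    Matrix (Fin (m + 1 + 1)) (Fin (m + 1 + 1)) ℝ :=
  Matrix.reindex finSumFinEquiv finSumFinEquiv
    (Matrix.fromBlocks A 0 0 (1 : Matrix (Fin 1) (Fin 1) ℝ))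

theorem blockIncl_mul {m : ℕ} (A B : Matrix (Fin (m + 1)) (Fin (m + 1)) ℝ) :
    blockIncl (A * B) = blockIncl A * blockIncl B := by
  simp [blockIncl, Matrix.submatrix_mul_equiv, Matrix.fromBlocks_multiply]

theorem blockIncl_transpose {m : ℕ} (A : Matrix (Fin (m + 1)) (Fin (m + 1)) ℝ) :
    blockIncl Aᵀ = (blockIncl A)ᵀ := by
  simp [blockIncl, Matrix.fromBlocks_transpose]

theorem blockIncl_one {m : ℕ} :
    blockIncl (1 : Matrix (Fin (m + 1)) (Fin (m + 1)) ℝ) = 1 := by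
  simp [blockIncl, Matrix.fromBlocks_one]

theorem gram_succ (m : ℕ) : gram (m + 1) = Matrix.reindex finSumFinEquiv finSumFinEquiv
    (Matrix.fromBlocks (gram m) 0 0
      (Matrix.diagonal fun _ : Fin 1 => sgn (m + 1) (Fin.last (m + 1)))) := by
  ext i j
  obtain ⟨i, rfl⟩ := finSumFinEquiv.surjective i
  obtain ⟨j, rfl⟩ := finSumFinEquiv.surjective j
  rcases i with i | i <;> rcases j with j | j
  · simp [gram, Matrix.diagonal_apply, sgn]
  · have : (Fin.castAdd 1 i : Fin (m + 1 + 1)) ≠ Fin.natAdd (m + 1) j := by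
      simp [Fin.ext_iff]; omega
    simp [gram, this]
  · have : (Fin.natAdd (m + 1) i : Fin (m + 1 + 1)) ≠ Fin.castAdd 1 j := by
      simp [Fin.ext_iff]; omega
    simp [gram, this]
  · have : (Fin.natAdd (m + 1) (0 : Fin 1) : Fin (m + 1 + 1)) = Fin.last (m + 1) := by
      simp [Fin.ext_iff]
    simp [gram, Subsingleton.elim i 0, Subsingleton.elim j 0, this]

theorem blockIncl_gram {m : ℕ} (A : Matrix (Fin (m + 1)) (Fin (m + 1)) ℝ)
    (hA : Aᵀ * gram m * A = gram m) :
    (blockIncl A)ᵀ * gram (m + 1) * blockIncl A = gram (m + 1) := by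
  rw [gram_succ]
  simp [blockIncl, Matrix.fromBlocks_transpose, Matrix.submatrix_mul_equiv,
    Matrix.fromBlocks_multiply, hA]

/-- The inclusion `i : G^m → G^{m+1}`, `M ↦ diag(M, 1)`. -/
def incl (m : ℕ) : G m →* G (m + 1) where
  toFun g := ofMat (blockIncl (mat g)) (blockIncl_gram _ (mat_gram g))
  map_one' := mat_injective (by rw [mat_ofMat, mat_one, mat_one, blockIncl_one])
  map_mul' g h := mat_injective (by
    rw [mat_ofMat, mat_mul, mat_mul, mat_ofMat, mat_ofMat, blockIncl_mul])

theorem mat_incl {m : ℕ} (g : G m) : mat (incl m g) = blockIncl (mat g) := rfl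

/-- The Lie algebra `𝔬(2, m-1)` of `G^m`: the matrices `X` with `Xᵀ η = -η X`, `η` the Gram
matrix. -/
def 𝔤 (m : ℕ) : LieSubalgebra ℝ (Matrix (Fin (m + 1)) (Fin (m + 1)) ℝ) :=
  skewAdjointMatricesLieSubalgebra (gram m)

theorem mem_𝔤 {m : ℕ} (X : Matrix (Fin (m + 1)) (Fin (m + 1)) ℝ) :
    X ∈ 𝔤 m ↔ Xᵀ * gram m = gram m * -X := by
  simp [𝔤, Matrix.IsSkewAdjoint, Matrix.IsAdjointPair]

theorem exp_mem {m : ℕ} {X : Matrix (Fin (m + 1)) (Fin (m + 1)) ℝ} (hX : X ∈ 𝔤 m) :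
    (NormedSpace.exp X)ᵀ * gram m * NormedSpace.exp X = gram m := by
  have hX' := (mem_𝔤 X).1 hX
  have hu : IsUnit (gram m) := IsUnit.of_mul_eq_one _ (gram_mul_gram m)
  have hinv : (gram m)⁻¹ = gram m := Matrix.inv_eq_left_inv (gram_mul_gram m)
  have h1 : Xᵀ = gram m * -X * (gram m)⁻¹ := by
    rw [← hX', hinv, mul_assoc, gram_mul_gram, mul_one]
  have h2 : ∀ Z : Matrix (Fin (m + 1)) (Fin (m + 1)) ℝ, gram m * (gram m * Z) = Z := by
    intro Z
    rw [← mul_assoc, gram_mul_gram, one_mul]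
  rw [← Matrix.exp_transpose, h1, Matrix.exp_conj _ _ hu, hinv]
  simp only [mul_assoc]
  rw [h2, ← Matrix.exp_add_of_commute _ _ (Commute.neg_left (Commute.refl X)), neg_add_cancel,
    NormedSpace.exp_zero, mul_one]

/-- The exponential map `𝔬(2, m-1) → O(2, m-1)`. -/
def expG {m : ℕ} (X : 𝔤 m) : G m := ofMat (NormedSpace.exp (X : Matrix _ _ ℝ)) (exp_mem X.2)

/-! ### Smooth functions on `G^m` and the right action of the enveloping algebra -/

/-- `C^∞(G^m)`, complex valued; `G^m` is a closed submanifold of the space of matrices. -/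
def CG (m : ℕ) : Subalgebra ℂ (G m → ℂ) where
  carrier := {u | SmoothVia (mat : G m → _) u}
  mul_mem' hu hv := hu.mul hv
  add_mem' hu hv := hu.add hv
  algebraMap_mem' c := SmoothVia.const _ c

/-- The left-invariant vector field `(R(X) u)(x) = d/dt|_{t=0} u(x exp(tX))`. -/
def rightDeriv {m : ℕ} (X : 𝔤 m) (u : G m → ℂ) : G m → ℂ :=
  fun x => deriv (fun t : ℝ => u (x * expG (t • X))) 0

theorem hasDerivAt_right {m : ℕ} (X : 𝔤 m) {u : G m → ℂ}
    {U : Set (Matrix (Fin (m + 1)) (Fin (m + 1)) ℝ)} (hU : IsOpen U)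
    {F : Matrix (Fin (m + 1)) (Fin (m + 1)) ℝ → ℂ} (hF : ContDiffOn ℝ ∞ F U)
    (hFu : ∀ y : G m, mat y ∈ U → F (mat y) = u y) (x : G m) (hx : mat x ∈ U) :
    HasDerivAt (fun t : ℝ => u (x * expG (t • X))) (fderiv ℝ F (mat x) (mat x * X)) 0 := by
  have hc : HasDerivAt (fun t : ℝ => mat x * NormedSpace.exp (t • (X : Matrix _ _ ℝ)))
      (mat x * X) 0 := by
    have := (hasDerivAt_exp_smul_const (𝕂 := ℝ) (X : Matrix (Fin (m + 1)) (Fin (m + 1)) ℝ)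
      (0 : ℝ)).const_mul (mat x)
    simp only [zero_smul, NormedSpace.exp_zero, one_mul] at this
    exact this
  have hFd : HasFDerivAt F (fderiv ℝ F (mat x))
      (mat x * NormedSpace.exp ((0 : ℝ) • (X : Matrix _ _ ℝ))) := by
    rw [zero_smul, NormedSpace.exp_zero, mul_one]
    exact ((hF.contDiffAt (hU.mem_nhds hx)).differentiableAt (by simp)).hasFDerivAt
  refine (hFd.comp_hasDerivAt (0 : ℝ) hc).congr_of_eventuallyEq ?_
  have : ∀ᶠ t : ℝ in nhds 0, mat x * NormedSpace.exp (t • (X : Matrix _ _ ℝ)) ∈ U := by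
    refine hc.continuousAt.eventually_mem (hU.mem_nhds ?_)
    simpa using hx
  filter_upwards [this] with t ht
  exact (hFu (x * expG (t • X)) ht).symm

theorem rightDeriv_eq {m : ℕ} (X : 𝔤 m) {u : G m → ℂ}
    {U : Set (Matrix (Fin (m + 1)) (Fin (m + 1)) ℝ)} (hU : IsOpen U)
    {F : Matrix (Fin (m + 1)) (Fin (m + 1)) ℝ → ℂ} (hF : ContDiffOn ℝ ∞ F U)
    (hFu : ∀ y : G m, mat y ∈ U → F (mat y) = u y) (x : G m) (hx : mat x ∈ U) :
    rightDeriv X u x = fderiv ℝ F (mat x) (mat x * X) :=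
  (hasDerivAt_right X hU hF hFu x hx).deriv

theorem contDiffOn_field {m : ℕ} (X : Matrix (Fin (m + 1)) (Fin (m + 1)) ℝ)
    {U : Set (Matrix (Fin (m + 1)) (Fin (m + 1)) ℝ)} (hU : IsOpen U)
    {F : Matrix (Fin (m + 1)) (Fin (m + 1)) ℝ → ℂ} (hF : ContDiffOn ℝ ∞ F U) :
    ContDiffOn ℝ ∞ (fun A => fderiv ℝ F A (A * X)) U :=
  (hF.fderiv_of_isOpen hU (by simp)).clm_apply (contDiffOn_id.mul contDiffOn_const)

theorem rightDeriv_mem {m : ℕ} (X : 𝔤 m) {u : G m → ℂ} (hu : u ∈ CG m) :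
    rightDeriv X u ∈ CG m := by
  intro x
  obtain ⟨U, hU, hx, F, hF, hFu⟩ := hu x
  exact ⟨U, hU, hx, _, contDiffOn_field X hU hF,
    fun y hy => (rightDeriv_eq X hU hF hFu y hy).symm⟩

/-- `R(X)` as an operator on `C^∞(G^m)`. -/
def RX {m : ℕ} (X : 𝔤 m) : Module.End ℂ (CG m) where
  toFun u := ⟨rightDeriv X u, rightDeriv_mem X u.2⟩
  map_add' u v := by
    ext x
    obtain ⟨U, hU, hx, F, hF, hFu⟩ := u.2 x
    obtain ⟨U', hU', hx', F', hF', hFu'⟩ := v.2 x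
    exact ((hasDerivAt_right X hU hF hFu x hx).add
      (hasDerivAt_right X hU' hF' hFu' x hx')).deriv.trans
      (by rw [← rightDeriv_eq X hU hF hFu x hx, ← rightDeriv_eq X hU' hF' hFu' x hx']; rfl)
  map_smul' c u := by
    ext x
    obtain ⟨U, hU, hx, F, hF, hFu⟩ := u.2 x
    exact ((hasDerivAt_right X hU hF hFu x hx).const_smul c).deriv.trans
      (by rw [← rightDeriv_eq X hU hF hFu x hx]; rfl)

/-- `R` is a homomorphism of Lie algebras. -/
def RLie (m : ℕ) : 𝔤 m →ₗ⁅ℝ⁆ Module.End ℂ (CG m) where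
  toFun := RX
  map_add' X Y := by
    ext u x
    obtain ⟨U, hU, hx, F, hF, hFu⟩ := u.2 x
    change rightDeriv (X + Y) u x = rightDeriv X u x + rightDeriv Y u x
    rw [rightDeriv_eq _ hU hF hFu x hx, rightDeriv_eq _ hU hF hFu x hx,
      rightDeriv_eq _ hU hF hFu x hx]
    simp [mul_add]
  map_smul' c X := by
    ext u x
    obtain ⟨U, hU, hx, F, hF, hFu⟩ := u.2 x
    change rightDeriv (c • X) u x = c • rightDeriv X u x
    rw [rightDeriv_eq _ hU hF hFu x hx, rightDeriv_eq _ hU hF hFu x hx]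
    simp
  map_lie' := by
    intro X Y
    ext u x
    obtain ⟨U, hU, hx, F, hF, hFu⟩ := u.2 x
    change rightDeriv ⁅X, Y⁆ u x =
      rightDeriv X (rightDeriv Y u) x - rightDeriv Y (rightDeriv X u) x
    have key : ∀ X Y : 𝔤 m, rightDeriv X (rightDeriv Y u) x =
        fderiv ℝ (fderiv ℝ F) (mat x) (mat x * X) (mat x * Y) +
          fderiv ℝ F (mat x) (mat x * X * Y) := by
      intro X Y
      rw [rightDeriv_eq X hU (contDiffOn_field Y hU hF)
        (fun y hy => (rightDeriv_eq Y hU hF hFu y hy).symm) x hx]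
      have h1 : DifferentiableAt ℝ (fderiv ℝ F) (mat x) :=
        ((hF.fderiv_of_isOpen hU (m := ∞) (by simp)).contDiffAt
          (hU.mem_nhds hx)).differentiableAt (by simp)
      have h2 : HasFDerivAt (fun A : Matrix (Fin (m + 1)) (Fin (m + 1)) ℝ =>
          A * (Y : Matrix _ _ ℝ)) ((ContinuousLinearMap.mul ℝ _).flip (Y : Matrix _ _ ℝ))
          (mat x) := ((ContinuousLinearMap.mul ℝ
            (Matrix (Fin (m + 1)) (Fin (m + 1)) ℝ)).flip (Y : Matrix _ _ ℝ)).hasFDerivAt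
      have h3 := (h1.hasFDerivAt.clm_apply h2).fderiv
      refine (congrArg (fun L => L (mat x * (X : Matrix _ _ ℝ))) h3).trans ?_
      exact add_comm _ _
    have hsymm : fderiv ℝ (fderiv ℝ F) (mat x) (mat x * X) (mat x * Y) =
        fderiv ℝ (fderiv ℝ F) (mat x) (mat x * Y) (mat x * X) := by
      have := (hF.contDiffAt (hU.mem_nhds hx)).isSymmSndFDerivAt (by
        simp only [minSmoothness_of_isRCLikeNormedField]
        exact WithTop.coe_le_coe.2 (le_top : (2 : ℕ∞) ≤ ⊤))
      exact this _ _
    rw [key X Y, key Y X, rightDeriv_eq _ hU hF hFu x hx, hsymm, LieSubalgebra.coe_bracket,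
      Ring.lie_def, mul_sub, map_sub, mul_assoc, mul_assoc]
    ring

/-- The complexified enveloping algebra `𝒰(𝔤_m) ⊗ ℂ`. -/
abbrev UC (m : ℕ) : Type := ℂ ⊗[ℝ] UniversalEnvelopingAlgebra ℝ (𝔤 m)

/-- The action of the enveloping algebra on `C^∞(G^m)` by left-invariant differential operators
that extends `R`. -/
def RU (m : ℕ) : UC m →ₐ[ℂ] Module.End ℂ (CG m) :=
  Algebra.TensorProduct.lift (Algebra.ofId ℂ _)
    (UniversalEnvelopingAlgebra.lift ℝ (RLie m)) (fun _ _ => Algebra.commutes _ _)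

/-- The elements of `𝔤_m` in its complexified enveloping algebra. -/
def toUC {m : ℕ} (X : 𝔤 m) : UC m := 1 ⊗ₜ[ℝ] UniversalEnvelopingAlgebra.ι ℝ X

/-- The restriction map `i^* : C^∞(G^{m+1}) → C^∞(G^m)`. -/
def restrictG (m : ℕ) : CG (m + 1) →ₐ[ℂ] CG m where
  toFun u := ⟨u ∘ incl m, by
    refine u.2.comp (incl m) (fun A => blockIncl A) ?_ (fun _ => rfl)
    have : (fun A : Matrix (Fin (m + 1)) (Fin (m + 1)) ℝ => blockIncl A) = fun A =>
        (LinearMap.toContinuousLinearMap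
          ({ toFun := fun A => blockIncl A - blockIncl 0
             map_add' := fun A B => by
              ext i j
              obtain ⟨i, rfl⟩ := finSumFinEquiv.surjective i
              obtain ⟨j, rfl⟩ := finSumFinEquiv.surjective j
              rcases i with i | i <;> rcases j with j | j <;> simp [blockIncl]
             map_smul' := fun c A => by
              ext i j
              obtain ⟨i, rfl⟩ := finSumFinEquiv.surjective i
              obtain ⟨j, rfl⟩ := finSumFinEquiv.surjective j
              rcases i with i | i <;> rcases j with j | j <;> simp [blockIncl] } :
            Matrix (Fin (m + 1)) (Fin (m + 1)) ℝ →ₗ[ℝ]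
              Matrix (Fin (m + 1 + 1)) (Fin (m + 1 + 1)) ℝ)) A + blockIncl 0 := by
      funext A
      simp
    rw [this]
    exact (ContinuousLinearMap.contDiff _).add contDiff_const⟩
  map_one' := rfl
  map_mul' _ _ := rfl
  map_zero' := rfl
  map_add' _ _ := rfl
  commutes' _ := rfl

/-! ### The elements `𝒟_N^0(λ)` -/

/-- The element of `𝔬(2, m-1)` with entry `η_b` at `(a, b)`, entry `-η_a` at `(b, a)`, and zeros
elsewhere (`a ≠ b`). -/
def rot {m : ℕ} (a b : Fin (m + 1)) : 𝔤 m :=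
  ⟨sgn m b • Matrix.single a b 1 - sgn m a • Matrix.single b a 1, by
    rw [mem_𝔤]
    ext i j
    simp only [gram, Matrix.transpose_sub, Matrix.transpose_smul, Matrix.transpose_single,
      Matrix.mul_diagonal, Matrix.diagonal_mul, Matrix.neg_apply,
      Matrix.sub_apply, Matrix.smul_apply, Matrix.single_apply, smul_eq_mul]
    split_ifs with h1 h2 h2
    · obtain ⟨rfl, rfl⟩ := h1
      obtain ⟨rfl, -⟩ := h2
      ring
    · obtain ⟨rfl, rfl⟩ := h1
      ring
    · obtain ⟨rfl, rfl⟩ := h2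
      ring
    · ring⟩

/-- The generator `H` of `𝔞`, with entries `1` at `(0, 3)` and `(3, 0)`. -/
def H (m : ℕ) : 𝔤 m := rot 0 3

/-- The standard basis of the abelian algebra `𝔫^-` (the `-1`-eigenspace of `ad H`), for
`k ≠ 0, 3`: it is `Q₁^-` for `k = 1`, `Q₂^-` for `k = 2`, and `Y_j^-` for `k = 3 + j`. -/
def nMinus {m : ℕ} (k : Fin (m + 1)) : 𝔤 m := rot 0 k - rot 3 k

/-- `Δ_{n-1} = -(Q₁^-)² + (Q₂^-)² + ∑_{j=1}^{n-3} (Y_j^-)² ∈ 𝒰(𝔫_n^-)`, inside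
`𝒰(𝔤_{n+1})`. -/
def lapU (n : ℕ) : UC (n + 1) :=
  ∑ k : Fin (n + 1) with k ≠ 0 ∧ k ≠ 3, (sgn n k : ℂ) • toUC (nMinus k.castSucc) ^ 2

/-- `T_n = Y_{n-2}^- ∈ 𝔫_{n+1}^-`, inside `𝒰(𝔤_{n+1})`. -/
def TU (n : ℕ) : UC (n + 1) := toUC (nMinus (Fin.last (n + 1)))

/-- The coefficients `a_j(λ)`, `0 ≤ j ≤ N`. -/
def aCoeff (n N : ℕ) (lam : ℂ) (j : ℕ) : ℂ :=
  ∏ i ∈ Finset.Ioc j N, -((i : ℂ) * (n - 1 + 2 * lam - 4 * N + 2 * i)) /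
    (((N : ℂ) - i + 1) * (2 * N - 2 * i + 1))

/-- The coefficients `b_j(λ)`, `0 ≤ j ≤ N`. -/
def bCoeff (n N : ℕ) (lam : ℂ) (j : ℕ) : ℂ :=
  ∏ i ∈ Finset.Ioc j N, -((i : ℂ) * (n - 3 + 2 * lam - 4 * N + 2 * i)) /
    (((N : ℂ) - i + 1) * (2 * N - 2 * i + 3))

theorem coeff_unique {N : ℕ} {p q c : ℕ → ℂ} (hp : ∀ j, 1 ≤ j → j ≤ N → p j ≠ 0) :
    ((∀ j, 1 ≤ j → j ≤ N → p j * c (j - 1) + q j * c j = 0) ∧ c N = 1) ↔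
      ∀ j, j ≤ N → c j = ∏ i ∈ Finset.Ioc j N, -q i / p i := by
  have step : ∀ j, 1 ≤ j → j ≤ N → ∏ i ∈ Finset.Ioc (j - 1) N, -q i / p i =
      (-q j / p j) * ∏ i ∈ Finset.Ioc j N, -q i / p i := by
    intro j hj hjN
    have : Finset.Ioc (j - 1) N = insert j (Finset.Ioc j N) := by
      ext i
      simp only [Finset.mem_Ioc, Finset.mem_insert]
      omega
    rw [this, Finset.prod_insert (by simp)]
  constructor
  · rintro ⟨h, hN⟩
    have : ∀ d, d ≤ N → c (N - d) = ∏ i ∈ Finset.Ioc (N - d) N, -q i / p i := by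
      intro d
      induction d with
      | zero => simp [hN]
      | succ d ih =>
        intro hd
        have h1 := h (N - d) (by omega) (by omega)
        have h2 := step (N - d) (by omega) (by omega)
        rw [Nat.sub_sub] at h1 h2
        rw [h2, ← ih (by omega)]
        have h3 := hp (N - d) (by omega) (by omega)
        field_simp
        linear_combination h1
    intro j hj
    have := this (N - j) (by omega)
    rwa [Nat.sub_sub_self hj] at this
  · intro h
    refine ⟨fun j hj hjN => ?_, by rw [h N le_rfl]; simp⟩
    have h3 := hp j hj hjN
    rw [h _ (by omega), h _ hjN, step j hj hjN]
    field_simp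
    ring

/-- The `a_j(λ)` are the unique solution of the defining recursion with `a_N(λ) = 1`. -/
theorem aCoeff_unique (n N : ℕ) (lam : ℂ) (c : ℕ → ℂ) :
    ((∀ j : ℕ, 1 ≤ j → j ≤ N → ((N : ℂ) - j + 1) * (2 * N - 2 * j + 1) * c (j - 1) +
      j * (n - 1 + 2 * lam - 4 * N + 2 * j) * c j = 0) ∧ c N = 1) ↔
      ∀ j, j ≤ N → c j = aCoeff n N lam j := by
  refine coeff_unique (p := fun j => ((N : ℂ) - j + 1) * (2 * N - 2 * j + 1))
    (q := fun j => (j : ℂ) * (n - 1 + 2 * lam - 4 * N + 2 * j)) fun j _ hjN => ?_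
  obtain ⟨d, rfl⟩ := Nat.exists_eq_add_of_le hjN
  refine mul_ne_zero ?_ ?_
  · have : (((j + d : ℕ) : ℂ) - j + 1) = ((d + 1 : ℕ) : ℂ) := by push_cast; ring
    rw [this]
    exact Nat.cast_ne_zero.2 (by omega)
  · have : (2 * ((j + d : ℕ) : ℂ) - 2 * j + 1) = ((2 * d + 1 : ℕ) : ℂ) := by push_cast; ring
    rw [this]
    exact Nat.cast_ne_zero.2 (by omega)

/-- The `b_j(λ)` are the unique solution of the defining recursion with `b_N(λ) = 1`. -/
theorem bCoeff_unique (n N : ℕ) (lam : ℂ) (c : ℕ → ℂ) :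
    ((∀ j : ℕ, 1 ≤ j → j ≤ N → ((N : ℂ) - j + 1) * (2 * N - 2 * j + 3) * c (j - 1) +
      j * (n - 3 + 2 * lam - 4 * N + 2 * j) * c j = 0) ∧ c N = 1) ↔
      ∀ j, j ≤ N → c j = bCoeff n N lam j := by
  refine coeff_unique (p := fun j => ((N : ℂ) - j + 1) * (2 * N - 2 * j + 3))
    (q := fun j => (j : ℂ) * (n - 3 + 2 * lam - 4 * N + 2 * j)) fun j _ hjN => ?_
  obtain ⟨d, rfl⟩ := Nat.exists_eq_add_of_le hjN
  refine mul_ne_zero ?_ ?_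
  · have : (((j + d : ℕ) : ℂ) - j + 1) = ((d + 1 : ℕ) : ℂ) := by push_cast; ring
    rw [this]
    exact Nat.cast_ne_zero.2 (by omega)
  · have : (2 * ((j + d : ℕ) : ℂ) - 2 * j + 3) = ((2 * d + 3 : ℕ) : ℂ) := by push_cast; ring
    rw [this]
    exact Nat.cast_ne_zero.2 (by omega)

/-- `𝒟_{2N}^0(λ) = ∑_j a_j(λ) Δ_{n-1}^j T_n^{2N-2j}`. -/
def evenD0 (n N : ℕ) (lam : ℂ) : UC (n + 1) :=
  ∑ j ∈ Finset.range (N + 1), aCoeff n N lam j • (lapU n ^ j * TU n ^ (2 * N - 2 * j))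

/-- `𝒟_{2N+1}^0(λ) = ∑_j b_j(λ) Δ_{n-1}^j T_n^{2N-2j+1}`. -/
def oddD0 (n N : ℕ) (lam : ℂ) : UC (n + 1) :=
  ∑ j ∈ Finset.range (N + 1), bCoeff n N lam j • (lapU n ^ j * TU n ^ (2 * N - 2 * j + 1))

/-- The polynomial family `𝒟_N^0(λ) ∈ 𝒰(𝔫_{n+1}^-)`. -/
def D0 (n N : ℕ) (lam : ℂ) : UC (n + 1) :=
  if Even N then evenD0 n (N / 2) lam else oddD0 n (N / 2) lam

/-! ### Principal series as induced representations

A subgroup `S` of `ℝˣ` distinguishes the two cases: `S = ℝˣ` belongs to lines and to the maximal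
parabolic subgroup `P = M A N⁺`; `S = ℝ_{>0}` belongs to rays and to `P̂ = M̂ A N⁺`. -/

/-- For `S = ℝ_{>0}` this is `M̂`, the group `O(1, m-2)` acting on the coordinates other than `0`
and `3`; for `S = ℝˣ` it is `M = {1, -1} M̂`. (On `e₀`, `e₃` the scalar can only be `±1`.) -/
def M (S : Subgroup ℝˣ) (m : ℕ) : Set (G m) :=
  {g | ∃ c ∈ S, mat g *ᵥ Pi.single 0 1 = (c : ℝ) • Pi.single 0 1 ∧
    mat g *ᵥ Pi.single 3 1 = (c : ℝ) • Pi.single 3 1}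

/-- `𝔫⁺`, the `1`-eigenspace of `ad H`. -/
def nPlus (m : ℕ) : Set (𝔤 m) := {X | ⁅H m, X⁆ = X}

/-- The space of `Ind(ξ_λ)`: all `u ∈ C^∞(G^m)` with `u(g μ a ν) = ξ_λ(a) u(g)` for `μ ∈ M`
(resp. `M̂`), `a = exp(tH) ∈ A`, `ν ∈ N⁺ = exp(𝔫⁺)`, where `ξ_λ(exp(tH)) = e^{λt}`. -/
def Ind (S : Subgroup ℝˣ) (m : ℕ) (lam : ℂ) : Submodule ℂ (CG m) where
  carrier := {u | ∀ g : G m, ∀ μ ∈ M S m, ∀ t : ℝ, ∀ X ∈ nPlus m,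
    (u : G m → ℂ) (g * μ * expG (t • H m) * expG X) =
      Complex.exp (lam * t) * (u : G m → ℂ) g}
  zero_mem' := by simp
  add_mem' {u v} hu hv g μ hμ t X hX := by
    have h1 := hu g μ hμ t X hX
    have h2 := hv g μ hμ t X hX
    simp only [Subalgebra.coe_add, Pi.add_apply, h1, h2]
    ring
  smul_mem' c u hu g μ hμ t X hX := by
    have h1 := hu g μ hμ t X hX
    simp only [Subalgebra.coe_smul, Pi.smul_apply, smul_eq_mul, h1]
    ring

/-- Left translation `(π(g) u)(x) = u(g⁻¹ x)` on `Ind(ξ_λ)`. -/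
def indRep (S : Subgroup ℝˣ) (m : ℕ) (lam : ℂ) : Representation ℂ (G m) (Ind S m lam) where
  toFun g :=
    { toFun := fun u => ⟨⟨fun x => (u : G m → ℂ) (g⁻¹ * x), by
        refine SmoothVia.comp (ι := mat) u.1.2 (fun x => g⁻¹ * x) (fun A => mat g⁻¹ * A)
          (contDiff_const.mul contDiff_id) (fun x => rfl)⟩, fun h μ hμ t X hX => by
          have := u.2 (g⁻¹ * h) μ hμ t X hX
          simpa only [mul_assoc] using this⟩
      map_add' := fun _ _ => rfl
      map_smul' := fun _ _ => rfl }
  map_one' := by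
    ext u x
    simp
  map_mul' g h := by
    ext u x
    simp [mul_assoc]

/-- The maximal compact subgroup `K = O(2) × O(m-1)`, i.e. the orthogonal matrices in `G^m`. -/
def K (m : ℕ) : Set (G m) := {g | (mat g)ᵀ * mat g = 1}

/-! ### The Einstein universes -/

/-- The null cone `C_m ⊂ ℝ^{m+1}` without the origin. -/
def Cone (m : ℕ) : Type := {v : Fin (m + 1) → ℝ // v ≠ 0 ∧ v ⬝ᵥ (gram m *ᵥ v) = 0}

/-- The underlying vector of a point of the cone. -/
def Cone.vec {m : ℕ} (v : Cone m) : Fin (m + 1) → ℝ := v.1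

/-- Two points of the cone are equivalent if they differ by a factor in `S`. -/
def scaleSetoid (S : Subgroup ℝˣ) (m : ℕ) : Setoid (Cone m) where
  r v w := ∃ c ∈ S, w.vec = (c : ℝ) • v.vec
  iseqv :=
    { refl := fun v => ⟨1, S.one_mem, by simp⟩
      symm := by
        rintro v w ⟨c, hc, h⟩
        exact ⟨c⁻¹, S.inv_mem hc, by simp [h, smul_smul]⟩
      trans := by
        rintro u v w ⟨c, hc, h⟩ ⟨d, hd, h'⟩
        exact ⟨d * c, S.mul_mem hd hc, by simp [h, h', smul_smul]⟩ }

/-- For `S = ℝˣ` this is `Ein_{m-1}`, the set of lines through the origin in `C_m`; for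
`S = ℝ_{>0}` it is `Êin_{m-1}`, the set of rays. -/
def Ein (S : Subgroup ℝˣ) (m : ℕ) : Type := Quotient (scaleSetoid S m)

/-- The line (resp. ray) through a point of the cone. -/
def Ein.mk (S : Subgroup ℝˣ) {m : ℕ} (v : Cone m) : Ein S m := Quotient.mk (scaleSetoid S m) v

theorem mat_mulVec_ne {m : ℕ} (g : G m) {v : Fin (m + 1) → ℝ} (hv : v ≠ 0) :
    mat g *ᵥ v ≠ 0 := by
  intro h
  apply hv
  have : mat g⁻¹ *ᵥ (mat g *ᵥ v) = v := by
    rw [Matrix.mulVec_mulVec, ← mat_mul, inv_mul_cancel, mat_one, Matrix.one_mulVec]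
  rw [← this, h, Matrix.mulVec_zero]

/-- The linear action of `G^m` on the cone. -/
instance coneAction (m : ℕ) : MulAction (G m) (Cone m) where
  smul g v := ⟨mat g *ᵥ v.vec, mat_mulVec_ne g v.2.1, by
    rw [Matrix.mulVec_mulVec, Matrix.dotProduct_mulVec, ← Matrix.mulVec_transpose,
      Matrix.mulVec_mulVec, Matrix.transpose_mul, gram, Matrix.diagonal_transpose, dotProduct_comm]
    exact (congrArg (fun A => v.vec ⬝ᵥ (A *ᵥ v.vec)) (mat_gram g)).trans v.2.2⟩
  one_smul v := Subtype.ext (Matrix.one_mulVec _)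
  mul_smul g h v := Subtype.ext (Matrix.mulVec_mulVec v.vec (mat g) (mat h)).symm

theorem vec_smul {m : ℕ} (g : G m) (v : Cone m) : (g • v).vec = mat g *ᵥ v.vec := rfl

/-- The induced action of `G^m` on lines (resp. rays). -/
instance einAction (S : Subgroup ℝˣ) (m : ℕ) : MulAction (G m) (Ein S m) where
  smul g := Quotient.map (fun v => g • v) (by
    rintro v w ⟨c, hc, h⟩
    exact ⟨c, hc, by rw [vec_smul, vec_smul, h, Matrix.mulVec_smul]⟩)
  one_smul x := by
    induction x using Quotient.inductionOn with
    | h v => exact congrArg (Ein.mk S) (one_smul (G m) v)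
  mul_smul g h x := by
    induction x using Quotient.inductionOn with
    | h v => exact congrArg (Ein.mk S) (mul_smul g h v)

theorem smul_mk {S : Subgroup ℝˣ} {m : ℕ} (g : G m) (v : Cone m) :
    g • Ein.mk S v = Ein.mk S (g • v) := rfl

/-- `C^∞(Ein_{m-1})`, resp. `C^∞(Êin_{m-1})`, complex valued: a function is smooth if its pull-back
to the cone without the origin (a submanifold of `ℝ^{m+1}`, submersed onto the quotient) is. -/
def CEin (S : Subgroup ℝˣ) (m : ℕ) : Subalgebra ℂ (Ein S m → ℂ) where
  carrier := {F | SmoothVia (Cone.vec : Cone m → _) (F ∘ Ein.mk S)}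
  mul_mem' hu hv := hu.mul hv
  add_mem' hu hv := hu.add hv
  algebraMap_mem' c := SmoothVia.const _ c

/-- The Euclidean norm. -/
def euclNorm {m : ℕ} (v : Fin (m + 1) → ℝ) : ℝ := Real.sqrt (v ⬝ᵥ v)

theorem dot_self_pos {m : ℕ} {v : Fin (m + 1) → ℝ} (hv : v ≠ 0) : 0 < v ⬝ᵥ v :=
  lt_of_le_of_ne (Finset.sum_nonneg fun _ _ => mul_self_nonneg _)
    (fun h => hv (dotProduct_self_eq_zero.1 h.symm))

theorem euclNorm_pos {m : ℕ} {v : Fin (m + 1) → ℝ} (hv : v ≠ 0) : 0 < euclNorm v :=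
  Real.sqrt_pos.2 (dot_self_pos hv)

/-- The factor `|g v| / |v|` by which `g` stretches the line (resp. ray) through `v`. -/
def stretch {S : Subgroup ℝˣ} {m : ℕ} (g : G m) (x : Ein S m) : ℝ :=
  Quotient.lift (fun v : Cone m => euclNorm (mat g *ᵥ v.vec) / euclNorm v.vec) (by
    rintro v w ⟨c, hc, h⟩
    have key : ∀ z : Fin (m + 1) → ℝ, euclNorm ((c : ℝ) • z) = |(c : ℝ)| * euclNorm z := by
      intro z
      rw [euclNorm, euclNorm, smul_dotProduct, dotProduct_smul, smul_smul,
        smul_eq_mul, Real.sqrt_mul (mul_self_nonneg _), Real.sqrt_mul_self_eq_abs]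
    simp only [h, Matrix.mulVec_smul, key]
    rw [mul_div_mul_left _ _ (abs_ne_zero.2 c.ne_zero)]) x

theorem stretch_mk {S : Subgroup ℝˣ} {m : ℕ} (g : G m) (v : Cone m) :
    stretch g (Ein.mk S v) = euclNorm (mat g *ᵥ v.vec) / euclNorm v.vec := rfl

theorem stretch_pos {S : Subgroup ℝˣ} {m : ℕ} (g : G m) (x : Ein S m) : 0 < stretch g x := by
  induction x using Quotient.inductionOn with
  | h v => exact div_pos (euclNorm_pos (mat_mulVec_ne g v.2.1)) (euclNorm_pos v.2.1)

theorem stretch_one {S : Subgroup ℝˣ} {m : ℕ} (x : Ein S m) : stretch (1 : G m) x = 1 := by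
  induction x using Quotient.inductionOn with
  | h v =>
    change euclNorm (mat 1 *ᵥ v.vec) / euclNorm v.vec = 1
    rw [mat_one, Matrix.one_mulVec, div_self (euclNorm_pos (v := v.vec) v.2.1).ne']

theorem stretch_mul {S : Subgroup ℝˣ} {m : ℕ} (g h : G m) (x : Ein S m) :
    stretch (g * h) x = stretch g (h • x) * stretch h x := by
  induction x using Quotient.inductionOn with
  | h v =>
    change euclNorm (mat (g * h) *ᵥ v.vec) / euclNorm v.vec =
      euclNorm (mat g *ᵥ (mat h *ᵥ v.vec)) / euclNorm (mat h *ᵥ v.vec) *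
        (euclNorm (mat h *ᵥ v.vec) / euclNorm v.vec)
    have := (euclNorm_pos (mat_mulVec_ne h v.2.1)).ne'
    rw [mat_mul, Matrix.mulVec_mulVec, div_mul_div_cancel₀]
    exact this

theorem contDiff_mulVec {m : ℕ} (A : Matrix (Fin (m + 1)) (Fin (m + 1)) ℝ) :
    ContDiff ℝ ∞ (fun v : Fin (m + 1) → ℝ => A *ᵥ v) :=
  (LinearMap.toContinuousLinearMap (Matrix.mulVecLin A)).contDiff

theorem contDiffAt_euclNorm {m : ℕ} {v : Fin (m + 1) → ℝ} (hv : v ≠ 0) :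
    ContDiffAt ℝ ∞ (euclNorm : (Fin (m + 1) → ℝ) → ℝ) v := by
  refine ContDiffAt.sqrt ?_ (dot_self_pos hv).ne'
  unfold dotProduct
  fun_prop

theorem smooth_stretch (S : Subgroup ℝˣ) {m : ℕ} (g : G m) (lam : ℂ) :
    SmoothVia (Cone.vec : Cone m → _)
      (fun v => Complex.exp (lam * Real.log (stretch g (Ein.mk S v)))) := by
  intro v
  refine ⟨{0}ᶜ, isOpen_compl_singleton, v.2.1, fun w => Complex.exp (lam *
    (Real.log (euclNorm (mat g *ᵥ w) / euclNorm w) : ℝ)), ?_, fun w _ => rfl⟩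
  intro w hw
  have hw : w ≠ 0 := hw
  have h1 : ContDiffAt ℝ ∞ (fun w => Real.log (euclNorm (mat g *ᵥ w) / euclNorm w)) w := by
    refine ContDiffAt.log (ContDiffAt.div ?_ (contDiffAt_euclNorm hw) (euclNorm_pos hw).ne')
      (div_pos (euclNorm_pos (mat_mulVec_ne g hw)) (euclNorm_pos hw)).ne'
    exact ContDiffAt.comp (g := (euclNorm : (Fin (m + 1) → ℝ) → ℝ)) w
      (contDiffAt_euclNorm (mat_mulVec_ne g hw))
      (contDiff_mulVec (mat g)).contDiffAt
  exact (ContDiffAt.cexp (contDiffAt_const.mul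
    (Complex.ofRealCLM.contDiff.contDiffAt.comp w h1))).contDiffWithinAt

/-- The compact realization: the `G^m`-module `C^∞(Ein_{m-1})_λ`, resp. `C^∞(Êin_{m-1})_λ`, with
`(π^c_λ(g) F)(x) = F(g⁻¹ x) e^{λ H(g⁻¹ k)}` for `x` the line (resp. ray) of `k(e₀ + e₃)`, `k ∈ K`.
In the decomposition `g⁻¹ k = κ μ e^{H(g⁻¹ k)H} ν` one has
`g⁻¹ k (e₀ + e₃) = ± e^{H(g⁻¹ k)} κ (e₀ + e₃)`, whence `κ(e₀ + e₃)` spans `g⁻¹ x` and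
`e^{H(g⁻¹ k)}` is the factor by which `g⁻¹` stretches `x`. -/
def compactRep (S : Subgroup ℝˣ) (m : ℕ) (lam : ℂ) : Representation ℂ (G m) (CEin S m) where
  toFun g :=
    { toFun := fun F => ⟨fun x => (F : Ein S m → ℂ) (g⁻¹ • x) *
          Complex.exp (lam * Real.log (stretch g⁻¹ x)), by
        exact (SmoothVia.comp (κ := (Cone.vec : Cone m → _)) F.2 (fun v => g⁻¹ • v) _
          (contDiff_mulVec (mat g⁻¹)) (fun v => rfl)).mul (smooth_stretch S g⁻¹ lam)⟩
      map_add' := fun F F' => by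
        ext x
        exact add_mul _ _ _
      map_smul' := fun c F => by
        ext x
        exact mul_assoc _ _ _ }
  map_one' := by
    ext F x
    simp [stretch_one]
  map_mul' g h := by
    ext F x
    simp only [LinearMap.coe_mk, AddHom.coe_mk, Module.End.mul_apply, mul_inv_rev, mul_smul]
    rw [stretch_mul, Real.log_mul (stretch_pos _ _).ne' (stretch_pos _ _).ne', Complex.ofReal_add,
      mul_add, Complex.exp_add]
    ring

/-! ### The embedding of the Einstein universes and differential operators along it -/

/-- The inclusion `v ↦ (v, 0)` of `ℝ^{m+1}` in `ℝ^{m+2}`. -/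
def vecIncl {m : ℕ} (v : Fin (m + 1) → ℝ) : Fin (m + 1 + 1) → ℝ :=
  Sum.elim v (0 : Fin 1 → ℝ) ∘ finSumFinEquiv.symm

/-- The inclusion of the cones. -/
def coneIncl {m : ℕ} (v : Cone m) : Cone (m + 1) :=
  ⟨vecIncl v.vec, by
    intro h
    apply v.2.1
    funext i
    have := congrFun h (finSumFinEquiv (Sum.inl i))
    simpa [vecIncl, Cone.vec] using this, by
    rw [gram_succ]
    have h := v.2.2
    simpa [vecIncl, Matrix.submatrix_mulVec_equiv, Matrix.fromBlocks_mulVec, Function.comp_assoc,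
      dotProduct_comp_equiv_symm, Cone.vec] using h⟩

/-- The embedding `Ein_{m-1} → Ein_m`, resp. `Êin_{m-1} → Êin_m`. -/
def einIncl (S : Subgroup ℝˣ) (m : ℕ) : Ein S m → Ein S (m + 1) :=
  Quotient.map coneIncl (by
    rintro v w ⟨c, hc, h⟩
    refine ⟨c, hc, ?_⟩
    funext i
    obtain ⟨i, rfl⟩ := finSumFinEquiv.surjective i
    rcases i with i | i
    · simpa [coneIncl, Cone.vec, vecIncl] using congrFun h i
    · simp [coneIncl, Cone.vec, vecIncl])

/-- The restriction of smooth functions along this embedding. -/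
def pullEin (S : Subgroup ℝˣ) (m : ℕ) : CEin S (m + 1) →ₐ[ℂ] CEin S m where
  toFun F := ⟨F ∘ einIncl S m, by
    refine SmoothVia.comp (κ := (Cone.vec : Cone m → _)) F.2 coneIncl vecIncl ?_ (fun _ => rfl)
    rw [contDiff_pi]
    intro i
    obtain ⟨i, rfl⟩ := finSumFinEquiv.surjective i
    rcases i with i | i
    · simp only [vecIncl, Function.comp_apply, Equiv.symm_apply_apply, Sum.elim_inl]
      fun_prop
    · simp only [vecIncl, Function.comp_apply, Equiv.symm_apply_apply, Sum.elim_inr]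
      fun_prop⟩
  map_one' := rfl
  map_mul' _ _ := rfl
  map_zero' := rfl
  map_add' _ _ := rfl
  commutes' _ := rfl

/-- A linear map between function algebras is a differential operator of order at most `k` along
the algebra homomorphism `φ` (here: the restriction to a submanifold) if its iterated commutators
`D ∘ a - φ(a) ∘ D` with `k + 1` functions vanish. -/
def IsDiffOpAlong {A B : Type*} [CommRing A] [Algebra ℂ A] [CommRing B] [Algebra ℂ B]
    (φ : A →ₐ[ℂ] B) : ℕ → (A →ₗ[ℂ] B) → Prop
  | 0, D => ∀ a f, D (a * f) = φ a * D f
  | k + 1, D => ∀ a, IsDiffOpAlong φ k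
      (D ∘ₗ LinearMap.mulLeft ℂ a - LinearMap.mulLeft ℂ (φ a) ∘ₗ D)

/-- A family of linear maps that depends polynomially on the complex parameter. -/
def IsPolynomialFamily {V W : Type*} [AddCommGroup V] [Module ℂ V] [AddCommGroup W] [Module ℂ W]
    (D : ℂ → V →ₗ[ℂ] W) : Prop :=
  ∃ (d : ℕ) (B : ℕ → V →ₗ[ℂ] W), ∀ lam, D lam = ∑ j ∈ Finset.range (d + 1), lam ^ j • B j

/-- `δ` is the isomorphism of `G^m`-modules from `Ind(ξ_λ)` onto its compact realization that is
given by restriction to `K`: `(δ u)(k (e₀ + e₃)) = u(k)`. -/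
def IsCompactRealization (S : Subgroup ℝˣ) (m : ℕ) (lam : ℂ)
    (δ : Ind S m lam ≃ₗ[ℂ] CEin S m) : Prop :=
  (∀ u : Ind S m lam, ∀ k ∈ K m, ∀ v : Cone m,
    v.vec = mat k *ᵥ (Pi.single 0 1 + Pi.single 3 1) →
      (δ u : Ein S m → ℂ) (Ein.mk S v) = (u : G m → ℂ) k) ∧
  ∀ (g : G m) (u : Ind S m lam), δ (indRep S m lam g u) = compactRep S m lam g (δ u)

/-- The operators `i^* ∘ 𝒟_N^0(λ)` map `Ind(ξ_λ)` for `G^{n+1}` to `Ind(ξ_{λ-N})` for `G^n`, and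
in the compact realizations they define a polynomial family of `G^n`-equivariant differential
operators (of order at most `N`). -/
def DefinesEquivariantFamily (S : Subgroup ℝˣ) (n N : ℕ) : Prop :=
  ∃ (δ : ∀ lam : ℂ, Ind S (n + 1) lam ≃ₗ[ℂ] CEin S (n + 1))
    (δ' : ∀ lam : ℂ, Ind S n lam ≃ₗ[ℂ] CEin S n)
    (D : ∀ lam : ℂ, Ind S (n + 1) lam →ₗ[ℂ] Ind S n (lam - N))
    (Dc : ℂ → CEin S (n + 1) →ₗ[ℂ] CEin S n),
    (∀ lam, IsCompactRealization S (n + 1) lam (δ lam)) ∧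
    (∀ lam, IsCompactRealization S n lam (δ' lam)) ∧
    (∀ lam (u : Ind S (n + 1) lam),
      (D lam u : CG n) = restrictG n (RU (n + 1) (D0 n N lam) u)) ∧
    (∀ lam (u : Ind S (n + 1) lam), Dc lam (δ lam u) = δ' (lam - N) (D lam u)) ∧
    (∀ lam (g : G n) (F : CEin S (n + 1)),
      Dc lam (compactRep S (n + 1) lam (incl n g) F) =
        compactRep S n (lam - N) g (Dc lam F)) ∧
    (∀ lam, IsDiffOpAlong (pullEin S n) N (Dc lam)) ∧
    IsPolynomialFamily Dc

end EinsteinFamilies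

end

open scoped ContDiff Matrix TensorProduct

noncomputable section

namespace EinsteinFamilies

/-! ### The intertwining relation in an abstract module -/

section Abstract

variable {V ι : Type*} [AddCommGroup V] [Module ℂ V] [DecidableEq ι]

/-! The enveloping algebra acts by left-invariant operators, so `i^* ∘ 𝒟_N^0(λ)` commutes with left
translation by `G^n` for free. What has to be shown is that its values again transform correctly
under right translation by the parabolic subgroup of `G^n`, and this is done factor by factor.

For `N⁺` it suffices that `𝔫⁺_n` annihilates `𝒟_N^0(λ) u`. Moving `E = L_{0k} + L_{3k}` to the right
through `Δ^j T^p` until it reaches `u`, which `E` and the rotations kill and on which `H` acts by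
`λ`, leaves two multiples of terms `I_k Δ^i T^q u`. In the sum over `j` the multiples coming from
`j` and `j + 1` meet on the same term, and the recursion for the coefficients says exactly that they
cancel. This is `raise_family`, applied on the group in `raise_D0_eq_zero`.

For `M` and `A`, let `g ∈ G^n` scale `e₀ - e₃` by `c`. Conjugation by `g` multiplies `T` by `c` and
`Δ` by `c²`, hence `𝒟_N^0(λ)` by `c^N` (`rightTrans_D0`). For `exp(tH)` one has `c = e^{-t}`, which
turns `λ` into `λ - N`. For elements of `M` one has `c = ±1`, which is why lines require even `N`;
on `M̂` one has `c = 1`, so rays allow every `N`. The three factors are assembled in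
`restrictG_D0_mem_Ind`.

For the compact realization, let `π(g) = [g(e₀ + e₃)]` and let `s_λ(g)` be the `λ`-th power of the
factor by which `g` stretches `e₀ + e₃`. Then `F ↦ s_λ · (F ∘ π)` is a bijection onto the induced
representation: `G^m` is transitive on the cone (`exists_mulVec_ePlus`), the stabilizer of `e₀ + e₃`
is `M̂ N⁺` (`exists_of_fixes_ePlus`), and `π` has smooth local sections (`exists_of_mem_Ind`). The
operator `D^c` is thus determined by `s_{λ-N} · π^*(D^c F) = i^* 𝒟_N^0(λ)(s_λ · π^* F)`. Its order
is read off from this identity on the group (`IsDiffOpAlong.transport`). Conjugation by `s_λ` adds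
`λ` times a fixed function to each vector field, so the right-hand side is polynomial in `λ` up to
the factor `s_λ`; interpolation brings this back to `D^c` (`IsPolynomialFamily.of_injective`). -/

theorem comm_laplace {s : Finset ι} {k i : ι} (hk : k ∈ s) (hi : i ∈ s)
    {η : ι → ℂ} (hη : ∀ i, η i * η i = 1) {I R : ι → Module.End ℂ V}
    (hI : ∀ i j, I i * I j = I j * I i)
    (hR : ∀ i j, R i * I j = I j * R i + (if i = j then η i • I k else 0) -
      (if k = j then η k • I i else 0)) :
    R i * ∑ j ∈ s, η j • I j ^ 2 = (∑ j ∈ s, η j • I j ^ 2) * R i := by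
  -- Only `j = i` and `j = k` contribute. Since `η_j² = 1` the contributions are `2 I_k I_i` and `-2
  -- I_k I_i`, and they cancel because both indices lie in `s`.
  have h : ∀ j, R i * (η j • I j ^ 2) = (η j • I j ^ 2) * R i +
      ((if i = j then (2 : ℂ) • (I k * I i) else 0) -
        (if k = j then (2 : ℂ) • (I k * I i) else 0)) := by
    intro j
    have h1 : R i * I j ^ 2 = I j ^ 2 * R i +
        ((if i = j then (2 * η i) • (I k * I i) else 0) -
          (if k = j then (2 * η k) • (I k * I i) else 0)) := by
      rw [sq, ← mul_assoc, hR, sub_mul, add_mul, mul_assoc (I j) (R i), hR]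
      by_cases hij : i = j
      · subst hij
        by_cases hki : k = i
        · subst hki; simp [mul_assoc]
        · simp only [if_true, hki, if_false, sub_zero, zero_mul, mul_add, mul_assoc, smul_mul_assoc,
            mul_smul_comm, hI i k, mul_smul]
          module
      · by_cases hkj : k = j
        · subst hkj
          simp only [if_true, hij, if_false, add_zero, zero_mul, mul_sub, mul_assoc, smul_mul_assoc,
            mul_smul_comm, hI i k, mul_smul]
          module
        · simp [hij, hkj, mul_assoc]
    rw [mul_smul_comm, h1, smul_add, smul_mul_assoc, smul_sub]
    congr 2
    · split_ifs with hij
      · subst hij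
        rw [smul_smul, mul_left_comm, hη, mul_one]
      · simp
    · split_ifs with hij
      · subst hij
        rw [smul_smul, mul_left_comm, hη, mul_one]
      · simp
  rw [Finset.mul_sum, Finset.sum_congr rfl fun j _ => h j, Finset.sum_add_distrib,
    Finset.sum_sub_distrib, Finset.sum_ite_eq, Finset.sum_ite_eq, if_pos hk, if_pos hi, sub_self,
    add_zero, Finset.sum_mul]

/-- Normal ordering puts `H` and the `R_j` on the right, where they act on weight vectors. Moving
`R_j` past `I_j` costs `2 I_k` for each of the `s.card` indices, and the index `k` contributes
another `-4 I_k`; hence the constant `2 (s.card - 2)`. -/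
theorem raise_laplace {s : Finset ι} {k : ι} (hk : k ∈ s)
    {η : ι → ℂ} (hη : ∀ i, η i * η i = 1) {I R : ι → Module.End ℂ V} {E H : Module.End ℂ V}
    (hR : ∀ i j, R i * I j = I j * R i + (if i = j then η i • I k else 0) -
      (if k = j then η k • I i else 0))
    (hH : ∀ j, H * I j = I j * H - I j)
    (hE : ∀ j, E * I j = I j * E + (2 : ℂ) • R j + (if k = j then (2 * η k) • H else 0)) :
    E * ∑ j ∈ s, η j • I j ^ 2 = (∑ j ∈ s, η j • I j ^ 2) * E + (4 : ℂ) • (I k * H) +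
      (4 : ℂ) • (∑ j ∈ s, η j • (I j * R j)) + (2 * (s.card - 2) : ℂ) • I k := by
  have h : ∀ j, E * (η j • I j ^ 2) = (η j • I j ^ 2) * E + (4 : ℂ) • (η j • (I j * R j)) +
      (2 : ℂ) • I k + (if k = j then (4 : ℂ) • (I k * H) - (4 : ℂ) • I k else 0) := by
    intro j
    have h1 : E * I j ^ 2 = I j ^ 2 * E + (4 : ℂ) • (I j * R j) +
        (2 * η j) • I k + (if k = j then (4 * η k) • (I k * H) - (4 * η k) • I k else 0) := by
      rw [sq, ← mul_assoc, hE, add_mul, add_mul, mul_assoc (I j) E, hE, smul_mul_assoc, hR]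
      by_cases hkj : k = j
      · subst hkj
        simp only [if_true, mul_add, mul_assoc, smul_mul_assoc, mul_smul_comm, hH, mul_smul]
        module
      · simp only [if_true, hkj, if_false, add_zero, zero_mul, sub_zero, mul_add, mul_assoc, mul_smul_comm,
          mul_smul]
        module
    have h2 : η j • (2 * η j) • I k = (2 : ℂ) • I k := by
      rw [smul_smul, mul_left_comm, hη, mul_one]
    rw [mul_smul_comm, h1, smul_add, smul_add, smul_add, h2, smul_mul_assoc, smul_comm (η j) (4 : ℂ)]
    congr 1
    split_ifs with hij
    · subst hij
      rw [smul_sub, smul_smul, smul_smul, mul_left_comm, hη, mul_one]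
    · simp
  rw [Finset.mul_sum, Finset.sum_congr rfl fun j _ => h j, Finset.sum_add_distrib,
    Finset.sum_add_distrib, Finset.sum_add_distrib, Finset.sum_ite_eq, if_pos hk, Finset.sum_mul,
    Finset.smul_sum, Finset.sum_const, ← Nat.cast_smul_eq_nsmul ℂ, smul_smul]
  module

/-- The algebraic core. The exponents `p = 2(N - j) + ε` treat both parities at once, and `ha` is
the condition that the coefficient of each `I_k L^j T^(p - 2) u` vanishes. -/
theorem raise_family {s : Finset ι} {k : ι} (hk : k ∈ s)
    {η : ι → ℂ} (hη : ∀ i, η i * η i = 1) {I R : ι → Module.End ℂ V}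
    {E H T Q : Module.End ℂ V} {lam : ℂ} {u : V}
    (hI : ∀ i j, I i * I j = I j * I i) (hIT : ∀ i, I i * T = T * I i)
    (hR : ∀ i j, R i * I j = I j * R i + (if i = j then η i • I k else 0) -
      (if k = j then η k • I i else 0))
    (hRT : ∀ i, R i * T = T * R i)
    (hH : ∀ j, H * I j = I j * H - I j) (hHT : H * T = T * H - T)
    (hE : ∀ j, E * I j = I j * E + (2 : ℂ) • R j + (if k = j then (2 * η k) • H else 0))
    (hET : E * T = T * E + (2 : ℂ) • Q) (hQT : Q * T = T * Q + I k)
    (hEu : E u = 0) (hRu : ∀ i, R i u = 0) (hQu : Q u = 0) (hHu : H u = lam • u)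
    (N ε : ℕ) (hε : ε ≤ 1) (a : ℕ → ℂ)
    (ha : ∀ j < N, ((2 * (N - j) + ε : ℕ) : ℂ) * (2 * (N - j) + ε - 1 : ℕ) * a j +
      ((j : ℂ) + 1) * (4 * (lam - (2 * (N - (j + 1)) + ε : ℕ)) + 2 * (s.card - 2) - 4 * j) *
        a (j + 1) = 0) :
    E (∑ j ∈ Finset.range (N + 1),
      a j • ((∑ j ∈ s, η j • I j ^ 2) ^ j * T ^ (2 * (N - j) + ε)) u) = 0 := by
  have hRL : ∀ i ∈ s, Commute (R i) (∑ j ∈ s, η j • I j ^ 2) := fun i hi =>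
    comm_laplace hk hi hη hI hR
  have hIL : Commute (I k) (∑ j ∈ s, η j • I j ^ 2) :=
    Commute.sum_right _ _ _ fun j _ => ((Commute.pow_right (hI k j) 2).smul_right _)
  have hEL := raise_laplace (E := E) (H := H) hk hη hR hH hE
  have hHL : H * (∑ j ∈ s, η j • I j ^ 2) = (∑ j ∈ s, η j • I j ^ 2) * H -
      (2 : ℂ) • (∑ j ∈ s, η j • I j ^ 2) := by
    rw [Finset.mul_sum, Finset.sum_mul, Finset.smul_sum, ← Finset.sum_sub_distrib]
    refine Finset.sum_congr rfl fun j _ => ?_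
    rw [mul_smul_comm, sq, ← mul_assoc, hH, sub_mul, mul_assoc (I j) H, hH, mul_sub]
    simp only [smul_mul_assoc, mul_assoc]
    module
  generalize hL : (∑ j ∈ s, η j • I j ^ 2) = L at *
  have app : ∀ (A B : Module.End ℂ V) (v : V), (A * B) v = A (B v) := fun _ _ _ => rfl
  have hHTp : ∀ p : ℕ, H ((T ^ p) u) = (lam - p) • (T ^ p) u := by
    intro p
    induction p with
    | zero => simp [hHu]
    | succ p ih =>
      rw [pow_succ', app, ← app H, hHT, LinearMap.sub_apply, app, ih, map_smul]
      push_cast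
      module
  have hRTp : ∀ i (p : ℕ), R i ((T ^ p) u) = 0 := by
    intro i p
    rw [← app, (Commute.pow_right (hRT i) p).eq, app, hRu, map_zero]
  have hQTp : ∀ p : ℕ, Q ((T ^ (p + 1)) u) = ((p : ℂ) + 1) • I k ((T ^ p) u) := by
    intro p
    induction p with
    | zero => simp [← app, hQT, hQu]
    | succ p ih =>
      rw [pow_succ' T (p + 1), app, ← app Q, hQT, LinearMap.add_apply, app, ih, map_smul,
        ← app T (I k), ← hIT, app, ← app T, ← pow_succ']
      push_cast
      module
  -- The factor is `∑ 2q` over `q < p`. It vanishes for `p ≤ 1`, so the truncated exponent `p - 2`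
  -- does no harm.
  have hETp : ∀ p : ℕ, E ((T ^ p) u) = ((p : ℂ) * ((p - 1 : ℕ) : ℂ)) • I k ((T ^ (p - 2)) u) := by
    intro p
    induction p with
    | zero => simp [hEu]
    | succ p ih =>
      rw [pow_succ' T p, app, ← app E, hET, LinearMap.add_apply, app, ih, LinearMap.smul_apply]
      rcases p with _ | _ | p
      · simp [hQu]
      · simp [← app, hQT, hQu]
      · rw [hQTp (p + 1), map_smul, ← app T (I k), ← hIT, app, ← app T]
        simp only [Nat.add_sub_cancel, show p + 1 + 1 - 2 = p by omega,
          show p + 1 + 1 - 1 = p + 1 by omega, show p + 1 + 1 + 1 - 2 = p + 1 by omega,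
          ← pow_succ']
        push_cast
        module
  have hHLp : ∀ j p : ℕ, H ((L ^ j) ((T ^ p) u)) = (lam - p - 2 * j) • (L ^ j) ((T ^ p) u) := by
    intro j p
    induction j with
    | zero => simp [hHTp]
    | succ j ih =>
      rw [pow_succ' L, app, ← app H, hHL, LinearMap.sub_apply, app, ih, map_smul,
        LinearMap.smul_apply]
      push_cast
      module
  have hRLp : ∀ i ∈ s, ∀ j p : ℕ, R i ((L ^ j) ((T ^ p) u)) = 0 := by
    intro i hi j p
    rw [← app, ((hRL i hi).pow_right j).eq, app, hRTp, map_zero]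
  -- The coefficient is the sum of `4(λ - p - 2i) + 2(s.card - 2)` over `i < j`, where `λ - p - 2i`
  -- is the `H`-weight of `L^i T^p u`.
  have hELp : ∀ j p : ℕ, E ((L ^ j) ((T ^ p) u)) = (L ^ j) (E ((T ^ p) u)) +
      ((j : ℂ) * (4 * (lam - p) + 2 * (s.card - 2) - 4 * (j - 1))) •
        I k ((L ^ (j - 1)) ((T ^ p) u)) := by
    intro j p
    induction j with
    | zero => simp
    | succ j ih =>
      have hz : (∑ j ∈ s, η j • (I j * R j)) ((L ^ j) ((T ^ p) u)) = 0 := by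
        rw [LinearMap.sum_apply]
        refine Finset.sum_eq_zero fun i hi => ?_
        rw [LinearMap.smul_apply, app, hRLp i hi, map_zero, smul_zero]
      rw [pow_succ' L, app, ← app E, hEL, LinearMap.add_apply, LinearMap.add_apply,
        LinearMap.add_apply, app, ih, LinearMap.smul_apply, LinearMap.smul_apply, hz,
        LinearMap.smul_apply, app (I k), hHLp, map_smul, map_add, map_smul, Nat.add_sub_cancel,
        app L (L ^ j)]
      rcases j with _ | j
      · simp
        module
      · simp only [Nat.add_sub_cancel]
        rw [← app L (I k), ← hIL.eq, app, ← app L (L ^ j), ← pow_succ' L j]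
        push_cast
        module
  rw [map_sum]
  have h1 : ∀ j : ℕ, E (a j • (L ^ j * T ^ (2 * (N - j) + ε)) u) =
      (((2 * (N - j) + ε : ℕ) : ℂ) * (2 * (N - j) + ε - 1 : ℕ) * a j) •
        (L ^ j) (I k ((T ^ (2 * (N - j) + ε - 2)) u)) +
      ((j : ℂ) * (4 * (lam - (2 * (N - j) + ε : ℕ)) + 2 * (s.card - 2) - 4 * (j - 1)) * a j) •
        I k ((L ^ (j - 1)) ((T ^ (2 * (N - j) + ε)) u)) := by
    intro j
    rw [map_smul, app, hELp, hETp, map_smul]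
    module
  -- The first family of terms ends before `j = N`, since there the exponent of `T` is `ε ≤ 1`. The
  -- second starts after `j = 0`. After a shift of the index the two families match term by term.
  have hlast : ((2 * (N - N) + ε : ℕ) : ℂ) * (2 * (N - N) + ε - 1 : ℕ) * a N = 0 := by
    have : 2 * (N - N) + ε - 1 = 0 := by omega
    rw [this]
    simp
  rw [Finset.sum_congr rfl fun j _ => h1 j, Finset.sum_add_distrib, Finset.sum_range_succ, hlast,
    zero_smul, add_zero, Finset.sum_range_succ']
  simp only [Nat.cast_zero, zero_mul, zero_smul, add_zero]
  rw [← Finset.sum_add_distrib]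
  refine Finset.sum_eq_zero fun j hj => ?_
  have hj : j < N := Finset.mem_range.1 hj
  rw [Nat.add_sub_cancel, show 2 * (N - j) + ε - 2 = 2 * (N - (j + 1)) + ε by omega,
    ← app (L ^ j), ← (hIL.pow_right j).eq, app, ← add_smul]
  convert zero_smul ℂ _
  rw [← ha j hj]
  push_cast
  ring

end Abstract

/-! ### Differential operators along an algebra homomorphism -/

section DiffOp

variable {A B : Type*} [CommRing A] [Algebra ℂ A] [CommRing B] [Algebra ℂ B] {φ : A →ₐ[ℂ] B}

theorem isDiffOpAlong_zero (k : ℕ) : IsDiffOpAlong φ k (0 : A →ₗ[ℂ] B) := by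
  induction k with
  | zero => intro a f; simp
  | succ k ih => intro a; simpa using ih

theorem IsDiffOpAlong.add {k : ℕ} {D E : A →ₗ[ℂ] B} (hD : IsDiffOpAlong φ k D)
    (hE : IsDiffOpAlong φ k E) : IsDiffOpAlong φ k (D + E) := by
  induction k generalizing D E with
  | zero => intro a f; simp [hD a f, hE a f, mul_add]
  | succ k ih =>
    intro a
    convert ih (hD a) (hE a) using 1
    ext f
    simp [mul_add]
    ring

theorem IsDiffOpAlong.smul {k : ℕ} {D : A →ₗ[ℂ] B} (hD : IsDiffOpAlong φ k D) (c : ℂ) :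
    IsDiffOpAlong φ k (c • D) := by
  induction k generalizing D with
  | zero => intro a f; simp [hD a f]
  | succ k ih =>
    intro a
    convert ih (hD a) using 1
    ext f
    simp [smul_sub]

theorem IsDiffOpAlong.sum {k : ℕ} {ι : Type*} {s : Finset ι} {D : ι → A →ₗ[ℂ] B}
    (hD : ∀ i ∈ s, IsDiffOpAlong φ k (D i)) : IsDiffOpAlong φ k (∑ i ∈ s, D i) :=
  Finset.sum_induction D (IsDiffOpAlong φ k) (fun _ _ => IsDiffOpAlong.add)
    (isDiffOpAlong_zero k) hD

theorem IsDiffOpAlong.commutator_eq_zero {D : A →ₗ[ℂ] B} (hD : IsDiffOpAlong φ 0 D) (a : A) :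
    D ∘ₗ LinearMap.mulLeft ℂ a - LinearMap.mulLeft ℂ (φ a) ∘ₗ D = 0 := by
  ext f
  simp [hD a f]

theorem IsDiffOpAlong.succ {k : ℕ} {D : A →ₗ[ℂ] B} (hD : IsDiffOpAlong φ k D) :
    IsDiffOpAlong φ (k + 1) D := by
  induction k generalizing D with
  | zero =>
    intro a
    rw [hD.commutator_eq_zero]
    exact isDiffOpAlong_zero 0
  | succ k ih => exact fun a => ih (hD a)

theorem IsDiffOpAlong.mono {k l : ℕ} (h : k ≤ l) {D : A →ₗ[ℂ] B} (hD : IsDiffOpAlong φ k D) :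
    IsDiffOpAlong φ l D := by
  induction h with
  | refl => exact hD
  | step _ ih => exact ih.succ

/-- By `[DE, a] = [D, a] E + D [E, a]`, each summand has total order one less, so induction on `k +
l` applies. A factor of order `0` has vanishing commutators and drops out. -/
theorem isDiffOpAlong_mul {k l : ℕ} {D E : Module.End ℂ A}
    (hD : IsDiffOpAlong (AlgHom.id ℂ A) k D) (hE : IsDiffOpAlong (AlgHom.id ℂ A) l E) :
    IsDiffOpAlong (AlgHom.id ℂ A) (k + l) (D * E) := by
  have key : ∀ (a : A) (D E : Module.End ℂ A),
      (D * E) ∘ₗ LinearMap.mulLeft ℂ a - LinearMap.mulLeft ℂ (AlgHom.id ℂ A a) ∘ₗ (D * E) =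
      (D ∘ₗ LinearMap.mulLeft ℂ a - LinearMap.mulLeft ℂ (AlgHom.id ℂ A a) ∘ₗ D : Module.End ℂ A) * E
      + D * (E ∘ₗ LinearMap.mulLeft ℂ a - LinearMap.mulLeft ℂ (AlgHom.id ℂ A a) ∘ₗ E) := by
    intro a D E
    ext f
    simp
  obtain ⟨n, hn⟩ : ∃ n, k + l = n := ⟨_, rfl⟩
  induction n generalizing k l D E with
  | zero =>
    obtain ⟨rfl, rfl⟩ : k = 0 ∧ l = 0 := by omega
    intro a f
    have h1 := hE a f
    have h2 := hD a (E f)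
    simp only [Module.End.mul_apply, AlgHom.id_apply] at *
    rw [h1, h2]
  | succ n ih =>
    rw [hn]
    intro a
    rw [key]
    refine IsDiffOpAlong.add ?_ ?_
    · rcases k with _ | k
      · rw [hD.commutator_eq_zero, zero_mul]
        exact isDiffOpAlong_zero n
      · have h : k + l = n := by omega
        exact h ▸ ih (hD a) hE h
    · rcases l with _ | l
      · rw [hE.commutator_eq_zero, mul_zero]
        exact isDiffOpAlong_zero n
      · have h : k + l = n := by omega
        exact h ▸ ih hD (hE a) h

theorem isDiffOpAlong_one : IsDiffOpAlong (AlgHom.id ℂ A) 0 (1 : Module.End ℂ A) :=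
  fun _ _ => rfl

theorem isDiffOpAlong_pow {k : ℕ} {D : Module.End ℂ A}
    (hD : IsDiffOpAlong (AlgHom.id ℂ A) k D) (p : ℕ) :
    IsDiffOpAlong (AlgHom.id ℂ A) (p * k) (D ^ p) := by
  induction p with
  | zero => simpa using isDiffOpAlong_one
  | succ p ih =>
    rw [pow_succ, add_mul, one_mul]
    exact isDiffOpAlong_mul ih hD

theorem isDiffOpAlong_of_leibniz {D : Module.End ℂ A} (hD : ∀ a f, D (a * f) = a * D f + D a * f) :
    IsDiffOpAlong (AlgHom.id ℂ A) 1 D := by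
  intro a b f
  simp [hD]
  ring

/-- Multiplications by `s` and `r` commute with all multiplications, so the commutator of `D` with
`a` is related to that of `E` with `p a` by the same identity. Injectivity of `q` and invertibility
of `r` enter only in order `0`. This allows orders on the Einstein universe to be computed on the
group. -/
theorem IsDiffOpAlong.transport {A' B' : Type*} [CommRing A'] [Algebra ℂ A'] [CommRing B']
    [Algebra ℂ B'] {φ' : A' →ₐ[ℂ] B'} {p : A →ₐ[ℂ] A'} {q : B →ₐ[ℂ] B'}
    (hpq : ∀ a, q (φ a) = φ' (p a)) {s : A'} {r : B'} (hr : IsUnit r)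
    (hq : Function.Injective q) {k : ℕ} {E : Module.End ℂ A'}
    (hE : IsDiffOpAlong (AlgHom.id ℂ A') k E) {D : A →ₗ[ℂ] B}
    (h : ∀ f, r * q (D f) = φ' (E (s * p f))) : IsDiffOpAlong φ k D := by
  induction k generalizing E D with
  | zero =>
    intro a f
    apply hq
    apply hr.mul_left_cancel
    have := hE (p a) (s * p f)
    rw [h, map_mul p, mul_left_comm, this, map_mul φ', ← h, map_mul q, mul_left_comm r, hpq]
    rfl
  | succ k ih =>
    intro a
    refine ih (hE (p a)) fun f => ?_
    simp only [LinearMap.sub_apply, LinearMap.comp_apply, LinearMap.mulLeft_apply, map_sub, map_mul,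
      mul_sub, h, AlgHom.id_apply, hpq]
    rw [mul_left_comm r, h, mul_left_comm s]

end DiffOp

/-! ### Polynomial families -/

section Polynomial

variable {V W X Y : Type*} [AddCommGroup V] [Module ℂ V] [AddCommGroup W] [Module ℂ W]
  [AddCommGroup X] [Module ℂ X] [AddCommGroup Y] [Module ℂ Y]


theorem isPolynomialFamily_const (B : V →ₗ[ℂ] W) : IsPolynomialFamily fun _ => B :=
  ⟨0, fun _ => B, fun _ => by simp⟩

theorem isPolynomialFamily_smul_poly (p : Polynomial ℂ) (B : V →ₗ[ℂ] W) :
    IsPolynomialFamily fun lam => p.eval lam • B :=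
  ⟨p.natDegree, fun j => p.coeff j • B, fun lam => by
    dsimp only
    rw [Polynomial.eval_eq_sum_range, Finset.sum_smul]
    exact Finset.sum_congr rfl fun j _ => by rw [mul_comm, mul_smul]⟩

/-- Padding with zero coefficients lets two families be written with a common degree. -/
theorem IsPolynomialFamily.extend {D : ℂ → V →ₗ[ℂ] W} (hD : IsPolynomialFamily D) :
    ∃ (d : ℕ) (B : ℕ → V →ₗ[ℂ] W), ∀ e, d ≤ e →
      ∀ lam, D lam = ∑ j ∈ Finset.range (e + 1), lam ^ j • B j := by
  obtain ⟨d, B, h⟩ := hD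
  refine ⟨d, fun j => if j ≤ d then B j else 0, fun e he lam => ?_⟩
  rw [h, ← Finset.sum_subset (Finset.range_mono (Nat.succ_le_succ he))]
  · refine Finset.sum_congr rfl fun j hj => ?_
    simp [Nat.lt_succ_iff.1 (Finset.mem_range.1 hj)]
  · intro j _ hj
    have : ¬ j ≤ d := by simpa [Nat.lt_succ_iff] using hj
    simp [this]

theorem IsPolynomialFamily.add {D E : ℂ → V →ₗ[ℂ] W} (hD : IsPolynomialFamily D)
    (hE : IsPolynomialFamily E) : IsPolynomialFamily fun lam => D lam + E lam := by
  obtain ⟨d, B, h⟩ := hD.extend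
  obtain ⟨e, C, h'⟩ := hE.extend
  refine ⟨max d e, fun j => B j + C j, fun lam => ?_⟩
  dsimp only
  rw [h _ (le_max_left d e), h' _ (le_max_right d e), ← Finset.sum_add_distrib]
  simp

theorem isPolynomialFamily_sum {ι : Type*} (s : Finset ι) {D : ι → ℂ → V →ₗ[ℂ] W}
    (hD : ∀ i ∈ s, IsPolynomialFamily (D i)) :
    IsPolynomialFamily fun lam => ∑ i ∈ s, D i lam := by
  classical
  induction s using Finset.induction_on with
  | empty => simpa using isPolynomialFamily_const (0 : V →ₗ[ℂ] W)
  | insert i s hi ih =>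
    simp only [Finset.sum_insert hi]
    exact (hD i (by simp)).add (ih fun j hj => hD j (by simp [hj]))

theorem IsPolynomialFamily.comp {D : ℂ → W →ₗ[ℂ] X} {E : ℂ → V →ₗ[ℂ] W}
    (hD : IsPolynomialFamily D) (hE : IsPolynomialFamily E) :
    IsPolynomialFamily fun lam => D lam ∘ₗ E lam := by
  obtain ⟨d, B, h⟩ := hD
  obtain ⟨e, C, h'⟩ := hE
  have : (fun lam => D lam ∘ₗ E lam) = fun lam => ∑ i ∈ Finset.range (d + 1),
      ∑ j ∈ Finset.range (e + 1), (Polynomial.X ^ (i + j) : Polynomial ℂ).eval lam •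
        (B i ∘ₗ C j) := by
    funext lam
    ext v
    rw [h, h']
    simp [LinearMap.sum_apply, map_sum, Finset.smul_sum, pow_add, mul_smul]
  rw [this]
  exact isPolynomialFamily_sum _ fun i _ => isPolynomialFamily_sum _ fun j _ =>
    isPolynomialFamily_smul_poly _ _

/-- The coefficients of `ψ ∘ D` need not visibly take values in the image of `ψ`. Lagrange
interpolation at `0, …, d` avoids this: `D(λ)` is a combination of the values `D(0), …, D(d)` with
polynomial coefficients, an identity that can be checked after applying `ψ`. -/
theorem IsPolynomialFamily.of_injective {ψ : W →ₗ[ℂ] X} (hψ : Function.Injective ψ)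
    {D : ℂ → V →ₗ[ℂ] W} (hD : IsPolynomialFamily fun lam => ψ ∘ₗ D lam) :
    IsPolynomialFamily D := by
  obtain ⟨d, B, h⟩ := hD
  have hinj : Set.InjOn (fun i : ℕ => (i : ℂ)) (Finset.range (d + 1)) :=
    fun i _ j _ hij => Nat.cast_injective hij
  have : D = fun lam => ∑ i ∈ Finset.range (d + 1),
      (Lagrange.basis (Finset.range (d + 1)) (fun i : ℕ => (i : ℂ)) i).eval lam • D i := by
    funext lam
    refine LinearMap.ext fun v => hψ ?_
    have h' : ∀ mu v, ψ (D mu v) = ∑ j ∈ Finset.range (d + 1), mu ^ j • B j v := fun mu v => by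
      have := congrArg (fun L => L v) (h mu)
      simpa [LinearMap.sum_apply] using this
    simp only [LinearMap.sum_apply, map_sum, LinearMap.smul_apply, map_smul, h', Finset.smul_sum]
    rw [Finset.sum_comm]
    refine Finset.sum_congr rfl fun j hj => ?_
    simp only [smul_smul]
    rw [← Finset.sum_smul]
    congr 1
    have hX := Lagrange.eq_interpolate (f := (Polynomial.X ^ j : Polynomial ℂ)) hinj (by
      rw [Polynomial.degree_X_pow, Finset.card_range]
      exact_mod_cast Finset.mem_range.1 hj)
    have := congrArg (Polynomial.eval lam) hX
    rw [Lagrange.interpolate_apply, Polynomial.eval_finsetSum] at this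
    simpa [mul_comm] using this
  rw [this]
  exact isPolynomialFamily_sum _ fun i _ => isPolynomialFamily_smul_poly _ _

end Polynomial

end EinsteinFamilies

end

noncomputable section

namespace EinsteinFamilies

attribute [local instance] Matrix.linftyOpNormedRing Matrix.linftyOpNormedAlgebra
attribute [local instance 100] LieRing.ofAssociativeRing

/-! ### Brackets of the rotation generators -/

/-- Numerals in `Fin (m + 1)` are read modulo `m + 1`; this is where the recurring condition `3 ≤ m`
comes from. -/
theorem val_three {m : ℕ} (hm : 3 ≤ m) : ((3 : Fin (m + 1)) : ℕ) = 3 := by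
  exact Nat.mod_eq_of_lt (by omega : 3 < m + 1)

theorem three_ne_zero_fin {m : ℕ} (hm : 3 ≤ m) : (3 : Fin (m + 1)) ≠ 0 := by
  intro h
  have := congrArg Fin.val h
  rw [val_three hm] at this
  simp at this

theorem castSucc_three {m : ℕ} (hm : 3 ≤ m) : (3 : Fin (m + 1)).castSucc = 3 :=
  Fin.ext (by rw [Fin.val_castSucc, val_three hm, val_three (hm.trans (Nat.le_succ m))])

theorem sgn_zero (m : ℕ) : sgn m 0 = -1 := by simp [sgn]

theorem sgn_three {m : ℕ} (hm : 3 ≤ m) : sgn m 3 = 1 := by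
  rw [sgn, val_three hm]
  norm_num

theorem sgn_mul_self {m : ℕ} (i : Fin (m + 1)) : sgn m i * sgn m i = 1 := by
  unfold sgn
  split_ifs <;> norm_num

theorem sgn_castSucc {m : ℕ} (i : Fin (m + 1)) : sgn (m + 1) i.castSucc = sgn m i := rfl

theorem sgn_last {m : ℕ} (hm : 3 ≤ m) : sgn m (Fin.last m) = 1 := by
  rw [sgn, if_neg]
  simp
  omega

theorem rot_self {m : ℕ} (a : Fin (m + 1)) : rot a a = 0 :=
  Subtype.ext (sub_self _)

theorem rot_swap {m : ℕ} (a b : Fin (m + 1)) : rot b a = -rot a b :=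
  Subtype.ext (by simp [rot])

theorem single_mul_single {n : Type*} [Fintype n] [DecidableEq n] (a b c d : n) :
    (Matrix.single a b 1 * Matrix.single c d 1 : Matrix n n ℝ) =
      if b = c then Matrix.single a d 1 else 0 := by
  split_ifs with h
  · subst h
    simp
  · simp [h]

theorem rot_lie {m : ℕ} (a b c d : Fin (m + 1)) :
    ⁅rot a b, rot c d⁆ = (if b = c then sgn m b • rot a d else 0)
      - (if a = c then sgn m a • rot b d else 0) - (if b = d then sgn m b • rot a c else 0)
      + (if a = d then sgn m a • rot b c else 0) := by
  apply Subtype.ext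
  rw [LieSubalgebra.coe_bracket, Ring.lie_def]
  have h1 : ∀ (p : Prop) [Decidable p] (x : 𝔤 m), ((if p then x else 0 : 𝔤 m) :
      Matrix (Fin (m + 1)) (Fin (m + 1)) ℝ) = if p then (x : Matrix _ _ ℝ) else 0 := by
    intro p _ x
    split_ifs <;> rfl
  simp only [AddSubgroupClass.coe_sub, AddMemClass.coe_add, h1, SetLike.val_smul]
  simp only [rot, sub_mul, mul_sub, smul_mul_assoc, mul_smul_comm, single_mul_single,
    eq_comm (a := d), eq_comm (a := c)]
  split_ifs <;> subst_vars <;> simp only [smul_zero, smul_sub, smul_smul] <;> module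

/-- The generators `L_{0k} + L_{3k}` of `𝔫⁺`, opposite to `nMinus k`. -/
def raise {m : ℕ} (k : Fin (m + 1)) : 𝔤 m := rot 0 k + rot 3 k

section Brackets

variable {m : ℕ} {j k l : Fin (m + 1)}

theorem lie_nMinus_nMinus (hm : 3 ≤ m) (hj0 : j ≠ 0) (hj3 : j ≠ 3) (hk0 : k ≠ 0) (hk3 : k ≠ 3) :
    ⁅(nMinus j : 𝔤 m), nMinus k⁆ = 0 := by
  have h30 := three_ne_zero_fin hm
  simp only [nMinus, lie_sub, sub_lie, rot_lie, hj0, hj3, hk0.symm, hk3.symm, h30, h30.symm,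
    if_false, if_true, sgn_zero, sgn_three hm, rot_self, rot_swap 0 3]
  split_ifs <;> simp <;> module

theorem lie_raise_nMinus (hm : 3 ≤ m) (hj0 : j ≠ 0) (hj3 : j ≠ 3) (hk0 : k ≠ 0) (hk3 : k ≠ 3) :
    ⁅raise k, nMinus j⁆ = (2 : ℝ) • rot k j + if k = j then (2 * sgn m k) • H m else 0 := by
  have h30 := three_ne_zero_fin hm
  simp only [nMinus, raise, add_lie, lie_sub, rot_lie, hk0, hk3, hj0.symm, hj3.symm, h30, h30.symm,
    if_false, if_true, sgn_zero, sgn_three hm, rot_self, rot_swap 0 3, H]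
  split_ifs <;> simp <;> module

theorem lie_H_nMinus (hm : 3 ≤ m) (hj0 : j ≠ 0) (hj3 : j ≠ 3) :
    ⁅H m, nMinus j⁆ = -nMinus j := by
  have h30 := three_ne_zero_fin hm
  simp only [nMinus, H, lie_sub, rot_lie, hj0.symm, hj3.symm, h30, h30.symm,
    if_false, if_true, sgn_zero, sgn_three hm, rot_self, rot_swap 0 3]
  simp

theorem lie_rot_nMinus (hk0 : k ≠ 0) (hk3 : k ≠ 3) (hl0 : l ≠ 0)
    (hl3 : l ≠ 3) : ⁅rot k l, (nMinus j : 𝔤 m)⁆ =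
      (if l = j then sgn m l • nMinus k else 0) - if k = j then sgn m k • nMinus l else 0 := by
  simp only [nMinus, lie_sub, rot_lie, hk0, hk3, hl0, hl3, if_false,
    rot_swap 0, rot_swap 3]
  split_ifs <;> simp <;> module

end Brackets

/-! ### Exponentials of matrices -/

theorem exp_of_cube_eq_zero {n : Type*} [Fintype n] [DecidableEq n] {X : Matrix n n ℝ}
    (hX : X * X * X = 0) : NormedSpace.exp X = 1 + X + (2⁻¹ : ℝ) • (X * X) := by
  rw [NormedSpace.exp_eq_tsum ℝ]
  have h : ∀ k ∉ Finset.range 3, ((k.factorial : ℝ)⁻¹) • X ^ k = 0 := by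
    intro k hk
    have hk : 3 ≤ k := by simpa using hk
    obtain ⟨l, rfl⟩ := Nat.exists_eq_add_of_le hk
    rw [pow_add, pow_succ, sq, hX, zero_mul, smul_zero]
  simp only
  rw [tsum_eq_sum h]
  simp [Finset.sum_range_succ, sq, Nat.factorial]

/-- Only the action of `exp(tH)` on `e₀ ± e₃`, and of exponentials of rotations on `e₀` and `e₃`, is
ever needed, so full matrix exponentials can be avoided. -/
theorem exp_mulVec_of_eigenvector {n : Type*} [Fintype n] [DecidableEq n] {X : Matrix n n ℝ}
    {v : n → ℝ} {c : ℝ} (h : X *ᵥ v = c • v) : NormedSpace.exp X *ᵥ v = Real.exp c • v := by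
  have h1 := NormedSpace.exp_series_hasSum_exp' (𝕂 := ℝ) X
  have h2 : HasSum (fun k : ℕ => ((k.factorial : ℝ)⁻¹) • (X ^ k) *ᵥ v) (NormedSpace.exp X *ᵥ v) := by
    have hc : Continuous fun A : Matrix n n ℝ => A *ᵥ v := by fun_prop
    have := h1.map (Matrix.mulVecBilin ℝ ℝ |>.flip v) hc
    simp only [Function.comp_def] at this
    convert this using 1
    · funext k
      exact (Matrix.smul_mulVec _ _ _).symm
    · rfl
  have h3 : ∀ k : ℕ, (X ^ k) *ᵥ v = c ^ k • v := by
    intro k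
    induction k with
    | zero => simp
    | succ k ih => rw [pow_succ, ← Matrix.mulVec_mulVec, h, Matrix.mulVec_smul, ih, smul_smul,
        pow_succ']
  have h4 := (NormedSpace.exp_series_hasSum_exp' (𝕂 := ℝ) c).smul_const v
  rw [← Real.exp_eq_exp_ℝ] at h4
  refine h2.unique ?_
  convert h4 using 1
  funext k
  rw [h3, smul_eq_mul, smul_smul]

theorem mat_expG {m : ℕ} (X : 𝔤 m) : mat (expG X) = NormedSpace.exp (X : Matrix _ _ ℝ) := rfl

theorem expG_zero {m : ℕ} : expG (0 : 𝔤 m) = 1 :=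
  mat_injective (by simp [mat_expG, mat_one])

theorem expG_add_smul {m : ℕ} (X : 𝔤 m) (s t : ℝ) :
    expG ((s + t) • X) = expG (s • X) * expG (t • X) := by
  refine mat_injective ?_
  rw [mat_mul, mat_expG, mat_expG, mat_expG, SetLike.val_smul, SetLike.val_smul, SetLike.val_smul,
    add_smul]
  exact Matrix.exp_add_of_commute _ _ (((Commute.refl _).smul_left _).smul_right _)

theorem expG_neg {m : ℕ} (X : 𝔤 m) : expG (-X) = (expG X)⁻¹ := by
  have := expG_add_smul X (-1) 1
  rw [neg_add_cancel, zero_smul, expG_zero, neg_one_smul, one_smul] at this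
  exact eq_inv_of_mul_eq_one_left this.symm

/-! ### The invariant form and the generators `p ∧ x` -/

/-- The bilinear form of signature `(2, m-1)`. -/
def form (m : ℕ) : (Fin (m + 1) → ℝ) →ₗ[ℝ] (Fin (m + 1) → ℝ) →ₗ[ℝ] ℝ :=
  Matrix.toLinearMap₂' ℝ (gram m)

theorem form_apply {m : ℕ} (v w : Fin (m + 1) → ℝ) : form m v w = v ⬝ᵥ (gram m *ᵥ w) :=
  Matrix.toLinearMap₂'_apply' _ _ _

theorem form_eq_sum {m : ℕ} (v w : Fin (m + 1) → ℝ) : form m v w = ∑ i, sgn m i * v i * w i := by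
  rw [form_apply, dotProduct]
  refine Finset.sum_congr rfl fun i _ => ?_
  rw [gram, Matrix.mulVec_diagonal]
  ring

theorem form_symm {m : ℕ} (v w : Fin (m + 1) → ℝ) : form m v w = form m w v := by
  rw [form_eq_sum, form_eq_sum]
  exact Finset.sum_congr rfl fun i _ => by ring

theorem form_single {m : ℕ} (i : Fin (m + 1)) (v : Fin (m + 1) → ℝ) :
    form m (Pi.single i 1) v = sgn m i * v i := by
  rw [form_eq_sum, Finset.sum_eq_single i]
  · simp
  · intro j _ hj
    simp [hj]
  · simp

theorem form_mulVec {m : ℕ} (g : G m) (v w : Fin (m + 1) → ℝ) :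
    form m (mat g *ᵥ v) (mat g *ᵥ w) = form m v w := by
  rw [form_apply, form_apply]
  conv_rhs => rw [← mat_gram g, mul_assoc, ← Matrix.mulVec_mulVec, ← Matrix.mulVec_mulVec,
    Matrix.dotProduct_mulVec v, Matrix.vecMul_transpose]

theorem gram_of_form {m : ℕ} {A : Matrix (Fin (m + 1)) (Fin (m + 1)) ℝ}
    (h : ∀ v w, form m (A *ᵥ v) (A *ᵥ w) = form m v w) : Aᵀ * gram m * A = gram m := by
  ext i j
  have h1 := h (Pi.single i 1) (Pi.single j 1)
  have h2 : ∀ B : Matrix (Fin (m + 1)) (Fin (m + 1)) ℝ,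
      B i j = Pi.single i 1 ⬝ᵥ (B *ᵥ Pi.single j 1) := fun B => by simp
  rw [form_apply, form_apply] at h1
  rw [h2 (Aᵀ * gram m * A), h2 (gram m), ← h1, mul_assoc, ← Matrix.mulVec_mulVec,
    ← Matrix.mulVec_mulVec, Matrix.dotProduct_mulVec _ Aᵀ, Matrix.vecMul_transpose]

theorem form_lie {m : ℕ} (X : 𝔤 m) (v w : Fin (m + 1) → ℝ) :
    form m (X.1 *ᵥ v) w = -form m v (X.1 *ᵥ w) := by
  rw [form_apply, form_apply, ← Matrix.vecMul_transpose, ← Matrix.dotProduct_mulVec,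
    Matrix.mulVec_mulVec, (mem_𝔤 _).1 X.2, Matrix.mulVec_mulVec, mul_neg, Matrix.neg_mulVec,
    dotProduct_neg]

/-- The skew endomorphism `v ↦ ⟨x, v⟩ p - ⟨p, v⟩ x`. -/
def wedge {m : ℕ} : (Fin (m + 1) → ℝ) →ₗ[ℝ] (Fin (m + 1) → ℝ) →ₗ[ℝ] 𝔤 m :=
  LinearMap.mk₂ ℝ (fun p x => ⟨Matrix.vecMulVec p (gram m *ᵥ x) - Matrix.vecMulVec x (gram m *ᵥ p),
    by
      have h : ∀ y z : Fin (m + 1) → ℝ, (Matrix.vecMulVec y (gram m *ᵥ z))ᵀ * gram m =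
          gram m * Matrix.vecMulVec z (gram m *ᵥ y) := by
        intro y z
        ext i j
        simp only [gram, Matrix.mul_diagonal, Matrix.diagonal_mul, Matrix.transpose_apply,
          Matrix.vecMulVec_apply, Matrix.mulVec_diagonal]
        ring
      rw [mem_𝔤, Matrix.transpose_sub, sub_mul, h, h, neg_sub, mul_sub]⟩)
    (fun p p' x => Subtype.ext (by
      simp [Matrix.add_vecMulVec, Matrix.vecMulVec_add, Matrix.mulVec_add]; abel))
    (fun c p x => Subtype.ext (by
      simp [Matrix.smul_vecMulVec, Matrix.vecMulVec_smul, Matrix.mulVec_smul, smul_sub]))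
    (fun p x x' => Subtype.ext (by
      simp [Matrix.add_vecMulVec, Matrix.vecMulVec_add, Matrix.mulVec_add]; abel))
    (fun c p x => Subtype.ext (by
      simp [Matrix.smul_vecMulVec, Matrix.vecMulVec_smul, Matrix.mulVec_smul, smul_sub]))

theorem wedge_coe {m : ℕ} (p x : Fin (m + 1) → ℝ) : (wedge p x).1 =
    Matrix.vecMulVec p (gram m *ᵥ x) - Matrix.vecMulVec x (gram m *ᵥ p) := rfl

theorem wedge_mulVec {m : ℕ} (p x v : Fin (m + 1) → ℝ) :
    (wedge p x).1 *ᵥ v = form m x v • p - form m p v • x := by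
  rw [wedge_coe, Matrix.sub_mulVec, Matrix.vecMulVec_mulVec, Matrix.vecMulVec_mulVec,
    form_symm x, form_symm p, form_apply, form_apply, dotProduct_comm v (gram m *ᵥ x),
    dotProduct_comm v (gram m *ᵥ p)]
  simp

theorem lie_algebra_ext {m : ℕ} {X Y : 𝔤 m}
    (h : ∀ v, X.1 *ᵥ v = Y.1 *ᵥ v) : X = Y :=
  Subtype.ext (Matrix.mulVec_injective (funext h))

theorem rot_eq_wedge {m : ℕ} (a b : Fin (m + 1)) :
    rot a b = wedge (Pi.single a 1) (Pi.single b 1) := by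
  apply Subtype.ext
  rw [wedge_coe]
  ext i j
  simp only [rot, gram, Matrix.sub_apply, Matrix.smul_apply, Matrix.single_apply,
    Matrix.vecMulVec_apply, Matrix.mulVec_diagonal, Pi.single_apply, smul_eq_mul]
  have h1 : (a = i) = (i = a) := propext eq_comm
  have h2 : (b = i) = (i = b) := propext eq_comm
  have h3 : (a = j) = (j = a) := propext eq_comm
  have h4 : (b = j) = (j = b) := propext eq_comm
  simp only [h1, h2, h3, h4]
  by_cases hia : i = a <;> by_cases hib : i = b <;> by_cases hja : j = a <;>
    by_cases hjb : j = b <;> simp [hia, hib, hja, hjb]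
  all_goals simp_all

theorem wedge_lie {m : ℕ} (X : 𝔤 m) (p x : Fin (m + 1) → ℝ) :
    ⁅X, wedge p x⁆ = wedge (X.1 *ᵥ p) x + wedge p (X.1 *ᵥ x) := by
  refine lie_algebra_ext fun v => ?_
  rw [LieSubalgebra.coe_bracket, Ring.lie_def, Matrix.sub_mulVec, ← Matrix.mulVec_mulVec,
    ← Matrix.mulVec_mulVec, AddMemClass.coe_add, Matrix.add_mulVec, wedge_mulVec, wedge_mulVec,
    wedge_mulVec, wedge_mulVec, Matrix.mulVec_sub, Matrix.mulVec_smul, Matrix.mulVec_smul,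
    form_lie, form_lie]
  module

/-- Under these conditions the endomorphism sends everything into the span of `p` and `x`, sends `x`
to a multiple of `p`, and kills `p`. -/
theorem wedge_cube {m : ℕ} {p x : Fin (m + 1) → ℝ} (hp : form m p p = 0) (hx : form m p x = 0) :
    (wedge p x).1 * (wedge p x).1 * (wedge p x).1 = 0 := by
  refine Matrix.mulVec_injective (funext fun v => ?_)
  rw [← Matrix.mulVec_mulVec, ← Matrix.mulVec_mulVec]
  simp [wedge_mulVec, hp, hx, form_symm x p]

theorem exp_wedge {m : ℕ} {p x : Fin (m + 1) → ℝ} (hp : form m p p = 0) (hx : form m p x = 0) :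
    mat (expG (wedge p x)) = 1 + (wedge p x).1 +
      (2⁻¹ : ℝ) • ((wedge p x).1 * (wedge p x).1) :=
  exp_of_cube_eq_zero (wedge_cube hp hx)

theorem exp_wedge_mulVec {m : ℕ} {p x : Fin (m + 1) → ℝ} (hp : form m p p = 0)
    (hx : form m p x = 0) (v : Fin (m + 1) → ℝ) :
    mat (expG (wedge p x)) *ᵥ v =
      v + form m x v • p - form m p v • x - (2⁻¹ * form m p v * form m x x) • p := by
  rw [exp_wedge hp hx, Matrix.add_mulVec, Matrix.add_mulVec, Matrix.one_mulVec, Matrix.smul_mulVec,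
    ← Matrix.mulVec_mulVec]
  simp only [wedge_mulVec, map_sub, map_smul, hp, hx, form_symm x p, smul_eq_mul]
  module

/-! ### The light-like vectors `e₀ ± e₃` -/

/-- The null vector `e₀ + e₃`. -/
def ePlus (m : ℕ) : Fin (m + 1) → ℝ := Pi.single 0 1 + Pi.single 3 1

/-- The null vector `e₀ - e₃`. -/
def eMinus (m : ℕ) : Fin (m + 1) → ℝ := Pi.single 0 1 - Pi.single 3 1

/-- The component of a vector orthogonal to `e₀` and `e₃`. -/
def transverse {m : ℕ} (v : Fin (m + 1) → ℝ) : Fin (m + 1) → ℝ :=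
  fun k => if k = 0 ∨ k = 3 then 0 else v k

theorem transverse_zero {m : ℕ} (v : Fin (m + 1) → ℝ) : transverse v 0 = 0 := by simp [transverse]

theorem transverse_three {m : ℕ} (v : Fin (m + 1) → ℝ) : transverse v 3 = 0 := by
  simp [transverse]

section Light

variable {m : ℕ}

theorem eq_transverse_add (hm : 3 ≤ m) (v : Fin (m + 1) → ℝ) :
    v = transverse v + v 0 • Pi.single 0 1 + v 3 • Pi.single 3 1 := by
  have h30 := three_ne_zero_fin hm
  funext k
  by_cases h0 : k = 0
  · subst h0; simp [transverse, h30.symm]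
  · by_cases h3 : k = 3
    · subst h3; simp [transverse, h30]
    · simp [transverse, h0, h3]

theorem eq_transverse_add_null (hm : 3 ≤ m) (v : Fin (m + 1) → ℝ) :
    v = transverse v + ((v 0 + v 3) / 2) • ePlus m + ((v 0 - v 3) / 2) • eMinus m := by
  nth_rw 1 [eq_transverse_add hm v]
  rw [ePlus, eMinus]
  module

theorem form_ePlus_left (hm : 3 ≤ m) (v : Fin (m + 1) → ℝ) :
    form m (ePlus m) v = v 3 - v 0 := by
  rw [ePlus, map_add, LinearMap.add_apply, form_single, form_single, sgn_zero, sgn_three hm]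
  ring

theorem form_eMinus_left (hm : 3 ≤ m) (v : Fin (m + 1) → ℝ) :
    form m (eMinus m) v = -v 0 - v 3 := by
  rw [eMinus, map_sub, LinearMap.sub_apply, form_single, form_single, sgn_zero, sgn_three hm]
  ring

theorem ePlus_zero (hm : 3 ≤ m) : ePlus m 0 = 1 := by
  simp [ePlus, (three_ne_zero_fin hm).symm]

theorem ePlus_three (hm : 3 ≤ m) : ePlus m 3 = 1 := by
  simp [ePlus, three_ne_zero_fin hm]

theorem eMinus_zero (hm : 3 ≤ m) : eMinus m 0 = 1 := by
  simp [eMinus, (three_ne_zero_fin hm).symm]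

theorem eMinus_three (hm : 3 ≤ m) : eMinus m 3 = -1 := by
  simp [eMinus, three_ne_zero_fin hm]

theorem form_ePlus_self (hm : 3 ≤ m) : form m (ePlus m) (ePlus m) = 0 := by
  rw [form_ePlus_left hm, ePlus_zero hm, ePlus_three hm, sub_self]

theorem form_eMinus_self (hm : 3 ≤ m) : form m (eMinus m) (eMinus m) = 0 := by
  rw [form_eMinus_left hm, eMinus_zero hm, eMinus_three hm]
  norm_num

theorem form_ePlus_eMinus (hm : 3 ≤ m) : form m (ePlus m) (eMinus m) = -2 := by
  rw [form_ePlus_left hm, eMinus_zero hm, eMinus_three hm]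
  norm_num

theorem form_ePlus_transverse (hm : 3 ≤ m) (v : Fin (m + 1) → ℝ) :
    form m (ePlus m) (transverse v) = 0 := by
  rw [form_ePlus_left hm, transverse_zero, transverse_three, sub_self]

theorem form_eMinus_transverse (hm : 3 ≤ m) (v : Fin (m + 1) → ℝ) :
    form m (eMinus m) (transverse v) = 0 := by
  rw [form_eMinus_left hm, transverse_zero, transverse_three, neg_zero, sub_zero]

theorem form_self (hm : 3 ≤ m) (v : Fin (m + 1) → ℝ) :
    form m v v = form m (transverse v) (transverse v) - (v 0 + v 3) * (v 0 - v 3) := by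
  conv_lhs => rw [eq_transverse_add_null hm v]
  simp only [map_add, LinearMap.add_apply, map_smul, LinearMap.smul_apply, smul_eq_mul,
    form_ePlus_self hm, form_eMinus_self hm, form_ePlus_eMinus hm, form_ePlus_transverse hm,
    form_eMinus_transverse hm, form_symm (transverse v) (ePlus m),
    form_symm (transverse v) (eMinus m), form_symm (eMinus m) (ePlus m)]
  ring

theorem H_mulVec (hm : 3 ≤ m) (v : Fin (m + 1) → ℝ) :
    (H m).1 *ᵥ v = v 3 • Pi.single 0 1 + v 0 • Pi.single 3 1 := by
  rw [H, rot_eq_wedge, wedge_mulVec, form_single, form_single, sgn_zero, sgn_three hm]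
  module

theorem H_mulVec_ePlus (hm : 3 ≤ m) : (H m).1 *ᵥ ePlus m = ePlus m := by
  rw [H_mulVec hm, ePlus_zero hm, ePlus_three hm, one_smul, one_smul, ePlus]

theorem exp_H_mulVec_ePlus (hm : 3 ≤ m) (t : ℝ) :
    mat (expG (t • H m)) *ᵥ ePlus m = Real.exp t • ePlus m := by
  refine exp_mulVec_of_eigenvector ?_
  rw [SetLike.val_smul, Matrix.smul_mulVec, H_mulVec_ePlus hm]

theorem H_mulVec_transverse (hm : 3 ≤ m) (v : Fin (m + 1) → ℝ) :
    (H m).1 *ᵥ transverse v = 0 := by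
  rw [H_mulVec hm, transverse_zero, transverse_three, zero_smul, zero_smul, add_zero]

theorem wedge_mem_nPlus (hm : 3 ≤ m) (x : Fin (m + 1) → ℝ) :
    wedge (ePlus m) (transverse x) ∈ nPlus m := by
  change ⁅H m, wedge (ePlus m) (transverse x)⁆ = _
  rw [wedge_lie, H_mulVec_ePlus hm, H_mulVec_transverse hm, map_zero, add_zero]

/-- Entrywise, skewness (`hs`) and the eigenvalue equation (`hl`) form a linear system, whose
instances involving the indices `0` and `3` determine `X` from its column `0`. -/
theorem exists_wedge_of_mem_nPlus (hm : 3 ≤ m) {X : 𝔤 m} (hX : X ∈ nPlus m) :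
    ∃ x, X = wedge (ePlus m) (transverse x) := by
  have h30 := three_ne_zero_fin hm
  have h03 := h30.symm
  have hs : ∀ i j, X.1 j i * sgn m j = -(sgn m i * X.1 i j) := by
    intro i j
    have := congrFun (congrFun ((mem_𝔤 _).1 X.2) i) j
    simpa [gram, Matrix.mul_diagonal, Matrix.diagonal_mul] using this
  have hl : ∀ i j, (if i = 0 then X.1 3 j else 0) +
      (if i = 3 then X.1 0 j else 0) - ((if j = 3 then X.1 i 0 else 0) +
      (if j = 0 then X.1 i 3 else 0)) = X.1 i j := by
    intro i j
    have hX' : ⁅H m, X⁆ = X := hX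
    have h1 := congrArg (fun Y : 𝔤 m => Y.1 i j) hX'
    have hH : (H m).1 = Matrix.single 0 3 1 + Matrix.single 3 0 1 := by
      simp [H, rot, sgn_zero, sgn_three hm]
    simp only [LieSubalgebra.coe_bracket, Ring.lie_def, hH, Matrix.sub_apply, add_mul, mul_add,
      Matrix.add_apply, Matrix.mul_apply, Matrix.single_apply, ite_mul, mul_ite, one_mul, zero_mul,
      mul_one, mul_zero] at h1
    rw [← h1]
    simp [ite_and, eq_comm]
  have hs0 : sgn m 0 = -1 := sgn_zero m
  have hs3 := sgn_three hm
  -- For transverse `x`, the endomorphism `(e₀ + e₃) ∧ x` sends `e₀` to `x`, so `x` must be the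
  -- transverse part of column `0`.
  refine ⟨fun k => X.1 k 0, Subtype.ext ?_⟩
  ext i j
  have a1 := hs i j
  have a2 := hs 0 i
  have a3 := hs 0 j
  have a4 := hs 3 i
  have a5 := hs 3 j
  have a6 := hs 3 3
  have a7 := hs 0 0
  have a8 := hs 0 3
  have b1 := hl i j
  have b2 := hl 0 j
  have b3 := hl 3 j
  have b4 := hl i 0
  have b5 := hl i 3
  have b6 := hl 0 3
  have b7 := hl 0 0
  have b8 := hl 3 0
  have b9 := hl 3 3
  rw [wedge_coe]
  simp only [gram, Matrix.sub_apply, Matrix.vecMulVec_apply, Matrix.mulVec_diagonal, transverse,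
    ePlus, Pi.add_apply, Pi.single_apply]
  rcases eq_or_ne i 0 with hi0 | hi0 <;> rcases eq_or_ne j 0 with hj0 | hj0 <;>
  rcases eq_or_ne i 3 with hi3 | hi3 <;> rcases eq_or_ne j 3 with hj3 | hj3 <;>
  first
  | exact absurd (hi0.symm.trans hi3) h03
  | exact absurd (hj0.symm.trans hj3) h03
  | (simp only [hi0, hj0, hi3, hj3, h30, h03, hs0, hs3, if_true, if_false, true_or, or_true,
      or_self] at *
     linarith)

/-! ### Transitivity and stabilizers -/

/-- The reflection at the hyperplane orthogonal to a vector `w` that is not null. -/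
theorem exists_reflection {w : Fin (m + 1) → ℝ} (hw : form m w w ≠ 0) :
    ∃ g : G m, ∀ v, mat g *ᵥ v = v - (2 * form m w v / form m w w) • w := by
  have h : ∀ v, (1 - (2 / form m w w) • Matrix.vecMulVec w (gram m *ᵥ w)) *ᵥ v =
      v - (2 * form m w v / form m w w) • w := by
    intro v
    rw [Matrix.sub_mulVec, Matrix.one_mulVec, Matrix.smul_mulVec, Matrix.vecMulVec_mulVec,
      form_symm w v, form_apply v w, dotProduct_comm]
    simp [smul_smul]
    ring_nf
  refine ⟨ofMat (1 - (2 / form m w w) • Matrix.vecMulVec w (gram m *ᵥ w))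
    (gram_of_form fun v v' => ?_), fun v => by rw [mat_ofMat, h]⟩
  rw [h, h]
  simp only [map_sub, LinearMap.sub_apply, map_smul, LinearMap.smul_apply, smul_eq_mul,
    form_symm v w]
  field_simp
  ring

/-- The reflection at the hyperplane orthogonal to `v - w` works; that vector is not null because
its square is `-2⟨v, w⟩`. -/
theorem exists_mulVec_eq_of_form_ne_zero {v w : Fin (m + 1) → ℝ} (hv : form m v v = 0)
    (hw : form m w w = 0) (hvw : form m v w ≠ 0) : ∃ g : G m, mat g *ᵥ v = w := by
  have hn : form m (v - w) (v - w) = -2 * form m v w := by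
    simp only [map_sub, LinearMap.sub_apply, hv, hw, form_symm w v]
    ring
  obtain ⟨g, hg⟩ := exists_reflection (w := v - w) (by rw [hn]; simpa using hvw)
  refine ⟨g, ?_⟩
  rw [hg, hn, map_sub, LinearMap.sub_apply, hv, form_symm w v]
  have : 2 * (0 - form m v w) / (-2 * form m v w) = 1 := by field_simp; ring
  rw [this, one_smul, sub_sub_cancel]

theorem form_cone (v : Cone m) : form m v.vec v.vec = 0 := by
  rw [form_apply]
  exact v.2.2

/-- If `v` is not orthogonal to `e₀ + e₃`, one reflection suffices. Otherwise two reflections pass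
through a null vector `u` orthogonal to neither. -/
theorem exists_mulVec_ePlus (hm : 3 ≤ m) (v : Cone m) : ∃ g : G m, mat g *ᵥ ePlus m = v.vec := by
  by_cases h2 : form m (ePlus m) v.vec ≠ 0
  · exact exists_mulVec_eq_of_form_ne_zero (form_ePlus_self hm) (form_cone v) h2
  have h2 : form m (ePlus m) v.vec = 0 := not_not.1 h2
  suffices h : ∃ u, form m u u = 0 ∧ form m (ePlus m) u ≠ 0 ∧ form m u v.vec ≠ 0 by
    obtain ⟨u, hu, h1, h2⟩ := h
    obtain ⟨g, hg⟩ := exists_mulVec_eq_of_form_ne_zero (form_ePlus_self hm) hu h1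
    obtain ⟨g', hg'⟩ := exists_mulVec_eq_of_form_ne_zero hu (form_cone v) h2
    exact ⟨g' * g, by rw [mat_mul, ← Matrix.mulVec_mulVec, hg, hg']⟩
  by_cases h1 : form m (eMinus m) v.vec ≠ 0
  · refine ⟨eMinus m, form_eMinus_self hm, ?_, h1⟩
    rw [form_ePlus_eMinus hm]
    norm_num
  have h1 : form m (eMinus m) v.vec = 0 := not_not.1 h1
  have hp := form_ePlus_self hm
  -- Here `v` is orthogonal to both `e₀ ± e₃`, hence transverse and nonzero, and a basis vector can
  -- serve as `x`.
  obtain ⟨x, hx⟩ : ∃ x, form m (transverse x) v.vec ≠ 0 := by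
    have hv : transverse v.vec = v.vec := by
      rw [form_ePlus_left hm] at h2
      rw [form_eMinus_left hm] at h1
      nth_rw 2 [eq_transverse_add hm v.vec]
      rw [show v.vec 0 = 0 by linarith, show v.vec 3 = 0 by linarith]
      simp
    obtain ⟨k, hk⟩ := Function.ne_iff.1 v.2.1
    change v.vec k ≠ 0 at hk
    have hk' : ¬ (k = 0 ∨ k = 3) := by
      intro h
      apply hk
      rw [← hv]
      simp [transverse, h]
    refine ⟨Pi.single k 1, ?_⟩
    have : transverse (Pi.single k 1 : Fin (m + 1) → ℝ) = Pi.single k 1 := by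
      funext j
      by_cases hj : j = k
      · subst hj; simp [transverse, hk']
      · simp [transverse, hj]
    rw [this, form_single]
    refine mul_ne_zero (fun h => ?_) hk
    have := sgn_mul_self k
    rw [h] at this
    norm_num at this
  have hx0 := form_ePlus_transverse hm x
  -- This vector is null as the image of a null vector. Its products with `e₀ + e₃` and `v` are `-2`
  -- and `2⟨x, v⟩`.
  refine ⟨mat (expG (wedge (ePlus m) (transverse x))) *ᵥ eMinus m, ?_, ?_, ?_⟩
  · rw [form_mulVec, form_eMinus_self hm]
  · rw [exp_wedge_mulVec hp hx0]
    simp [hp, hx0, form_ePlus_eMinus hm]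
  · rw [exp_wedge_mulVec hp hx0]
    simp [h1, h2, form_ePlus_eMinus hm, hx]

end Light

section Stabilizer

variable {m : ℕ}

theorem zero_mem_nPlus : (0 : 𝔤 m) ∈ nPlus m := by
  simp [nPlus]

theorem one_mem_M (S : Subgroup ℝˣ) : (1 : G m) ∈ M S m :=
  ⟨1, S.one_mem, by rw [mat_one, Matrix.one_mulVec, Units.val_one, one_smul],
    by rw [mat_one, Matrix.one_mulVec, Units.val_one, one_smul]⟩

/-- The stabilizer of the vector `e₀ + e₃` is `M̂ N⁺`. -/
theorem exists_of_fixes_ePlus (S : Subgroup ℝˣ) (hm : 3 ≤ m) {q : G m}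
    (hq : mat q *ᵥ ePlus m = ePlus m) : ∃ μ ∈ M S m, ∃ X ∈ nPlus m, q = μ * expG X := by
  have hqi : mat q⁻¹ *ᵥ ePlus m = ePlus m := by
    conv_lhs => rw [← hq, Matrix.mulVec_mulVec, ← mat_mul, inv_mul_cancel, mat_one,
      Matrix.one_mulVec]
  obtain ⟨v, hv⟩ : ∃ v, v = mat q⁻¹ *ᵥ eMinus m := ⟨_, rfl⟩
  have h1 : form m (ePlus m) v = -2 := by
    rw [← form_ePlus_eMinus hm, hv]
    conv_lhs => rw [← hqi]
    exact form_mulVec _ _ _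
  have h2 : form m v v = 0 := by rw [hv, form_mulVec, form_eMinus_self hm]
  rw [form_ePlus_left hm] at h1
  rw [form_self hm] at h2
  -- The element `X` is chosen so that `exp X` sends `e₀ - e₃` to `v = q⁻¹(e₀ - e₃)`. The factor
  -- `2⁻¹` compensates `⟨e₀ + e₃, e₀ - e₃⟩ = -2`. Then `q exp X` fixes both null vectors, hence `e₀`
  -- and `e₃`.
  obtain ⟨X, hX⟩ : ∃ X, X = wedge (ePlus m) (transverse ((2⁻¹ : ℝ) • v)) := ⟨_, rfl⟩
  have hp := form_ePlus_self hm
  have hx := form_ePlus_transverse hm ((2⁻¹ : ℝ) • v)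
  have ht : transverse ((2⁻¹ : ℝ) • v) = (2⁻¹ : ℝ) • transverse v := by
    funext k
    by_cases h : k = 0 ∨ k = 3 <;> simp [transverse, h]
  have hv' : v 0 + v 3 = 2⁻¹ * form m (transverse v) (transverse v) := by
    rw [show v 0 - v 3 = 2 by linarith] at h2
    linarith
  have h3 : mat (expG X) *ᵥ eMinus m = v := by
    rw [hX, exp_wedge_mulVec hp hx, form_ePlus_eMinus hm, ht]
    nth_rw 5 [eq_transverse_add_null hm v]
    simp only [map_smul, LinearMap.smul_apply, form_symm (transverse v) (eMinus m),
      form_eMinus_transverse hm, smul_eq_mul]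
    rw [hv', show v 0 - v 3 = 2 by linarith]
    module
  have h4 : mat (expG X) *ᵥ ePlus m = ePlus m := by
    rw [hX, exp_wedge_mulVec hp hx, hp, form_symm, hx]
    simp
  have h5 : mat (q * expG X) *ᵥ ePlus m = ePlus m := by
    rw [mat_mul, ← Matrix.mulVec_mulVec, h4, hq]
  have h6 : mat (q * expG X) *ᵥ eMinus m = eMinus m := by
    rw [mat_mul, ← Matrix.mulVec_mulVec, h3, hv, Matrix.mulVec_mulVec, ← mat_mul, mul_inv_cancel,
      mat_one, Matrix.one_mulVec]
  refine ⟨q * expG X, ⟨1, S.one_mem, ?_, ?_⟩, -X, ?_, ?_⟩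
  · have : (Pi.single 0 1 : Fin (m + 1) → ℝ) = (2⁻¹ : ℝ) • (ePlus m + eMinus m) := by
      rw [ePlus, eMinus]
      module
    rw [this, Matrix.mulVec_smul, Matrix.mulVec_add, h5, h6, Units.val_one, one_smul]
  · have : (Pi.single 3 1 : Fin (m + 1) → ℝ) = (2⁻¹ : ℝ) • (ePlus m - eMinus m) := by
      rw [ePlus, eMinus]
      module
    rw [this, Matrix.mulVec_smul, Matrix.mulVec_sub, h5, h6, Units.val_one, one_smul]
  · have := wedge_mem_nPlus hm ((2⁻¹ : ℝ) • v)
    rw [← hX] at this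
    change ⁅H m, -X⁆ = -X
    rw [lie_neg]
    exact congrArg _ this
  · rw [expG_neg, mul_inv_cancel_right]

theorem exp_nPlus_mulVec_ePlus (hm : 3 ≤ m) {X : 𝔤 m} (hX : X ∈ nPlus m) :
    mat (expG X) *ᵥ ePlus m = ePlus m := by
  obtain ⟨x, rfl⟩ := exists_wedge_of_mem_nPlus hm hX
  rw [exp_wedge_mulVec (form_ePlus_self hm) (form_ePlus_transverse hm x), form_ePlus_self hm,
    form_symm, form_ePlus_transverse hm]
  simp

/-- The scalar is `±1` because `e₀` is not null and its square is preserved. -/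
theorem exists_M_mulVec_ePlus {S : Subgroup ℝˣ} (μ : G m) (hμ : μ ∈ M S m) :
    ∃ c ∈ S, |(c : ℝ)| = 1 ∧ mat μ *ᵥ ePlus m = (c : ℝ) • ePlus m := by
  obtain ⟨c, hc, h0, h3⟩ := hμ
  refine ⟨c, hc, ?_, ?_⟩
  · have := form_mulVec μ (Pi.single 0 1) (Pi.single 0 1)
    rw [h0] at this
    simp only [map_smul, LinearMap.smul_apply, form_single, sgn_zero, Pi.single_eq_same,
      smul_eq_mul] at this
    rw [← abs_one, ← sq_eq_sq_iff_abs_eq_abs]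
    linarith
  · rw [ePlus, Matrix.mulVec_add, h0, h3, smul_add]

end Stabilizer

/-! ### Functions on the group and functions on the Einstein universe -/

section Fibration

variable {m : ℕ}

theorem ePlus_ne_zero (hm : 3 ≤ m) : ePlus m ≠ 0 := by
  intro h
  have := congrFun h 0
  rw [ePlus_zero hm] at this
  simp at this

/-- The point `e₀ + e₃` of the cone. -/
def basePoint (hm : 3 ≤ m) : Cone m :=
  ⟨ePlus m, ePlus_ne_zero hm, by rw [← form_apply, form_ePlus_self hm]⟩

theorem exists_smul_basePoint (hm : 3 ≤ m) (v : Cone m) : ∃ g : G m, g • basePoint hm = v := by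
  obtain ⟨g, hg⟩ := exists_mulVec_ePlus hm v
  exact ⟨g, Subtype.ext hg⟩

theorem contDiff_mulVec_left (v : Fin (m + 1) → ℝ) :
    ContDiff ℝ ∞ (fun A : Matrix (Fin (m + 1)) (Fin (m + 1)) ℝ => A *ᵥ v) :=
  (LinearMap.toContinuousLinearMap 
    { toFun := fun A : Matrix (Fin (m + 1)) (Fin (m + 1)) ℝ => A *ᵥ v
      map_add' := fun A B => Matrix.add_mulVec A B v
      map_smul' := fun c A => Matrix.smul_mulVec c A v }).contDiff

/-- The logarithm of the factor by which a group element stretches `e₀ + e₃`. -/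
def logStretch (hm : 3 ≤ m) : CG m :=
  ⟨fun g => (Real.log (euclNorm (mat g *ᵥ ePlus m) / euclNorm (ePlus m)) : ℝ), by
    intro g
    have hc := contDiff_mulVec_left (ePlus m)
    refine ⟨(fun A : Matrix (Fin (m + 1)) (Fin (m + 1)) ℝ => A *ᵥ ePlus m) ⁻¹' {0}ᶜ,
      isOpen_compl_singleton.preimage hc.continuous, mat_mulVec_ne g (ePlus_ne_zero hm),
      fun A => (Real.log (euclNorm (A *ᵥ ePlus m) / euclNorm (ePlus m)) : ℝ), ?_, fun _ _ => rfl⟩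
    intro A hA
    have hA : A *ᵥ ePlus m ≠ 0 := hA
    have h1 : ContDiffAt ℝ ∞ (fun A : Matrix (Fin (m + 1)) (Fin (m + 1)) ℝ =>
        Real.log (euclNorm (A *ᵥ ePlus m) / euclNorm (ePlus m))) A := by
      refine ContDiffAt.log (ContDiffAt.div ?_ contDiffAt_const (euclNorm_pos (ePlus_ne_zero hm)).ne')
        (div_pos (euclNorm_pos hA) (euclNorm_pos (ePlus_ne_zero hm))).ne'
      exact ContDiffAt.comp (g := (euclNorm : (Fin (m + 1) → ℝ) → ℝ)) A
        (contDiffAt_euclNorm hA) hc.contDiffAt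
    exact (Complex.ofRealCLM.contDiff.contDiffAt.comp A h1).contDiffWithinAt⟩

theorem logStretch_apply (hm : 3 ≤ m) (g : G m) : (logStretch hm : G m → ℂ) g =
    (Real.log (euclNorm (mat g *ᵥ ePlus m) / euclNorm (ePlus m)) : ℝ) := rfl

theorem logStretch_eq (S : Subgroup ℝˣ) (hm : 3 ≤ m) (g : G m) : (logStretch hm : G m → ℂ) g =
    (Real.log (stretch g (Ein.mk S (basePoint hm))) : ℝ) := rfl

theorem SmoothVia.cexp {X E : Type*} [NormedAddCommGroup E] [NormedSpace ℝ E] {ι : X → E}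
    {f : X → ℂ} (hf : SmoothVia ι f) : SmoothVia ι fun x => Complex.exp (f x) := by
  intro s
  obtain ⟨U, hU, hs, F, hF, hFf⟩ := hf s
  exact ⟨U, hU, hs, fun y => Complex.exp (F y), hF.cexp, fun s' hs' =>
    congrArg Complex.exp (hFf s' hs')⟩

/-- The power `|g (e₀ + e₃)|^λ / |e₀ + e₃|^λ`. -/
def stretchPow (hm : 3 ≤ m) (lam : ℂ) : CG m :=
  ⟨fun g => Complex.exp (lam * (logStretch hm : G m → ℂ) g),
    SmoothVia.cexp (SmoothVia.mul (SmoothVia.const _ lam) (logStretch hm).2)⟩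

theorem stretchPow_apply (hm : 3 ≤ m) (lam : ℂ) (g : G m) : (stretchPow hm lam : G m → ℂ) g =
    Complex.exp (lam * (logStretch hm : G m → ℂ) g) := rfl

theorem stretchPow_add (hm : 3 ≤ m) (lam mu : ℂ) :
    stretchPow hm (lam + mu) = stretchPow hm lam * stretchPow hm mu := by
  ext g
  change _ = (stretchPow hm lam : G m → ℂ) g * (stretchPow hm mu : G m → ℂ) g
  simp only [stretchPow_apply, add_mul, Complex.exp_add]

theorem stretchPow_zero (hm : 3 ≤ m) : stretchPow hm 0 = 1 := by
  ext g
  change (stretchPow hm 0 : G m → ℂ) g = 1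
  rw [stretchPow_apply, zero_mul, Complex.exp_zero]

theorem stretchPow_mul_neg (hm : 3 ≤ m) (lam : ℂ) :
    stretchPow hm lam * stretchPow hm (-lam) = 1 := by
  rw [← stretchPow_add, add_neg_cancel, stretchPow_zero]

theorem isUnit_stretchPow (hm : 3 ≤ m) (lam : ℂ) : IsUnit (stretchPow hm lam) :=
  IsUnit.of_mul_eq_one _ (stretchPow_mul_neg hm lam)

/-- The pull-back of functions along `g ↦ [g (e₀ + e₃)]`. -/
def orbitPull (S : Subgroup ℝˣ) (hm : 3 ≤ m) : CEin S m →ₐ[ℂ] CG m where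
  toFun F := ⟨fun g => (F : Ein S m → ℂ) (Ein.mk S (g • basePoint hm)),
    SmoothVia.comp (κ := (mat : G m → _)) F.2 (fun g => g • basePoint hm) _
      (contDiff_mulVec_left (ePlus m)) (fun _ => rfl)⟩
  map_one' := rfl
  map_mul' _ _ := rfl
  map_zero' := rfl
  map_add' _ _ := rfl
  commutes' _ := rfl

theorem orbitPull_apply (S : Subgroup ℝˣ) (hm : 3 ≤ m) (F : CEin S m) (g : G m) :
    (orbitPull S hm F : G m → ℂ) g = (F : Ein S m → ℂ) (Ein.mk S (g • basePoint hm)) := rfl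

theorem orbitPull_injective (S : Subgroup ℝˣ) (hm : 3 ≤ m) :
    Function.Injective (orbitPull S hm) := by
  intro F F' h
  ext x
  induction x using Quotient.inductionOn with
  | h v =>
    obtain ⟨g, rfl⟩ := exists_smul_basePoint hm v
    exact congrArg (fun u : CG m => (u : G m → ℂ) g) h

theorem euclNorm_smul (c : ℝ) (v : Fin (m + 1) → ℝ) : euclNorm (c • v) = |c| * euclNorm v := by
  rw [euclNorm, euclNorm, smul_dotProduct, dotProduct_smul, smul_smul,
    smul_eq_mul, Real.sqrt_mul (mul_self_nonneg _), Real.sqrt_mul_self_eq_abs]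

theorem logStretch_of_smul (hm : 3 ≤ m) {g h : G m} {c : ℝ} (hc : c ≠ 0)
    (hgh : mat h *ᵥ ePlus m = c • mat g *ᵥ ePlus m) :
    (logStretch hm : G m → ℂ) h = Real.log |c| + (logStretch hm : G m → ℂ) g := by
  have h0 := euclNorm_pos (ePlus_ne_zero hm)
  have h1 := euclNorm_pos (mat_mulVec_ne g (ePlus_ne_zero hm))
  rw [logStretch_apply, logStretch_apply, hgh, euclNorm_smul, mul_div_assoc,
    Real.log_mul (abs_pos.2 hc).ne' (div_pos h1 h0).ne', Complex.ofReal_add]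

theorem mk_eq_mk {S : Subgroup ℝˣ} {v w : Cone m} {c : ℝˣ} (hc : c ∈ S)
    (h : w.vec = (c : ℝ) • v.vec) : Ein.mk S w = Ein.mk S v :=
  (Quotient.sound (s := scaleSetoid S m) ⟨c, hc, h⟩ : Ein.mk S v = Ein.mk S w).symm

/-- The element `μ exp(tH) ν` multiplies `e₀ + e₃` by `±e^t`: the class of `g(e₀ + e₃)` is
unchanged, while the stretching factor is multiplied by `e^t`. -/
theorem mul_orbitPull_mem_Ind {S : Subgroup ℝˣ} (hS : Units.posSubgroup ℝ ≤ S) (hm : 3 ≤ m)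
    (lam : ℂ) (F : CEin S m) : stretchPow hm lam * orbitPull S hm F ∈ Ind S m lam := by
  intro g μ hμ t X hX
  obtain ⟨c, hc, hc1, hce⟩ := exists_M_mulVec_ePlus μ hμ
  obtain ⟨r, hr⟩ : ∃ r : ℝˣ, (r : ℝ) = Real.exp t := ⟨Units.mk0 _ (Real.exp_pos t).ne', rfl⟩
  have hrS : r ∈ S := hS (by rw [Units.mem_posSubgroup, hr]; exact Real.exp_pos t)
  have h1 : mat (g * μ * expG (t • H m) * expG X) *ᵥ ePlus m =
      ((r * c : ℝˣ) : ℝ) • mat g *ᵥ ePlus m := by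
    rw [mat_mul, mat_mul, mat_mul, ← Matrix.mulVec_mulVec, exp_nPlus_mulVec_ePlus hm hX,
      ← Matrix.mulVec_mulVec, exp_H_mulVec_ePlus hm, Matrix.mulVec_smul, ← Matrix.mulVec_mulVec,
      hce, Matrix.mulVec_smul, smul_smul, Units.val_mul, hr]
  have h3 : Real.log |((r * c : ℝˣ) : ℝ)| = t := by
    rw [Units.val_mul, abs_mul, hc1, mul_one, hr, abs_of_pos (Real.exp_pos t), Real.log_exp]
  change (stretchPow hm lam : G m → ℂ) _ * (orbitPull S hm F : G m → ℂ) _ =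
    _ * ((stretchPow hm lam : G m → ℂ) g * (orbitPull S hm F : G m → ℂ) g)
  rw [stretchPow_apply, logStretch_of_smul hm (r * c).ne_zero h1, h3, orbitPull_apply,
    mk_eq_mk (v := g • basePoint hm) (w := (g * μ * expG (t • H m) * expG X) • basePoint hm)
      (S.mul_mem hrS hc) h1, orbitPull_apply, stretchPow_apply,
    mul_add, Complex.exp_add, mul_assoc]

theorem Ind_mul_M {S : Subgroup ℝˣ} {lam : ℂ} {u : CG m} (hu : u ∈ Ind S m lam) (g : G m)
    {μ : G m} (hμ : μ ∈ M S m) : (u : G m → ℂ) (g * μ) = (u : G m → ℂ) g := by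
  have := hu g μ hμ 0 0 zero_mem_nPlus
  simpa [expG_zero] using this

theorem Ind_mul_A {S : Subgroup ℝˣ} {lam : ℂ} {u : CG m} (hu : u ∈ Ind S m lam) (g : G m) (t : ℝ) :
    (u : G m → ℂ) (g * expG (t • H m)) = Complex.exp (lam * t) * (u : G m → ℂ) g := by
  have := hu g 1 (one_mem_M S) t 0 zero_mem_nPlus
  simpa [expG_zero] using this

theorem Ind_mul_N {S : Subgroup ℝˣ} {lam : ℂ} {u : CG m} (hu : u ∈ Ind S m lam) (g : G m)
    {X : 𝔤 m} (hX : X ∈ nPlus m) : (u : G m → ℂ) (g * expG X) = (u : G m → ℂ) g := by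
  have := hu g 1 (one_mem_M S) 0 X hX
  simpa [expG_zero] using this

/-- The elements `h` and `g exp((log c) H)` have the same effect on `e₀ + e₃`, so they differ by its
stabilizer `M̂ N⁺`, under which `u` is invariant. -/
theorem Ind_of_pos_smul {S : Subgroup ℝˣ} (hm : 3 ≤ m) {lam : ℂ} {u : CG m}
    (hu : u ∈ Ind S m lam) {g h : G m} {c : ℝ} (hc : 0 < c)
    (hgh : mat h *ᵥ ePlus m = c • mat g *ᵥ ePlus m) :
    (u : G m → ℂ) h = Complex.exp (lam * Real.log c) * (u : G m → ℂ) g := by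
  obtain ⟨μ, hμ, X, hX, hq⟩ := exists_of_fixes_ePlus S hm
    (q := (g * expG (Real.log c • H m))⁻¹ * h) (by
      have h1 : mat h *ᵥ ePlus m = mat (g * expG (Real.log c • H m)) *ᵥ ePlus m := by
        rw [mat_mul, ← Matrix.mulVec_mulVec, exp_H_mulVec_ePlus hm, Real.exp_log hc,
          Matrix.mulVec_smul, hgh]
      rw [mat_mul, ← Matrix.mulVec_mulVec, h1, Matrix.mulVec_mulVec, ← mat_mul, inv_mul_cancel,
        mat_one, Matrix.one_mulVec])
  rw [inv_mul_eq_iff_eq_mul, ← mul_assoc] at hq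
  rw [hq, Ind_mul_N hu _ hX, Ind_mul_M hu _ hμ, Ind_mul_A hu]

/-- A negative scalar is made positive by replacing `h` with `-h`; this does not change `u` since
then `-1` lies in `M`. -/
theorem Ind_of_smul {S : Subgroup ℝˣ} (hS : ∀ c ∈ S, (c : ℝ) < 0 → (-1 : ℝˣ) ∈ S) (hm : 3 ≤ m)
    {lam : ℂ} {u : CG m} (hu : u ∈ Ind S m lam) {g h : G m} {c : ℝˣ} (hc : c ∈ S)
    (hgh : mat h *ᵥ ePlus m = (c : ℝ) • mat g *ᵥ ePlus m) :
    (u : G m → ℂ) h = Complex.exp (lam * Real.log |(c : ℝ)|) * (u : G m → ℂ) g := by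
  rcases lt_or_gt_of_ne c.ne_zero with h0 | h0
  · have hn : mat (ofMat (-1 : Matrix (Fin (m + 1)) (Fin (m + 1)) ℝ) (by simp)) = -1 := rfl
    generalize (ofMat (-1 : Matrix (Fin (m + 1)) (Fin (m + 1)) ℝ) (by simp)) = z at hn
    have hz : z ∈ M S m := ⟨-1, hS c hc h0,
      by rw [hn, Matrix.neg_mulVec, Matrix.one_mulVec, Units.val_neg, Units.val_one, neg_one_smul],
      by rw [hn, Matrix.neg_mulVec, Matrix.one_mulVec, Units.val_neg, Units.val_one, neg_one_smul]⟩
    rw [← Ind_mul_M hu h hz]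
    refine Ind_of_pos_smul hm hu (abs_pos.2 c.ne_zero) ?_
    rw [mat_mul, ← Matrix.mulVec_mulVec, hn, Matrix.neg_mulVec, Matrix.one_mulVec,
      Matrix.mulVec_neg, hgh, abs_of_neg h0, neg_smul]
  · rw [abs_of_pos h0]
    exact Ind_of_pos_smul hm hu h0 hgh

/-- The matrix of a local section of `g ↦ g (e₀ + e₃)` near `e₀ + e₃`. -/
def sectionMat (w : Fin (m + 1) → ℝ) : Matrix (Fin (m + 1)) (Fin (m + 1)) ℝ :=
  let X := (wedge (eMinus m) ((w 0 + w 3)⁻¹ • transverse w)).1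
  1 + X + (2⁻¹ : ℝ) • (X * X)

theorem contDiffOn_sectionMat :
    ContDiffOn ℝ ∞ (sectionMat : (Fin (m + 1) → ℝ) → _) {w | 0 < w 0 + w 3} := by
  have hX : ContDiffOn ℝ ∞ (fun w : Fin (m + 1) → ℝ =>
      (wedge (eMinus m) ((w 0 + w 3)⁻¹ • transverse w)).1) {w | 0 < w 0 + w 3} := by
    refine (LinearMap.toContinuousLinearMap
      ((𝔤 m).toSubmodule.subtype ∘ₗ wedge (eMinus m))).contDiff.comp_contDiffOn ?_
    refine ContDiffOn.smul (ContDiffOn.inv (f := fun w : Fin (m + 1) → ℝ => w 0 + w 3) ?_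
      fun w (hw : 0 < w 0 + w 3) => hw.ne') ?_
    · fun_prop
    · refine contDiffOn_pi.2 fun k => ?_
      by_cases h : k = 0 ∨ k = 3
      · simpa [transverse, h] using contDiffOn_const
      · simp only [transverse, h, if_false]
        fun_prop
  exact (contDiffOn_const.add hX).add ((hX.mul hX).const_smul _)

theorem sectionMat_eq (hm : 3 ≤ m) (w : Fin (m + 1) → ℝ) : sectionMat w =
    mat (expG (wedge (eMinus m) ((w 0 + w 3)⁻¹ • transverse w))) := by
  rw [exp_wedge (form_eMinus_self hm)]
  · rfl
  · rw [map_smul, form_eMinus_transverse hm, smul_zero]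

/-- One has `exp((e₀ - e₃) ∧ x)(e₀ + e₃) = (e₀ + e₃) + 2x + ⟨x, x⟩(e₀ - e₃)`. With `x` the
transverse part of `w` divided by `w₀ + w₃`, nullity of `w` gives `⟨x, x⟩ = (w₀ - w₃)/(w₀ + w₃)`. -/
theorem sectionMat_mulVec (hm : 3 ≤ m) {w : Fin (m + 1) → ℝ} (hw : form m w w = 0)
    (hpos : 0 < w 0 + w 3) : w = ((w 0 + w 3) / 2) • sectionMat w *ᵥ ePlus m := by
  have hx : form m (eMinus m) ((w 0 + w 3)⁻¹ • transverse w) = 0 := by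
    rw [map_smul, form_eMinus_transverse hm, smul_zero]
  have h1 : form m (transverse w) (transverse w) = (w 0 + w 3) * (w 0 - w 3) := by
    rw [form_self hm] at hw
    linarith
  rw [sectionMat_eq hm, exp_wedge_mulVec (form_eMinus_self hm) hx]
  nth_rw 1 [eq_transverse_add_null hm w]
  simp only [map_smul, LinearMap.smul_apply, h1, form_symm (transverse w) (ePlus m),
    form_ePlus_transverse hm, form_symm (eMinus m) (ePlus m), form_ePlus_eMinus hm, smul_eq_mul]
  generalize w 0 - w 3 = d
  generalize transverse w = z
  generalize w 0 + w 3 = s at hpos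
  have hs := hpos.ne'
  match_scalars <;> field_simp <;> ring_nf

/-- After division by the stretching power, `u` is constant on the fibres of `g ↦ [g(e₀ + e₃)]` and
descends to the quotient. Local sections show that the descended function is smooth. -/
theorem exists_of_mem_Ind {S : Subgroup ℝˣ} (hS : ∀ c ∈ S, (c : ℝ) < 0 → (-1 : ℝˣ) ∈ S)
    (hm : 3 ≤ m) {lam : ℂ} {u : CG m} (hu : u ∈ Ind S m lam) :
    ∃ F : CEin S m, stretchPow hm lam * orbitPull S hm F = u := by
  -- A section without any regularity defines `F`; near each point it is replaced by a smooth one.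
  choose sec hsec using exists_smul_basePoint (m := m) hm
  have hsec' : ∀ v, mat (sec v) *ᵥ ePlus m = v.vec := fun v => congrArg Cone.vec (hsec v)
  let w : CG m := stretchPow hm (-lam) * u
  have hw : ∀ g, (w : G m → ℂ) g =
      Complex.exp (-lam * (logStretch hm : G m → ℂ) g) * (u : G m → ℂ) g := fun g => rfl
  have hinv : ∀ {g h : G m} {c : ℝ}, c ≠ 0 → mat h *ᵥ ePlus m = c • mat g *ᵥ ePlus m →
      (u : G m → ℂ) h = Complex.exp (lam * Real.log |c|) * (u : G m → ℂ) g →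
      (w : G m → ℂ) h = (w : G m → ℂ) g := by
    intro g h c hc hgh huh
    rw [hw, hw, logStretch_of_smul hm hc hgh, huh, ← mul_assoc, ← Complex.exp_add]
    congr 2
    ring
  let F : Ein S m → ℂ := Quotient.lift (fun v => (w : G m → ℂ) (sec v)) (by
    rintro v v' ⟨c, hc, h⟩
    have h' : mat (sec v') *ᵥ ePlus m = (c : ℝ) • mat (sec v) *ᵥ ePlus m := by
      rw [hsec', hsec', h]
    exact (hinv c.ne_zero h' (Ind_of_smul hS hm hu hc h')).symm)
  have hFg : ∀ {g v} {c : ℝ}, 0 < c → v.vec = c • mat g *ᵥ ePlus m →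
      F (Ein.mk S v) = (w : G m → ℂ) g := by
    intro g v c hc h
    rw [← hsec'] at h
    exact hinv hc.ne' h (by rw [abs_of_pos hc]; exact Ind_of_pos_smul hm hu hc h)
  have hF : F ∈ CEin S m := by
    intro v₀
    obtain ⟨U, hU, hgU, W, hW, hWw⟩ := w.2 (sec v₀)
    have hv₀ : mat (sec v₀)⁻¹ *ᵥ v₀.vec = ePlus m := by
      rw [← hsec', Matrix.mulVec_mulVec, ← mat_mul, inv_mul_cancel, mat_one, Matrix.one_mulVec]
    obtain ⟨T, hT⟩ : ∃ T : (Fin (m + 1) → ℝ) → (Fin (m + 1) → ℝ),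
        T = fun v => mat (sec v₀)⁻¹ *ᵥ v := ⟨_, rfl⟩
    have hTc : ContDiff ℝ ∞ T := by rw [hT]; exact contDiff_mulVec _
    have hTv : ∀ v : Cone m, form m (T v.vec) (T v.vec) = 0 := fun v => by
      rw [hT]
      exact (form_mulVec _ _ _).trans (form_cone v)
    have hTi : ∀ v, mat (sec v₀) *ᵥ T v = v := fun v => by
      rw [hT, Matrix.mulVec_mulVec, ← mat_mul, mul_inv_cancel, mat_one, Matrix.one_mulVec]
    have hT0 : T v₀.vec = ePlus m := by rw [hT]; exact hv₀
    -- Translating by `sec v₀` moves the local section at `e₀ + e₃` to `v₀`. The formula makes sense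
    -- on an open set of the ambient space, but takes values in the group only on the cone.
    have hΦ : ContDiffOn ℝ ∞ (fun v => mat (sec v₀) * sectionMat (T v))
        (T ⁻¹' {w | 0 < w 0 + w 3}) :=
      contDiffOn_const.mul (contDiffOn_sectionMat.comp hTc.contDiffOn fun _ h => h)
    have hV : IsOpen (T ⁻¹' {w | 0 < w 0 + w 3}) :=
      (isOpen_lt continuous_const (by fun_prop)).preimage hTc.continuous
    refine ⟨_, hΦ.continuousOn.isOpen_inter_preimage hV hU, ⟨?_, ?_⟩,
      fun v => W (mat (sec v₀) * sectionMat (T v)),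
      hW.comp (hΦ.mono Set.inter_subset_left) fun v hv => hv.2, ?_⟩
    · change 0 < T v₀.vec 0 + T v₀.vec 3
      rw [hT0, ePlus_zero hm, ePlus_three hm]
      norm_num
    · change mat (sec v₀) * sectionMat (T v₀.vec) ∈ U
      have : transverse (ePlus m) = 0 := by
        funext k
        by_cases h : k = 0 ∨ k = 3
        · simp [transverse, h]
        · have h' := not_or.1 h
          simp [transverse, ePlus, h'.1, h'.2]
      rw [hT0, sectionMat_eq hm, this, smul_zero, map_zero, expG_zero, mat_one, mul_one]
      exact hgU
    · intro v hv
      have hpos : 0 < T v.vec 0 + T v.vec 3 := hv.1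
      have hU' : mat (sec v₀) * sectionMat (T v.vec) ∈ U := hv.2
      have hmat := sectionMat_eq hm (T v.vec)
      have hvec := sectionMat_mulVec hm (hTv v) hpos
      dsimp only
      rw [hmat, ← mat_mul] at hU' ⊢
      rw [hmat] at hvec
      rw [hWw _ hU']
      refine (hFg (half_pos hpos) ?_).symm
      rw [mat_mul, ← Matrix.mulVec_mulVec, ← Matrix.mulVec_smul, ← hvec, hTi]
  refine ⟨⟨F, hF⟩, ?_⟩
  have : orbitPull S hm ⟨F, hF⟩ = w := by
    ext g
    exact hFg one_pos (by rw [one_smul]; rfl)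
  rw [this, ← mul_assoc, stretchPow_mul_neg, one_mul]

end Fibration

/-! ### The inclusion of the groups -/

section Inclusion

variable {m : ℕ}

theorem vecIncl_castSucc (v : Fin (m + 1) → ℝ) (i : Fin (m + 1)) : vecIncl v i.castSucc = v i := by
  have : i.castSucc = finSumFinEquiv (Sum.inl i) := rfl
  rw [this, vecIncl, Function.comp_apply, Equiv.symm_apply_apply, Sum.elim_inl]

theorem vecIncl_last (v : Fin (m + 1) → ℝ) : vecIncl v (Fin.last (m + 1)) = 0 := by
  have : Fin.last (m + 1) = finSumFinEquiv (Sum.inr 0 : Fin (m + 1) ⊕ Fin 1) := rfl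
  rw [this, vecIncl, Function.comp_apply, Equiv.symm_apply_apply, Sum.elim_inr, Pi.zero_apply]

theorem blockIncl_apply (A : Matrix (Fin (m + 1)) (Fin (m + 1)) ℝ) (i j : Fin (m + 1)) :
    blockIncl A i.castSucc j.castSucc = A i j := by
  have h : ∀ i : Fin (m + 1), i.castSucc = finSumFinEquiv (Sum.inl i) := fun _ => rfl
  simp [h, blockIncl]

theorem blockIncl_castSucc_last (A : Matrix (Fin (m + 1)) (Fin (m + 1)) ℝ) (i : Fin (m + 1)) :
    blockIncl A i.castSucc (Fin.last (m + 1)) = 0 := by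
  have h : i.castSucc = finSumFinEquiv (Sum.inl i) := rfl
  have h' : Fin.last (m + 1) = finSumFinEquiv (Sum.inr 0 : Fin (m + 1) ⊕ Fin 1) := rfl
  simp only [h, h', blockIncl, Matrix.reindex_apply, Matrix.submatrix_apply,
    Equiv.symm_apply_apply, Matrix.fromBlocks_apply₁₂, Matrix.zero_apply]

theorem blockIncl_last (A : Matrix (Fin (m + 1)) (Fin (m + 1)) ℝ) (j : Fin (m + 1 + 1)) :
    blockIncl A (Fin.last (m + 1)) j = if j = Fin.last (m + 1) then 1 else 0 := by
  have h' : Fin.last (m + 1) = finSumFinEquiv (Sum.inr 0 : Fin (m + 1) ⊕ Fin 1) := rfl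
  obtain ⟨j, rfl⟩ := finSumFinEquiv.surjective j
  rw [h']
  rcases j with j | j
  · simp only [blockIncl, Matrix.reindex_apply, Matrix.submatrix_apply,
      Equiv.symm_apply_apply, Matrix.fromBlocks_apply₂₁, Matrix.zero_apply,
      EmbeddingLike.apply_eq_iff_eq, reduceCtorEq, if_false]
  · simp [blockIncl, Subsingleton.elim j 0]

theorem blockIncl_mulVec_vecIncl (A : Matrix (Fin (m + 1)) (Fin (m + 1)) ℝ)
    (v : Fin (m + 1) → ℝ) : blockIncl A *ᵥ vecIncl v = vecIncl (A *ᵥ v) := by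
  funext i
  rw [Matrix.mulVec, dotProduct, Fin.sum_univ_castSucc, vecIncl_last, mul_zero, add_zero]
  simp only [vecIncl_castSucc]
  induction i using Fin.lastCases with
  | last =>
    rw [vecIncl_last]
    refine Finset.sum_eq_zero fun j _ => ?_
    rw [blockIncl_last, if_neg (Fin.castSucc_lt_last j).ne, zero_mul]
  | cast i =>
    simp only [vecIncl_castSucc, blockIncl_apply]
    rfl

theorem blockIncl_mulVec_last (A : Matrix (Fin (m + 1)) (Fin (m + 1)) ℝ) :
    blockIncl A *ᵥ Pi.single (Fin.last (m + 1)) 1 = Pi.single (Fin.last (m + 1)) 1 := by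
  funext i
  rw [Matrix.mulVec_single_one, Matrix.col_apply]
  induction i using Fin.lastCases with
  | last => simp [blockIncl_last]
  | cast i => simp [blockIncl_castSucc_last, (Fin.castSucc_lt_last i).ne]

theorem vecIncl_add (v w : Fin (m + 1) → ℝ) : vecIncl (v + w) = vecIncl v + vecIncl w := by
  funext i
  induction i using Fin.lastCases <;> simp [vecIncl_castSucc, vecIncl_last]

theorem vecIncl_smul (c : ℝ) (v : Fin (m + 1) → ℝ) : vecIncl (c • v) = c • vecIncl v := by
  funext i
  induction i using Fin.lastCases <;> simp [vecIncl_castSucc, vecIncl_last]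

/-- `vecIncl` as a linear map. -/
def vecInclLin : (Fin (m + 1) → ℝ) →ₗ[ℝ] (Fin (m + 1 + 1) → ℝ) where
  toFun := vecIncl
  map_add' := vecIncl_add
  map_smul' := vecIncl_smul

theorem vecIncl_single (i : Fin (m + 1)) :
    vecIncl (Pi.single i 1) = Pi.single i.castSucc 1 := by
  funext j
  induction j using Fin.lastCases with
  | last => simp [vecIncl_last, (Fin.castSucc_lt_last i).ne']
  | cast j => simp [vecIncl_castSucc, Pi.single_apply]

theorem vecIncl_ePlus (hm : 3 ≤ m) : vecIncl (ePlus m) = ePlus (m + 1) := by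
  rw [ePlus, vecIncl_add, vecIncl_single, vecIncl_single, castSucc_three hm]
  rfl

theorem vecIncl_eMinus (hm : 3 ≤ m) : vecIncl (eMinus m) = eMinus (m + 1) := by
  rw [eMinus, sub_eq_add_neg, ← neg_one_smul ℝ, vecIncl_add, vecIncl_smul, vecIncl_single,
    vecIncl_single, castSucc_three hm, neg_one_smul, ← sub_eq_add_neg]
  rfl

theorem mat_incl_mulVec (g : G m) (v : Fin (m + 1) → ℝ) :
    mat (incl m g) *ᵥ vecIncl v = vecIncl (mat g *ᵥ v) :=
  blockIncl_mulVec_vecIncl _ _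

/-- The map `A ↦ diag(A, 0)` is not unital and `A ↦ diag(A, 1)` is not additive, but both are
restrictions of the continuous ring homomorphism `(A, a) ↦ diag(A, a)`, which commutes with `exp`;
and `exp 0 = 1` in the corner. -/
theorem incl_expG_wedge (p x : Fin (m + 1) → ℝ) :
    incl m (expG (wedge p x)) = expG (wedge (vecIncl p) (vecIncl x)) := by
  let f : Matrix (Fin (m + 1)) (Fin (m + 1)) ℝ × ℝ →+* Matrix (Fin (m + 1 + 1)) (Fin (m + 1 + 1)) ℝ :=
    { toFun := fun a => Matrix.reindex finSumFinEquiv finSumFinEquiv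
        (Matrix.fromBlocks a.1 0 0 (Matrix.diagonal fun _ : Fin 1 => a.2))
      map_one' := by simp [Matrix.fromBlocks_one]
      map_zero' := by
        simp
      map_mul' := fun a b => by
        simp [Matrix.submatrix_mul_equiv, Matrix.fromBlocks_multiply]
      map_add' := fun a b => by
        have : (Matrix.diagonal fun _ : Fin 1 => (a + b).2) =
          (Matrix.diagonal fun _ : Fin 1 => a.2) + Matrix.diagonal fun _ : Fin 1 => b.2 := by simp
        rw [this, Prod.fst_add]
        ext i j
        obtain ⟨i, rfl⟩ := finSumFinEquiv.surjective i
        obtain ⟨j, rfl⟩ := finSumFinEquiv.surjective j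
        rcases i with i | i <;> rcases j with j | j <;> simp
        rw [Subsingleton.elim i j]
        simp }
  have hf : Continuous f := by
    change Continuous fun a : Matrix (Fin (m + 1)) (Fin (m + 1)) ℝ × ℝ =>
      Matrix.reindex finSumFinEquiv finSumFinEquiv
        (Matrix.fromBlocks a.1 0 0 (Matrix.diagonal fun _ : Fin 1 => a.2))
    refine Continuous.matrix_reindex ?_ _ _
    refine Continuous.matrix_fromBlocks continuous_fst continuous_const continuous_const ?_
    exact Continuous.matrix_diagonal (continuous_pi fun _ => continuous_snd)
  have h1 : (wedge (vecIncl p) (vecIncl x)).1 = f ((wedge p x).1, 0) := by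
    ext i j
    have hv : ∀ (v : Fin (m + 1) → ℝ) i, vecIncl v (finSumFinEquiv (Sum.inl i)) = v i :=
      vecIncl_castSucc
    have hv' : ∀ (v : Fin (m + 1) → ℝ) i, vecIncl v (finSumFinEquiv (Sum.inr i)) = 0 := by
      intro v i
      simp [vecIncl]
    have hs : ∀ i, sgn (m + 1) (finSumFinEquiv (Sum.inl i)) = sgn m i := sgn_castSucc
    obtain ⟨i, rfl⟩ := finSumFinEquiv.surjective i
    obtain ⟨j, rfl⟩ := finSumFinEquiv.surjective j
    change _ = Matrix.reindex finSumFinEquiv finSumFinEquiv (Matrix.fromBlocks (wedge p x).1 0 0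
      (Matrix.diagonal fun _ : Fin 1 => (0 : ℝ))) _ _
    rw [Matrix.reindex_apply, Matrix.submatrix_apply, Equiv.symm_apply_apply,
      Equiv.symm_apply_apply]
    rcases i with i | i <;> rcases j with j | j <;>
      simp only [wedge_coe, gram, Matrix.sub_apply, Matrix.vecMulVec_apply, Matrix.mulVec_diagonal,
        hv, hv', hs, Matrix.fromBlocks_apply₁₁, Matrix.fromBlocks_apply₁₂,
        Matrix.fromBlocks_apply₂₁, Matrix.fromBlocks_apply₂₂, Matrix.diagonal_zero,
        Matrix.zero_apply] <;> ring
  refine mat_injective ?_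
  rw [mat_incl, mat_expG, mat_expG, h1]
  refine Eq.trans ?_ (NormedSpace.map_exp f hf ((wedge p x).1, (0 : ℝ)))
  have h2 : NormedSpace.exp ((wedge p x).1, (0 : ℝ)) = (NormedSpace.exp (wedge p x).1, 1) :=
    Prod.ext (Prod.fst_exp _) ((Prod.snd_exp _).trans NormedSpace.exp_zero)
  refine Eq.trans ?_ (congrArg f h2.symm)
  change _ = Matrix.reindex finSumFinEquiv finSumFinEquiv (Matrix.fromBlocks
    (NormedSpace.exp (wedge p x).1) 0 0 (Matrix.diagonal fun _ : Fin 1 => (1 : ℝ)))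
  rw [Matrix.diagonal_one]
  rfl

theorem incl_expG_H (hm : 3 ≤ m) (t : ℝ) : incl m (expG (t • H m)) = expG (t • H (m + 1)) := by
  have h : ∀ m, t • H m = wedge (t • Pi.single 0 1) (Pi.single 3 1) := fun m => by
    rw [map_smul, LinearMap.smul_apply, ← rot_eq_wedge, H]
  rw [h, h, incl_expG_wedge, vecIncl_smul, vecIncl_single, vecIncl_single, castSucc_three hm]
  rfl

theorem mat_mul_gram_mul_transpose (g : G m) : mat g * gram m * (mat g)ᵀ = gram m := by
  have h1 : (gram m * (mat g)ᵀ * gram m) * mat g = 1 := by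
    rw [mul_assoc, mul_assoc, ← mul_assoc (mat g)ᵀ, mat_gram, gram_mul_gram]
  have h2 := mul_eq_one_comm.1 h1
  calc mat g * gram m * (mat g)ᵀ = mat g * (gram m * (mat g)ᵀ * gram m) * gram m := by
        simp only [mul_assoc, gram_mul_gram, mul_one]
    _ = gram m := by rw [h2, one_mul]

theorem incl_mem_M {S : Subgroup ℝˣ} (hm : 3 ≤ m) {μ : G m} (hμ : μ ∈ M S m) :
    incl m μ ∈ M S (m + 1) := by
  obtain ⟨c, hc, h0, h3⟩ := hμ
  refine ⟨c, hc, ?_, ?_⟩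
  · have : (Pi.single 0 1 : Fin (m + 2) → ℝ) = vecIncl (Pi.single 0 1) := (vecIncl_single 0).symm
    rw [this, mat_incl_mulVec, h0, vecIncl_smul]
  · have : (Pi.single 3 1 : Fin (m + 2) → ℝ) = vecIncl (Pi.single 3 1) := by
      rw [vecIncl_single, castSucc_three hm]
    rw [this, mat_incl_mulVec, h3, vecIncl_smul]

end Inclusion

/-! ### Translations and left-invariant operators -/

section Translations

variable {m : ℕ}

/-- Right translation `u ↦ u(· h)`. -/
def rightTrans (h : G m) : CG m →ₐ[ℂ] CG m where
  toFun u := ⟨fun x => (u : G m → ℂ) (x * h), SmoothVia.comp (ι := mat) (κ := mat) u.2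
    (fun x => x * h) (fun A => A * mat h) (contDiff_id.mul contDiff_const) (fun _ => rfl)⟩
  map_one' := rfl
  map_mul' _ _ := rfl
  map_zero' := rfl
  map_add' _ _ := rfl
  commutes' _ := rfl

/-- Left translation `u ↦ u(g ·)`. -/
def leftTrans (g : G m) : CG m →ₐ[ℂ] CG m where
  toFun u := ⟨fun x => (u : G m → ℂ) (g * x), SmoothVia.comp (ι := mat) (κ := mat) u.2
    (fun x => g * x) (fun A => mat g * A) (contDiff_const.mul contDiff_id) (fun _ => rfl)⟩
  map_one' := rfl
  map_mul' _ _ := rfl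
  map_zero' := rfl
  map_add' _ _ := rfl
  commutes' _ := rfl

theorem RX_apply (X : 𝔤 m) (u : CG m) (x : G m) : (RX X u : G m → ℂ) x =
    deriv (fun t : ℝ => (u : G m → ℂ) (x * expG (t • X))) 0 := rfl

theorem hasDerivAt_RX (X : 𝔤 m) (u : CG m) (x : G m) :
    HasDerivAt (fun t : ℝ => (u : G m → ℂ) (x * expG (t • X))) ((RX X u : G m → ℂ) x) 0 := by
  obtain ⟨U, hU, hx, F, hF, hFu⟩ := u.2 x
  exact (hasDerivAt_right X hU hF hFu x hx).differentiableAt.hasDerivAt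

theorem leftTrans_RX (g : G m) (X : 𝔤 m) :
    (leftTrans g).toLinearMap * RX X = RX X * (leftTrans g).toLinearMap := by
  ext u x
  change deriv (fun t : ℝ => (u : G m → ℂ) (g * x * expG (t • X))) 0 =
    deriv (fun t : ℝ => (u : G m → ℂ) (g * (x * expG (t • X)))) 0
  simp only [mul_assoc]

/-- The hypothesis says `Y = Ad(h) X`, so `h exp(tX) = exp(tY) h`. -/
theorem rightTrans_RX {h : G m} {X Y : 𝔤 m} (hXY : mat h * X.1 = Y.1 * mat h) :
    (rightTrans h).toLinearMap * RX X = RX Y * (rightTrans h).toLinearMap := by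
  have hc : ∀ t : ℝ, h * expG (t • X) = expG (t • Y) * h := by
    intro t
    rw [← mul_inv_eq_iff_eq_mul]
    refine mat_injective ?_
    have h1 : (t • Y).1 = (h.1 : Matrix _ _ ℝ) * (t • X).1 * ((h.1)⁻¹ : GL (Fin (m + 1)) ℝ).1 := by
      change t • Y.1 = mat h * (t • X.1) * mat h⁻¹
      rw [mul_smul_comm, hXY, smul_mul_assoc, mul_assoc, ← mat_mul, mul_inv_cancel, mat_one, mul_one]
    rw [mat_expG, h1, Matrix.exp_units_conj]
    rfl
  ext u x
  change deriv (fun t : ℝ => (u : G m → ℂ) (x * h * expG (t • X))) 0 =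
    deriv (fun t : ℝ => (u : G m → ℂ) (x * expG (t • Y) * h)) 0
  simp only [mul_assoc, hc]

theorem mat_mul_wedge (h : G m) (p x : Fin (m + 1) → ℝ) :
    mat h * (wedge p x).1 = (wedge (mat h *ᵥ p) (mat h *ᵥ x)).1 * mat h := by
  refine Matrix.mulVec_injective (funext fun v => ?_)
  rw [← Matrix.mulVec_mulVec, ← Matrix.mulVec_mulVec, wedge_mulVec, wedge_mulVec, form_mulVec,
    form_mulVec, Matrix.mulVec_sub, Matrix.mulVec_smul, Matrix.mulVec_smul]

theorem RX_leibniz (X : 𝔤 m) (u v : CG m) : RX X (u * v) = u * RX X v + RX X u * v := by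
  ext x
  have := ((hasDerivAt_RX X u x).mul (hasDerivAt_RX X v x)).deriv
  simp only [zero_smul, expG_zero, mul_one] at this
  exact this.trans (add_comm _ _)

/-- The logarithmic derivative is linear in `λ`; this is the source of the polynomial dependence. -/
theorem RX_stretchPow (hm : 3 ≤ m) (X : 𝔤 m) (lam : ℂ) :
    RX X (stretchPow hm lam) = stretchPow hm lam * (lam • RX X (logStretch hm)) := by
  ext x
  have := ((hasDerivAt_RX X (logStretch hm) x).const_mul lam).cexp.deriv
  simp only [zero_smul, expG_zero, mul_one] at this
  exact this

/-- Along `t ↦ x exp(tX)` the derivative at any `t` is a value of `RX X u`, by the one-parameter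
group law. -/
theorem mul_expG_eq_of_RX_eq_zero {X : 𝔤 m} {u : CG m} (h : RX X u = 0) (x : G m) :
    (u : G m → ℂ) (x * expG X) = (u : G m → ℂ) x := by
  have hd : ∀ t : ℝ, HasDerivAt (fun t : ℝ => (u : G m → ℂ) (x * expG (t • X))) 0 t := by
    intro t
    have h1 := hasDerivAt_RX X u (x * expG (t • X))
    rw [h] at h1
    have h2 : HasDerivAt (fun s : ℝ => s - t) 1 t := (hasDerivAt_id t).sub_const t
    have h1' : HasDerivAt (fun s : ℝ => (u : G m → ℂ) (x * expG (t • X) * expG (s • X))) 0 (t - t) := by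
      rw [sub_self]
      exact h1
    have h3 := HasDerivAt.scomp (h := fun s : ℝ => s - t) t h1' h2
    rw [smul_zero] at h3
    have e : (fun s : ℝ => (u : G m → ℂ) (x * expG (s • X))) =
        (fun s : ℝ => (u : G m → ℂ) (x * expG (t • X) * expG (s • X))) ∘ fun s => s - t := by
      funext s
      rw [Function.comp_apply, mul_assoc, ← expG_add_smul, add_sub_cancel]
    rw [e]
    exact h3
  have := is_const_of_deriv_eq_zero (fun t => (hd t).differentiableAt) (fun t => (hd t).deriv) 1 0
  simpa [expG_zero] using this

theorem RX_eq_zero_of_mem_M {S : Subgroup ℝˣ} {lam : ℂ} {u : CG m} (hu : u ∈ Ind S m lam) {X : 𝔤 m}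
    (h0 : X.1 *ᵥ Pi.single 0 1 = 0) (h3 : X.1 *ᵥ Pi.single 3 1 = 0) : RX X u = 0 := by
  ext x
  rw [RX_apply]
  have : ∀ t : ℝ, (u : G m → ℂ) (x * expG (t • X)) = (u : G m → ℂ) x := by
    intro t
    refine Ind_mul_M hu x ⟨1, S.one_mem, ?_, ?_⟩
    · rw [mat_expG, exp_mulVec_of_eigenvector (c := 0), Real.exp_zero, Units.val_one]
      rw [SetLike.val_smul, Matrix.smul_mulVec, h0, smul_zero, zero_smul]
    · rw [mat_expG, exp_mulVec_of_eigenvector (c := 0), Real.exp_zero, Units.val_one]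
      rw [SetLike.val_smul, Matrix.smul_mulVec, h3, smul_zero, zero_smul]
  simp [this]

theorem RX_eq_zero_of_mem_nPlus {S : Subgroup ℝˣ} {lam : ℂ} {u : CG m} (hu : u ∈ Ind S m lam)
    {X : 𝔤 m} (hX : X ∈ nPlus m) : RX X u = 0 := by
  ext x
  rw [RX_apply]
  have : ∀ t : ℝ, (u : G m → ℂ) (x * expG (t • X)) = (u : G m → ℂ) x := by
    intro t
    refine Ind_mul_N hu x ?_
    have hX' : ⁅H m, X⁆ = X := hX
    change ⁅H m, t • X⁆ = t • X
    rw [lie_smul, hX']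
  simp [this]

theorem RX_H {S : Subgroup ℝˣ} {lam : ℂ} {u : CG m} (hu : u ∈ Ind S m lam) :
    RX (H m) u = lam • u := by
  ext x
  rw [RX_apply]
  simp only [Ind_mul_A hu]
  have h1 : HasDerivAt (fun t : ℝ => (lam * (t : ℂ))) lam 0 := by
    simpa using (Complex.ofRealCLM.hasDerivAt (x := (0 : ℝ))).const_mul lam
  have := (h1.cexp.mul_const ((u : G m → ℂ) x)).deriv
  simp only [Complex.ofReal_zero, mul_zero, Complex.exp_zero, one_mul] at this
  exact this

end Translations

end EinsteinFamilies

end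

noncomputable section

namespace EinsteinFamilies

attribute [local instance] Matrix.linftyOpNormedRing Matrix.linftyOpNormedAlgebra

/-! ### Conjugation of polynomials in two operators -/

section Conjugation

variable {A B : Type*} [Semiring A] [Algebra ℂ A] [Semiring B] [Algebra ℂ B]

theorem map_sum_smul_mul_pow (φ : A →ₐ[ℂ] B) {l t : A} {l' t' : B} (hl : φ l = l')
    (ht : φ t = t') (s : Finset ℕ) (a : ℕ → ℂ) (p : ℕ → ℕ) :
    φ (∑ j ∈ s, a j • (l ^ j * t ^ p j)) = ∑ j ∈ s, a j • (l' ^ j * t' ^ p j) := by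
  simp only [map_sum, map_smul, map_mul, map_pow, hl, ht]

theorem map_sum_smul_sq {ι : Type*} (φ : A →ₐ[ℂ] B) (s : Finset ι) (η : ι → ℂ) {f : ι → A}
    {g : ι → B} (h : ∀ i, φ (f i) = g i) :
    φ (∑ i ∈ s, η i • f i ^ 2) = ∑ i ∈ s, η i • g i ^ 2 := by
  simp only [map_sum, map_smul, map_pow, h]

/-- Conjugation acts on the span of the `X_k` by `c` times an isometry of the form `η`, so the
quadratic element built from `η` is multiplied by `c²`. -/
theorem semiconj_sum_smul_sq {ι : Type*} [Fintype ι] [DecidableEq ι] {X : ι → A} {R : A}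
    {γ : ι → ι → ℝ} {η : ι → ℝ} {c : ℝ}
    (hR : ∀ k, R * X k = (∑ l, ((c * γ l k : ℝ) : ℂ) • X l) * R)
    (hγ : ∀ l l', ∑ k, η k * (γ l k * γ l' k) = if l = l' then η l else 0) :
    R * ∑ k, (η k : ℂ) • X k ^ 2 = ((c : ℂ) ^ 2 • ∑ k, (η k : ℂ) • X k ^ 2) * R := by
  have h3 : ∀ k, R * ((η k : ℂ) • X k ^ 2) = (∑ l, ∑ l',
        ((c ^ 2 * (η k * (γ l k * γ l' k)) : ℝ) : ℂ) • (X l * X l')) * R := by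
    intro k
    rw [mul_smul_comm, sq, ← mul_assoc, hR, mul_assoc, hR, ← mul_assoc, ← smul_mul_assoc]
    congr 1
    rw [Finset.sum_mul_sum, Finset.smul_sum]
    refine Finset.sum_congr rfl fun l _ => ?_
    rw [Finset.smul_sum]
    refine Finset.sum_congr rfl fun l' _ => ?_
    rw [smul_mul_smul_comm, smul_smul]
    congr 1
    push_cast
    ring
  rw [Finset.mul_sum, Finset.sum_congr rfl fun k _ => h3 k, ← Finset.sum_mul]
  congr 1
  rw [Finset.sum_comm, Finset.smul_sum]
  refine Finset.sum_congr rfl fun l _ => ?_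
  rw [Finset.sum_comm]
  have h4 : ∀ l', ∑ k, ((c ^ 2 * (η k * (γ l k * γ l' k)) : ℝ) : ℂ) • (X l * X l') =
      if l = l' then ((c ^ 2 * η l : ℝ) : ℂ) • (X l * X l') else 0 := by
    intro l'
    rw [← Finset.sum_smul, ← Complex.ofReal_sum, ← Finset.mul_sum, hγ]
    split_ifs <;> simp
  rw [Finset.sum_congr rfl fun l' _ => h4 l', Finset.sum_ite_eq, if_pos (Finset.mem_univ _),
    smul_smul, sq (X l), Complex.ofReal_mul, Complex.ofReal_pow]

/-- With `L` of degree `2` and `T` of degree `1`, every summand is homogeneous of degree `N`. -/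
theorem semiconj_sum_smul_mul_pow {L T R : A} {c : ℂ} (hL : R * L = (c ^ 2 • L) * R)
    (hT : R * T = (c • T) * R) (N : ℕ) (a : ℕ → ℂ) :
    R * ∑ j ∈ Finset.range (N / 2 + 1), a j • (L ^ j * T ^ (2 * (N / 2 - j) + N % 2)) =
      (c ^ N • ∑ j ∈ Finset.range (N / 2 + 1), a j • (L ^ j * T ^ (2 * (N / 2 - j) + N % 2))) *
        R := by
  have hpow : ∀ {A' B' : A} (p : ℕ), R * A' = B' * R → R * A' ^ p = B' ^ p * R := by
    intro A' B' p h
    exact (SemiconjBy.pow_right (show SemiconjBy R A' B' from h) p).eq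
  rw [Finset.mul_sum, Finset.smul_sum, Finset.sum_mul]
  refine Finset.sum_congr rfl fun j hj => ?_
  have hj := Finset.mem_range.1 hj
  rw [mul_smul_comm, ← mul_assoc, hpow j hL, mul_assoc,
    hpow _ hT, ← mul_assoc, smul_pow, smul_pow, smul_mul_smul_comm,
    ← pow_mul, ← pow_add, show 2 * j + (2 * (N / 2 - j) + N % 2) = N by omega,
    smul_comm (c ^ N), smul_mul_assoc, smul_mul_assoc, smul_mul_assoc]

theorem commute_sum_smul_mul_pow {R L T : A} (hL : Commute R L) (hT : Commute R T)
    (s : Finset ℕ) (a : ℕ → ℂ) (p : ℕ → ℕ) : Commute R (∑ j ∈ s, a j • (L ^ j * T ^ p j)) :=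
  Commute.sum_right _ _ _ fun _ _ => ((hL.pow_right _).mul_right (hT.pow_right _)).smul_right _

theorem commute_sum_smul_sq {ι : Type*} {R : A} (s : Finset ι) (η : ι → ℂ) {f : ι → A}
    (h : ∀ i, Commute R (f i)) : Commute R (∑ i ∈ s, η i • f i ^ 2) :=
  Commute.sum_right _ _ _ fun i _ => ((h i).pow_right 2).smul_right _

end Conjugation

theorem sum_cancel_two {ι : Type*} [Fintype ι] [DecidableEq ι] {i j : ι} (hij : j ≠ i) {A : Type*}
    [AddCommGroup A] {f : ι → A}
    (h : f i + f j = 0) : ∑ k with k ≠ i ∧ k ≠ j, f k = ∑ k, f k := by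
  have h1 : (Finset.univ.filter fun k : ι => k ≠ i ∧ k ≠ j) = (Finset.univ.erase i).erase j := by
    ext k
    simp [and_comm]
  rw [h1, ← Finset.add_sum_erase Finset.univ _ (Finset.mem_univ i),
    ← Finset.add_sum_erase (Finset.univ.erase i) _ (by simp [hij] : j ∈ Finset.univ.erase i),
    ← add_assoc, h, zero_add]


/-- The vector form of `raise_family`. -/
theorem raise_family_apply {V ι : Type*} [AddCommGroup V] [Module ℂ V] [DecidableEq ι]
    {s : Finset ι} {k : ι} (hk : k ∈ s)
    {η : ι → ℂ} (hη : ∀ i, η i * η i = 1) {I R : ι → V →ₗ[ℂ] V}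
    {E H T Q : V →ₗ[ℂ] V} {lam : ℂ} {u : V}
    (hI : ∀ i j v, I i (I j v) = I j (I i v)) (hIT : ∀ i v, I i (T v) = T (I i v))
    (hR : ∀ i j v, R i (I j v) = I j (R i v) + ((if i = j then η i • I k v else 0) -
      (if k = j then η k • I i v else 0)))
    (hRT : ∀ i v, R i (T v) = T (R i v))
    (hH : ∀ j v, H (I j v) = I j (H v) + -I j v) (hHT : ∀ v, H (T v) = T (H v) + -T v)
    (hE : ∀ j v, E (I j v) = I j (E v) + ((2 : ℂ) • R j v + (if k = j then (2 * η k) • H v else 0)))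
    (hET : ∀ v, E (T v) = T (E v) + (2 : ℂ) • Q v) (hQT : ∀ v, Q (T v) = T (Q v) + I k v)
    (hEu : E u = 0) (hRu : ∀ i, R i u = 0) (hQu : Q u = 0) (hHu : H u = lam • u)
    (N ε : ℕ) (hε : ε ≤ 1) (a : ℕ → ℂ)
    (ha : ∀ j < N, ((2 * (N - j) + ε : ℕ) : ℂ) * (2 * (N - j) + ε - 1 : ℕ) * a j +
      ((j : ℂ) + 1) * (4 * (lam - (2 * (N - (j + 1)) + ε : ℕ)) + 2 * (s.card - 2) - 4 * j) *
        a (j + 1) = 0) :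
    E ((∑ j ∈ Finset.range (N + 1), a j • ((∑ j ∈ s, η j • (I j : Module.End ℂ V) ^ 2) ^ j *
      (T : Module.End ℂ V) ^ (2 * (N - j) + ε))) u) = 0 := by
  rw [LinearMap.sum_apply]
  refine raise_family hk hη (I := I) (R := R) (E := E) (H := H) (T := T) (Q := Q)
    (fun i j => LinearMap.ext (hI i j)) (fun i => LinearMap.ext (hIT i))
    (fun i j => LinearMap.ext fun v => ?_) (fun i => LinearMap.ext (hRT i))
    (fun j => LinearMap.ext fun v => ?_) (LinearMap.ext fun v => ?_)
    (fun j => LinearMap.ext fun v => ?_)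
    (LinearMap.ext hET) (LinearMap.ext hQT) hEu hRu hQu hHu N ε hε a ha
  · refine (hR i j v).trans ?_
    rw [← add_sub_assoc]
    split_ifs <;> rfl
  · exact (hH j v).trans (sub_eq_add_neg _ _).symm
  · exact (hHT v).trans (sub_eq_add_neg _ _).symm
  · refine (hE j v).trans ?_
    rw [← add_assoc]
    split_ifs <;> rfl

/-! ### The operators defined by `𝒟_N^0(λ)` -/

section Operators

variable {m : ℕ}

theorem RX_add (X Y : 𝔤 m) : RX (X + Y) = RX X + RX Y := (RLie m).map_add X Y

theorem RX_smul (c : ℝ) (X : 𝔤 m) : RX (c • X) = (c : ℂ) • RX X := by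
  have h : RX (c • X) = c • RX X := (RLie m).map_smul c X
  rw [h]
  ext u x
  exact Complex.real_smul

theorem RX_zero : RX (0 : 𝔤 m) = 0 := (RLie m).map_zero

theorem RX_neg (X : 𝔤 m) : RX (-X) = -RX X := (RLie m).map_neg X

theorem RX_sub (X Y : 𝔤 m) : RX (X - Y) = RX X - RX Y := (RLie m).map_sub X Y

theorem RX_sum {ι : Type*} (s : Finset ι) (X : ι → 𝔤 m) :
    RX (∑ i ∈ s, X i) = ∑ i ∈ s, RX (X i) := map_sum (RLie m) X s

section

attribute [local instance 100] LieRing.ofAssociativeRing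

theorem RX_lie_apply (X Y : 𝔤 m) (v : CG m) :
    RX ⁅X, Y⁆ v = RX X (RX Y v) - RX Y (RX X v) := by
  have h : RX ⁅X, Y⁆ = RX X * RX Y - RX Y * RX X := (RLie m).map_lie X Y
  exact congrArg (fun A => A v) h

theorem RU_toUC (X : 𝔤 m) : RU m (toUC X) = RX X := by
  have h := Algebra.TensorProduct.lift_tmul (Algebra.ofId ℂ (Module.End ℂ (CG m)))
    (UniversalEnvelopingAlgebra.lift ℝ (RLie m)) (fun _ _ => Algebra.commutes _ _) 1
    (UniversalEnvelopingAlgebra.ι ℝ X)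
  refine h.trans ?_
  have h2 := UniversalEnvelopingAlgebra.lift_ι_apply ℝ (RLie m) X
  rw [map_one, one_mul]
  exact h2

end

theorem RX_add_apply (X Y : 𝔤 m) (v : CG m) : RX (X + Y) v = RX X v + RX Y v :=
  congrArg (fun A => A v) (RX_add X Y)

theorem RX_sub_apply (X Y : 𝔤 m) (v : CG m) : RX (X - Y) v = RX X v - RX Y v :=
  congrArg (fun A => A v) (RX_sub X Y)

theorem RX_neg_apply (X : 𝔤 m) (v : CG m) : RX (-X) v = -RX X v :=
  congrArg (fun A => A v) (RX_neg X)

theorem RX_smul_apply (c : ℝ) (X : 𝔤 m) (v : CG m) : RX (c • X) v = (c : ℂ) • RX X v :=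
  congrArg (fun A => A v) (RX_smul c X)

theorem RX_ite_apply (p : Prop) [Decidable p] (X : 𝔤 m) (v : CG m) :
    RX (if p then X else 0) v = if p then RX X v else 0 := by
  split_ifs
  · rfl
  · rw [RX_zero]
    rfl

theorem RX_comm {X Y Z : 𝔤 m} (h : ⁅X, Y⁆ = Z) {v w : CG m} (hw : RX Z v = w) :
    RX X (RX Y v) = RX Y (RX X v) + w := by
  rw [← hw, ← h, RX_lie_apply]
  abel

theorem RX_comm_of_lie_eq_zero {X Y : 𝔤 m} (h : ⁅X, Y⁆ = 0) (v : CG m) :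
    RX X (RX Y v) = RX Y (RX X v) := by
  rw [← sub_eq_zero, ← RX_lie_apply, h, RX_zero]
  rfl

theorem nMinus_eq_wedge (k : Fin (m + 1)) : nMinus k = wedge (eMinus m) (Pi.single k 1) := by
  rw [nMinus, rot_eq_wedge, rot_eq_wedge, eMinus, map_sub, LinearMap.sub_apply]

theorem raise_eq_wedge (k : Fin (m + 1)) : raise k = wedge (ePlus m) (Pi.single k 1) := by
  rw [raise, rot_eq_wedge, rot_eq_wedge, ePlus, map_add, LinearMap.add_apply]

theorem eq_sum_single (v : Fin (m + 1) → ℝ) : v = ∑ k, v k • Pi.single k (1 : ℝ) := by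
  funext j
  simp [Finset.sum_apply, Pi.single_apply]

theorem raise_mem_nPlus (hm : 3 ≤ m) {k : Fin (m + 1)} (h0 : k ≠ 0) (h3 : k ≠ 3) :
    raise k ∈ nPlus m := by
  have : transverse (Pi.single k 1 : Fin (m + 1) → ℝ) = Pi.single k 1 := by
    funext j
    by_cases hj : j = k
    · subst hj; simp [transverse, h0, h3]
    · simp [transverse, hj]
  rw [raise_eq_wedge, ← this]
  exact wedge_mem_nPlus hm _

/-- The operator defined by `Δ`. -/
def lapOp (n : ℕ) : Module.End ℂ (CG (n + 1)) :=
  ∑ k : Fin (n + 1) with k ≠ 0 ∧ k ≠ 3, (sgn n k : ℂ) • RX (nMinus k.castSucc) ^ 2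

/-- The operator defined by `T`. -/
def normalOp (n : ℕ) : Module.End ℂ (CG (n + 1)) := RX (nMinus (Fin.last (n + 1)))

/-- The coefficients of `𝒟_N^0(λ)` for both parities of `N`. -/
def dCoeff (n N : ℕ) (lam : ℂ) (j : ℕ) : ℂ :=
  if Even N then aCoeff n (N / 2) lam j else bCoeff n (N / 2) lam j

theorem RU_D0 (n N : ℕ) (lam : ℂ) : RU (n + 1) (D0 n N lam) =
    ∑ j ∈ Finset.range (N / 2 + 1), dCoeff n N lam j •
      (lapOp n ^ j * normalOp n ^ (2 * (N / 2 - j) + N % 2)) := by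
  have hL : RU (n + 1) (lapU n) = lapOp n := map_sum_smul_sq _ _ _ fun _ => RU_toUC _
  have hT : RU (n + 1) (TU n) = normalOp n := RU_toUC _
  have h0 : RU (n + 1) (evenD0 n (N / 2) lam) = ∑ j ∈ Finset.range (N / 2 + 1),
      aCoeff n (N / 2) lam j • (lapOp n ^ j * normalOp n ^ (2 * (N / 2) - 2 * j)) :=
    map_sum_smul_mul_pow (RU (n + 1)) hL hT _ _ fun j => 2 * (N / 2) - 2 * j
  have h1 : RU (n + 1) (oddD0 n (N / 2) lam) = ∑ j ∈ Finset.range (N / 2 + 1),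
      bCoeff n (N / 2) lam j • (lapOp n ^ j * normalOp n ^ (2 * (N / 2) - 2 * j + 1)) :=
    map_sum_smul_mul_pow (RU (n + 1)) hL hT _ _ fun j => 2 * (N / 2) - 2 * j + 1
  unfold D0 dCoeff
  split_ifs with h
  · refine h0.trans (Finset.sum_congr rfl fun j _ => ?_)
    have e : 2 * (N / 2) - 2 * j = 2 * (N / 2 - j) + N % 2 := by
      have := Nat.even_iff.1 h
      omega
    exact congrArg (fun p => _ • (_ * normalOp n ^ p)) e
  · refine h1.trans (Finset.sum_congr rfl fun j hj => ?_)
    have e : 2 * (N / 2) - 2 * j + 1 = 2 * (N / 2 - j) + N % 2 := by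
      have := Finset.mem_range.1 hj
      have := Nat.odd_iff.1 (Nat.not_even_iff_odd.1 h)
      omega
    exact congrArg (fun p => _ • (_ * normalOp n ^ p)) e

/-- This is twice the defining recursion at index `j + 1`, in the form required by `raise_family`
with `s.card = n - 1`. -/
theorem dCoeff_recursion (n N : ℕ) (lam : ℂ) {j : ℕ} (hj : j < N / 2) :
    ((2 * (N / 2 - j) + N % 2 : ℕ) : ℂ) * (2 * (N / 2 - j) + N % 2 - 1 : ℕ) * dCoeff n N lam j +
      ((j : ℂ) + 1) * (4 * (lam - (2 * (N / 2 - (j + 1)) + N % 2 : ℕ)) + 2 * ((n : ℂ) - 1 - 2)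
        - 4 * j) * dCoeff n N lam (j + 1) = 0 := by
  obtain ⟨d, hd⟩ : ∃ d, N / 2 = j + 1 + d := Nat.exists_eq_add_of_le hj
  unfold dCoeff
  rw [hd, show j + 1 + d - j = d + 1 by omega, show j + 1 + d - (j + 1) = d by omega]
  split_ifs with h
  · have := ((aCoeff_unique n (j + 1 + d) lam _).2 fun _ _ => rfl).1 (j + 1)
      (by omega) (by omega)
    rw [Nat.even_iff.1 h, show 2 * (d + 1) + 0 - 1 = 2 * d + 1 by omega]
    rw [Nat.add_sub_cancel] at this
    push_cast at this ⊢
    linear_combination 2 * this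
  · have := ((bCoeff_unique n (j + 1 + d) lam _).2 fun _ _ => rfl).1 (j + 1)
      (by omega) (by omega)
    rw [Nat.odd_iff.1 (Nat.not_even_iff_odd.1 h), show 2 * (d + 1) + 1 - 1 = 2 * d + 2 by omega]
    rw [Nat.add_sub_cancel] at this
    push_cast at this ⊢
    linear_combination 2 * this

theorem rot_mulVec_single (a b c : Fin (m + 1)) (ha : a ≠ c) (hb : b ≠ c) :
    (rot a b).1 *ᵥ Pi.single c 1 = 0 := by
  rw [rot_eq_wedge, wedge_mulVec, form_single, form_single]
  simp [ha, hb]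

theorem castSucc_ne_three (hm : 3 ≤ m) {k : Fin (m + 1)} (h : k ≠ 3) : k.castSucc ≠ 3 := by
  rw [← castSucc_three hm]
  exact fun h' => h (Fin.castSucc_injective _ h')

theorem castSucc_ne_zero {k : Fin (m + 1)} (h : k ≠ 0) : k.castSucc ≠ 0 :=
  fun h' => h (Fin.castSucc_injective _ h')

theorem card_transverse (hm : 3 ≤ m) :
    ((Finset.univ : Finset {k : Fin (m + 1) // k ≠ 0 ∧ k ≠ 3}).card : ℂ) = (m : ℂ) - 1 := by
  have h1 : (Finset.univ.filter fun k : Fin (m + 1) => k ≠ 0 ∧ k ≠ 3) =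
      (Finset.univ.erase 0).erase 3 := by
    ext k
    simp [and_comm]
  rw [Finset.card_univ, Fintype.card_subtype, h1, Finset.card_erase_of_mem
    (by simp [three_ne_zero_fin hm]), Finset.card_erase_of_mem (by simp), Finset.card_univ,
    Fintype.card_fin]
  obtain ⟨d, rfl⟩ := Nat.exists_eq_add_of_le hm
  rw [show 3 + d + 1 - 1 - 1 = 2 + d by omega]
  push_cast
  ring

set_option maxHeartbeats 2000000 in
/-- The elements of `𝔫⁺_n` annihilate `𝒟_N^0(λ) u` for `u` in the induced representation. -/
theorem raise_D0_eq_zero {S : Subgroup ℝˣ} {n : ℕ} (hn : 3 ≤ n) (N : ℕ) {lam : ℂ}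
    {u : CG (n + 1)} (hu : u ∈ Ind S (n + 1) lam) {k : Fin (n + 1)} (hk0 : k ≠ 0) (hk3 : k ≠ 3) :
    RX (raise k.castSucc) (RU (n + 1) (D0 n N lam) u) = 0 := by
  have hn' : 3 ≤ n + 1 := by omega
  have c0 : ∀ i : {k : Fin (n + 1) // k ≠ 0 ∧ k ≠ 3}, i.1.castSucc ≠ 0 := fun i =>
    castSucc_ne_zero i.2.1
  have c3 : ∀ i : {k : Fin (n + 1) // k ≠ 0 ∧ k ≠ 3}, i.1.castSucc ≠ 3 := fun i =>
    castSucc_ne_three hn i.2.2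
  have l0 : Fin.last (n + 1) ≠ 0 := (Fin.last_pos).ne'
  have l3 : Fin.last (n + 1) ≠ 3 := by
    rw [← castSucc_three hn]
    exact (Fin.castSucc_lt_last _).ne'
  have hL : lapOp n = ∑ j : {k : Fin (n + 1) // k ≠ 0 ∧ k ≠ 3},
      (sgn n j.1 : ℂ) • RX (nMinus j.1.castSucc) ^ 2 := by
    rw [lapOp]
    exact Finset.sum_subtype _ (by simp) _
  have hk0' := castSucc_ne_zero hk0
  have hk3' := castSucc_ne_three hn hk3
  have ha : ∀ j < N / 2,
      ((2 * (N / 2 - j) + N % 2 : ℕ) : ℂ) * (2 * (N / 2 - j) + N % 2 - 1 : ℕ) * dCoeff n N lam j +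
      ((j : ℂ) + 1) * (4 * (lam - (2 * (N / 2 - (j + 1)) + N % 2 : ℕ)) +
        2 * ((Finset.univ : Finset {k : Fin (n + 1) // k ≠ 0 ∧ k ≠ 3}).card - 2) - 4 * j) *
        dCoeff n N lam (j + 1) = 0 := by
    rw [card_transverse hn]
    exact fun j hj => dCoeff_recursion n N lam hj
  rw [RU_D0, hL]
  -- The index set is a subtype because the bracket relations hold only for indices other than `0`
  -- and `3`. The operator `Q` is the rotation in the plane of `k` and the normal direction.
  refine raise_family_apply (V := CG (n + 1)) (s := Finset.univ)
    (k := (⟨k, hk0, hk3⟩ : {k : Fin (n + 1) // k ≠ 0 ∧ k ≠ 3})) (Finset.mem_univ _)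
    (η := fun i => (sgn n i.1 : ℂ)) (fun i => by rw [← Complex.ofReal_mul, sgn_mul_self]; simp)
    (I := fun i => RX (nMinus i.1.castSucc)) (R := fun i => RX (rot k.castSucc i.1.castSucc))
    (E := RX (raise k.castSucc)) (H := RX (H (n + 1))) (T := normalOp n)
    (Q := RX (rot k.castSucc (Fin.last (n + 1)))) (lam := lam) (u := u)
    ?_ ?_ ?_ ?_ ?_ ?_ ?_ ?_ ?_
    (RX_eq_zero_of_mem_nPlus hu (raise_mem_nPlus hn' hk0' hk3'))
    (fun i => RX_eq_zero_of_mem_M hu (rot_mulVec_single _ _ _ hk0' (c0 i))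
      (rot_mulVec_single _ _ _ hk3' (c3 i)))
    (RX_eq_zero_of_mem_M hu (rot_mulVec_single _ _ _ hk0' l0) (rot_mulVec_single _ _ _ hk3' l3))
    (RX_H hu) (N / 2) (N % 2) (Nat.le_of_lt_succ (Nat.mod_lt _ two_pos)) (dCoeff n N lam) ha
  · exact fun i j v => RX_comm_of_lie_eq_zero
      (lie_nMinus_nMinus hn' (c0 i) (c3 i) (c0 j) (c3 j)) v
  · exact fun i v => RX_comm_of_lie_eq_zero (lie_nMinus_nMinus hn' (c0 i) (c3 i) l0 l3) v
  · intro i j v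
    refine RX_comm (lie_rot_nMinus hk0' hk3' (c0 i) (c3 i)) ?_
    rw [RX_sub_apply, RX_ite_apply, RX_ite_apply, RX_smul_apply, RX_smul_apply, sgn_castSucc,
      sgn_castSucc]
    simp only [Fin.castSucc_inj, Subtype.ext_iff]
  · intro i v
    refine RX_comm_of_lie_eq_zero ((lie_rot_nMinus hk0' hk3' (c0 i) (c3 i)).trans ?_) v
    rw [if_neg (Fin.castSucc_lt_last _).ne, if_neg (Fin.castSucc_lt_last _).ne, sub_zero]
  · exact fun i v => RX_comm (lie_H_nMinus hn' (c0 i) (c3 i)) (RX_neg_apply _ v)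
  · exact fun v => RX_comm (lie_H_nMinus hn' l0 l3) (RX_neg_apply _ v)
  · intro i v
    refine RX_comm (lie_raise_nMinus hn' (c0 i) (c3 i) hk0' hk3') ?_
    rw [RX_add_apply, RX_ite_apply, RX_smul_apply, RX_smul_apply, sgn_castSucc]
    simp only [Fin.castSucc_inj, Subtype.ext_iff]
    push_cast
    rfl
  · intro v
    refine RX_comm (lie_raise_nMinus hn' l0 l3 hk0' hk3') ?_
    rw [if_neg (Fin.castSucc_lt_last _).ne, add_zero, RX_smul_apply]
    push_cast
    rfl
  · intro v
    refine RX_comm (lie_rot_nMinus hk0' hk3' l0 l3) ?_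
    rw [if_neg (Fin.castSucc_lt_last _).ne, if_pos rfl, sub_zero, sgn_last hn', one_smul]

/-- For both excluded indices `L_{0k} - L_{3k}` equals `H`, and the signs are opposite. Summing over
all indices makes the full relation `g η gᵀ = η` applicable without isolating a transverse block of
`g`. -/
theorem lapOp_eq_sum {n : ℕ} (hn : 3 ≤ n) :
    lapOp n = ∑ k : Fin (n + 1), (sgn n k : ℂ) • RX (nMinus k.castSucc) ^ 2 := by
  have h30 := three_ne_zero_fin hn
  have h0 : (nMinus (0 : Fin (n + 1)).castSucc : 𝔤 (n + 1)) = H (n + 1) := by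
    rw [Fin.castSucc_zero, nMinus, rot_self, zero_sub, ← rot_swap, H]
  have h3 : (nMinus (3 : Fin (n + 1)).castSucc : 𝔤 (n + 1)) = H (n + 1) := by
    rw [castSucc_three hn, nMinus, rot_self, sub_zero, H]
  refine sum_cancel_two (A := Module.End ℂ (CG (n + 1)))
    (f := fun k => (sgn n k : ℂ) • RX (nMinus k.castSucc) ^ 2) h30 ?_
  rw [h0, h3, sgn_zero, sgn_three hn, Complex.ofReal_neg, Complex.ofReal_one]
  module

/-- Conjugation of the operator `Δ` by elements of `G^n` that scale `e₀ - e₃`. -/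
theorem rightTrans_lapOp {n : ℕ} (hn : 3 ≤ n) {g : G n} {c : ℝ}
    (hg : mat g *ᵥ eMinus n = c • eMinus n) :
    (rightTrans (incl n g)).toLinearMap * lapOp n =
      ((c : ℂ) ^ 2 • lapOp n) * (rightTrans (incl n g)).toLinearMap := by
  have h1 : ∀ k : Fin (n + 1), (rightTrans (incl n g)).toLinearMap * RX (nMinus k.castSucc) =
      (∑ l, ((c * mat g l k : ℝ) : ℂ) • RX (nMinus l.castSucc)) *
        (rightTrans (incl n g)).toLinearMap := by
    intro k
    rw [rightTrans_RX (Y := ∑ l : Fin (n + 1), (c * mat g l k) • nMinus l.castSucc), RX_sum]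
    · simp only [RX_smul]
    · have h2 : mat (incl n g) *ᵥ Pi.single k.castSucc 1 =
          ∑ l : Fin (n + 1), mat g l k • Pi.single l.castSucc 1 := by
        rw [← vecIncl_single, mat_incl_mulVec, Matrix.mulVec_single_one,
          eq_sum_single (Matrix.col (mat g) k)]
        change vecInclLin _ = _
        rw [map_sum]
        refine Finset.sum_congr rfl fun l _ => ?_
        rw [map_smul]
        congr 1
        exact vecIncl_single l
      rw [nMinus_eq_wedge, mat_mul_wedge, h2, ← vecIncl_eMinus hn, mat_incl_mulVec, hg, vecIncl_smul,
        vecIncl_eMinus hn, map_smul]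
      congr 2
      rw [LinearMap.smul_apply, map_sum, Finset.smul_sum]
      refine Finset.sum_congr rfl fun l _ => ?_
      rw [map_smul, smul_smul, nMinus_eq_wedge]
  have hgram : ∀ l l' : Fin (n + 1), ∑ k, sgn n k * (mat g l k * mat g l' k) =
      if l = l' then sgn n l else 0 := by
    intro l l'
    have := congrFun (congrFun (mat_mul_gram_mul_transpose g) l) l'
    rw [gram, Matrix.mul_apply, Matrix.diagonal_apply] at this
    rw [← this]
    refine Finset.sum_congr rfl fun k _ => ?_
    rw [Matrix.mul_diagonal, Matrix.transpose_apply]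
    ring
  rw [lapOp_eq_sum hn]
  exact semiconj_sum_smul_sq h1 hgram

theorem rightTrans_normalOp {n : ℕ} (hn : 3 ≤ n) {g : G n} {c : ℝ}
    (hg : mat g *ᵥ eMinus n = c • eMinus n) :
    (rightTrans (incl n g)).toLinearMap * normalOp n =
      ((c : ℂ) • normalOp n) * (rightTrans (incl n g)).toLinearMap := by
  rw [normalOp, ← RX_smul]
  refine rightTrans_RX ?_
  rw [nMinus_eq_wedge, mat_mul_wedge, ← vecIncl_eMinus hn, mat_incl_mulVec, hg, vecIncl_smul,
    map_smul]
  congr 3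
  exact congrArg _ (blockIncl_mulVec_last _)

theorem rightTrans_D0 {n : ℕ} (hn : 3 ≤ n) {g : G n} {c : ℝ}
    (hg : mat g *ᵥ eMinus n = c • eMinus n) (N : ℕ) (lam : ℂ) :
    (rightTrans (incl n g)).toLinearMap * RU (n + 1) (D0 n N lam) =
      ((c : ℂ) ^ N • RU (n + 1) (D0 n N lam)) * (rightTrans (incl n g)).toLinearMap := by
  rw [RU_D0]
  exact semiconj_sum_smul_mul_pow (rightTrans_lapOp hn hg) (rightTrans_normalOp hn hg) N _

theorem leftTrans_D0 {n : ℕ} (g : G (n + 1)) (N : ℕ) (lam : ℂ) :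
    Commute (leftTrans g).toLinearMap (RU (n + 1) (D0 n N lam)) := by
  rw [RU_D0]
  exact commute_sum_smul_mul_pow (commute_sum_smul_sq _ _ fun k => leftTrans_RX g _)
    (leftTrans_RX g _) _ _ _

theorem exp_H_mulVec_eMinus (hm : 3 ≤ m) (t : ℝ) :
    mat (expG (t • H m)) *ᵥ eMinus m = Real.exp (-t) • eMinus m := by
  refine exp_mulVec_of_eigenvector ?_
  rw [SetLike.val_smul, Matrix.smul_mulVec, H_mulVec hm, eMinus_zero hm, eMinus_three hm, eMinus]
  module

/-- `i^* ∘ 𝒟_N^0(λ)` maps induced representations to induced representations. -/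
theorem restrictG_D0_mem_Ind {S : Subgroup ℝˣ} {n : ℕ} (hn : 3 ≤ n) {N : ℕ}
    (hSN : ∀ c ∈ S, |(c : ℝ)| = 1 → (c : ℝ) ^ N = 1) {lam : ℂ} {u : CG (n + 1)}
    (hu : u ∈ Ind S (n + 1) lam) :
    restrictG n (RU (n + 1) (D0 n N lam) u) ∈ Ind S n (lam - N) := by
  intro g μ hμ t X hX
  obtain ⟨w, hw⟩ : ∃ w, w = RU (n + 1) (D0 n N lam) u := ⟨_, rfl⟩
  -- Right translation of `𝒟_N^0(λ) u` is replaced by right translation of `u` itself, at the cost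
  -- of `c^N`.
  have hr : ∀ {h : G n} {c : ℝ} (y : G (n + 1)), mat h *ᵥ eMinus n = c • eMinus n →
      (w : G (n + 1) → ℂ) (y * incl n h) = (c : ℂ) ^ N *
        (RU (n + 1) (D0 n N lam) (rightTrans (incl n h) u) : G (n + 1) → ℂ) y := by
    intro h c y hc
    have h1 := congrArg (fun A => (A u : G (n + 1) → ℂ) y) (rightTrans_D0 hn hc N lam)
    rw [hw]
    exact h1
  rw [← hw]
  change (w : G (n + 1) → ℂ) (incl n (g * μ * expG (t • H n) * expG X)) =
    _ * (w : G (n + 1) → ℂ) (incl n g)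
  rw [map_mul, map_mul, map_mul]
  -- The image of `X` in the larger Lie algebra is a combination of the generators `raise
  -- k.castSucc`, all of which annihilate `w`.
  have hN : ∀ y, (w : G (n + 1) → ℂ) (y * incl n (expG X)) = (w : G (n + 1) → ℂ) y := by
    intro y
    obtain ⟨x, rfl⟩ := exists_wedge_of_mem_nPlus hn hX
    rw [incl_expG_wedge]
    refine mul_expG_eq_of_RX_eq_zero ?_ y
    rw [vecIncl_ePlus hn]
    have h1 : vecIncl (transverse x) =
        ∑ k : Fin (n + 1), transverse x k • Pi.single k.castSucc (1 : ℝ) := by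
      change vecInclLin _ = _
      nth_rw 1 [eq_sum_single (transverse x)]
      rw [map_sum]
      refine Finset.sum_congr rfl fun l _ => ?_
      rw [map_smul]
      congr 1
      exact vecIncl_single l
    rw [h1, map_sum, RX_sum, LinearMap.sum_apply]
    refine Finset.sum_eq_zero fun k _ => ?_
    rw [map_smul, ← raise_eq_wedge, RX_smul, LinearMap.smul_apply]
    by_cases hk : k = 0 ∨ k = 3
    · simp [transverse, hk]
    · rw [hw, raise_D0_eq_zero hn N hu (not_or.1 hk).1 (not_or.1 hk).2, smul_zero]
  rw [hN, hr _ (exp_H_mulVec_eMinus hn t)]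
  -- Together with `(e^{-t})^N` from `hr` this gives the character `e^{(λ-N)t}`.
  have hA : rightTrans (incl n (expG (t • H n))) u = Complex.exp (lam * t) • u := by
    ext x
    change (u : G (n + 1) → ℂ) (x * incl n (expG (t • H n))) = _
    rw [incl_expG_H hn, Ind_mul_A hu]
    rfl
  rw [hA, map_smul, ← hw]
  change _ * (_ * (w : G (n + 1) → ℂ) _) = _
  have hμ' := hμ
  obtain ⟨c, hc, h0, h3⟩ := hμ'
  have hce : mat μ *ᵥ eMinus n = (c : ℝ) • eMinus n := by
    rw [eMinus, Matrix.mulVec_sub, h0, h3, smul_sub]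
  -- The only point where the parity of `N` matters.
  have hc1 : (c : ℝ) ^ N = 1 := by
    refine hSN c hc ?_
    have := form_mulVec μ (Pi.single 0 1) (Pi.single 0 1)
    rw [h0] at this
    simp only [map_smul, LinearMap.smul_apply, form_single, sgn_zero, Pi.single_eq_same,
      smul_eq_mul] at this
    rw [← abs_one, ← sq_eq_sq_iff_abs_eq_abs]
    linarith
  have hM : rightTrans (incl n μ) u = u := by
    ext x
    exact Ind_mul_M hu x (incl_mem_M hn hμ)
  rw [hr _ hce, hM, ← hw, ← Complex.ofReal_pow (c : ℝ), hc1, Complex.ofReal_one, one_mul,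
    ← mul_assoc]
  congr 1
  rw [Complex.ofReal_exp, ← Complex.exp_nat_mul, ← Complex.exp_add]
  congr 1
  push_cast
  ring

end Operators

/-! ### Conjugation of differential operators by powers of a function -/

section Conjugated

variable {A : Type*} [CommRing A] [Algebra ℂ A]

/-- The operators `s(λ)⁻¹ D(λ) s(λ)` form a polynomial family. -/
def IsConjPolynomial (s : ℂ → A) (D : ℂ → Module.End ℂ A) : Prop :=
  ∃ E : ℂ → Module.End ℂ A, IsPolynomialFamily E ∧ ∀ lam v, D lam (s lam * v) = s lam * E lam v

variable {s : ℂ → A}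

theorem IsConjPolynomial.smul {D : ℂ → Module.End ℂ A} (hD : IsConjPolynomial s D)
    (p : Polynomial ℂ) : IsConjPolynomial s fun lam => p.eval lam • D lam := by
  obtain ⟨E, hE, h⟩ := hD
  refine ⟨fun lam => (p.eval lam • (1 : Module.End ℂ A)) ∘ₗ E lam,
    (isPolynomialFamily_smul_poly p _).comp hE, fun lam v => ?_⟩
  simp [h]

theorem IsConjPolynomial.mul {D D' : ℂ → Module.End ℂ A} (hD : IsConjPolynomial s D)
    (hD' : IsConjPolynomial s D') : IsConjPolynomial s fun lam => D lam * D' lam := by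
  obtain ⟨E, hE, h⟩ := hD
  obtain ⟨E', hE', h'⟩ := hD'
  refine ⟨fun lam => E lam ∘ₗ E' lam, hE.comp hE', fun lam v => ?_⟩
  rw [Module.End.mul_apply, h', h, LinearMap.comp_apply]

theorem IsConjPolynomial.pow {D : ℂ → Module.End ℂ A} (hD : IsConjPolynomial s D) (k : ℕ) :
    IsConjPolynomial s fun lam => D lam ^ k := by
  induction k with
  | zero => exact ⟨fun _ => 1, isPolynomialFamily_const _, fun _ _ => rfl⟩
  | succ k ih =>
    simp only [pow_succ]
    exact ih.mul hD

theorem isConjPolynomial_sum {ι : Type*} (t : Finset ι) {D : ι → ℂ → Module.End ℂ A}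
    (hD : ∀ i ∈ t, IsConjPolynomial s (D i)) :
    IsConjPolynomial s fun lam => ∑ i ∈ t, D i lam := by
  choose! E hE h using hD
  refine ⟨fun lam => ∑ i ∈ t, E i lam, isPolynomialFamily_sum t hE, fun lam v => ?_⟩
  rw [LinearMap.sum_apply, LinearMap.sum_apply, Finset.mul_sum]
  exact Finset.sum_congr rfl fun i hi => h i hi lam v

/-- Here `s(λ)⁻¹ D s(λ) = D + λ f`, affine in `λ`. -/
theorem isConjPolynomial_of_leibniz {D : Module.End ℂ A}
    (hD : ∀ a f, D (a * f) = a * D f + D a * f) {f : A}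
    (hf : ∀ lam, D (s lam) = s lam * (lam • f)) : IsConjPolynomial s fun _ => D := by
  refine ⟨fun lam => D + (Polynomial.X : Polynomial ℂ).eval lam • LinearMap.mulLeft ℂ f,
    (isPolynomialFamily_const D).add (isPolynomialFamily_smul_poly _ _), fun lam v => ?_⟩
  rw [hD, hf, LinearMap.add_apply, LinearMap.smul_apply, LinearMap.mulLeft_apply,
    Polynomial.eval_X, mul_add, mul_assoc, smul_mul_assoc]

variable {ι : Type*}

theorem isConjPolynomial_family {t : Finset ι} {η : ι → ℂ} {I : ι → Module.End ℂ A}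
    {T : Module.End ℂ A} (hI : ∀ i, IsConjPolynomial s fun _ => I i)
    (hT : IsConjPolynomial s fun _ => T) (r : Finset ℕ) (p : ℕ → ℕ) {a : ℂ → ℕ → ℂ}
    (ha : ∀ j, ∃ q : Polynomial ℂ, ∀ lam, a lam j = q.eval lam) :
    IsConjPolynomial s fun lam =>
      ∑ j ∈ r, a lam j • ((∑ i ∈ t, η i • I i ^ 2) ^ j * T ^ p j) := by
  refine isConjPolynomial_sum r fun j _ => ?_
  obtain ⟨q, hq⟩ := ha j
  simp only [hq]
  refine IsConjPolynomial.smul (IsConjPolynomial.mul (IsConjPolynomial.pow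
    (isConjPolynomial_sum t fun i _ => ?_) j) (hT.pow _)) q
  simpa using ((hI i).pow 2).smul (Polynomial.C (η i))

theorem isDiffOpAlong_family {t : Finset ι} {η : ι → ℂ} {I : ι → Module.End ℂ A}
    {T : Module.End ℂ A} (hI : ∀ i, IsDiffOpAlong (AlgHom.id ℂ A) 1 (I i))
    (hT : IsDiffOpAlong (AlgHom.id ℂ A) 1 T) (r : Finset ℕ) (p : ℕ → ℕ) (a : ℕ → ℂ) {N : ℕ}
    (hN : ∀ j ∈ r, 2 * j + p j ≤ N) : IsDiffOpAlong (AlgHom.id ℂ A) N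
      (∑ j ∈ r, a j • ((∑ i ∈ t, η i • I i ^ 2) ^ j * T ^ p j)) := by
  refine IsDiffOpAlong.sum fun j hj => IsDiffOpAlong.smul (IsDiffOpAlong.mono ?_
    (isDiffOpAlong_mul (isDiffOpAlong_pow (IsDiffOpAlong.sum (k := 2 * 1) fun i _ =>
      (isDiffOpAlong_pow (hI i) 2).smul _) j) (isDiffOpAlong_pow hT (p j)))) _
  have := hN j hj
  omega

end Conjugated

/-! ### Polynomial dependence and order of `𝒟_N^0(λ)` on the group. -/

theorem aCoeff_polynomial (n N j : ℕ) :
    ∃ q : Polynomial ℂ, ∀ lam, aCoeff n N lam j = q.eval lam := by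
  refine ⟨∏ i ∈ Finset.Ioc j N,
    (Polynomial.C (-(i : ℂ) / (((N : ℂ) - i + 1) * (2 * N - 2 * i + 1))) *
      (Polynomial.C ((n : ℂ) - 1 - 4 * N + 2 * i) + Polynomial.C 2 * Polynomial.X)),
    fun lam => ?_⟩
  rw [Polynomial.eval_prod, aCoeff]
  refine Finset.prod_congr rfl fun i _ => ?_
  simp only [Polynomial.eval_mul, Polynomial.eval_add, Polynomial.eval_C, Polynomial.eval_X]
  ring

theorem bCoeff_polynomial (n N j : ℕ) :
    ∃ q : Polynomial ℂ, ∀ lam, bCoeff n N lam j = q.eval lam := by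
  refine ⟨∏ i ∈ Finset.Ioc j N,
    (Polynomial.C (-(i : ℂ) / (((N : ℂ) - i + 1) * (2 * N - 2 * i + 3))) *
      (Polynomial.C ((n : ℂ) - 3 - 4 * N + 2 * i) + Polynomial.C 2 * Polynomial.X)),
    fun lam => ?_⟩
  rw [Polynomial.eval_prod, bCoeff]
  refine Finset.prod_congr rfl fun i _ => ?_
  simp only [Polynomial.eval_mul, Polynomial.eval_add, Polynomial.eval_C, Polynomial.eval_X]
  ring

theorem dCoeff_polynomial (n N j : ℕ) :
    ∃ q : Polynomial ℂ, ∀ lam, dCoeff n N lam j = q.eval lam := by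
  unfold dCoeff
  split_ifs
  · exact aCoeff_polynomial _ _ _
  · exact bCoeff_polynomial _ _ _

theorem isConjPolynomial_RX {m : ℕ} (hm : 3 ≤ m) (X : 𝔤 m) :
    IsConjPolynomial (stretchPow hm) fun _ => RX X :=
  isConjPolynomial_of_leibniz (RX_leibniz X) (RX_stretchPow hm X)

theorem isConjPolynomial_D0 {n : ℕ} (hn : 3 ≤ n + 1) (N : ℕ) :
    IsConjPolynomial (stretchPow hn) fun lam => RU (n + 1) (D0 n N lam) := by
  simp only [RU_D0]
  have h := isConjPolynomial_family (A := CG (n + 1)) (s := stretchPow hn)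
    (t := Finset.univ.filter fun k : Fin (n + 1) => k ≠ 0 ∧ k ≠ 3) (η := fun k => (sgn n k : ℂ))
    (I := fun k => RX (nMinus k.castSucc)) (T := normalOp n)
    (fun k => isConjPolynomial_RX hn (nMinus k.castSucc))
    (isConjPolynomial_RX hn (nMinus (Fin.last (n + 1)))) (Finset.range (N / 2 + 1))
    (fun j => 2 * (N / 2 - j) + N % 2) (a := dCoeff n N) (dCoeff_polynomial n N)
  exact h

theorem isDiffOpAlong_RX {m : ℕ} (X : 𝔤 m) : IsDiffOpAlong (AlgHom.id ℂ (CG m)) 1 (RX X) :=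
  isDiffOpAlong_of_leibniz (RX_leibniz X)

theorem isDiffOpAlong_D0 (n N : ℕ) (lam : ℂ) :
    IsDiffOpAlong (AlgHom.id ℂ (CG (n + 1))) N (RU (n + 1) (D0 n N lam)) := by
  rw [RU_D0]
  refine isDiffOpAlong_family (A := CG (n + 1))
    (t := Finset.univ.filter fun k : Fin (n + 1) => k ≠ 0 ∧ k ≠ 3) (η := fun k => (sgn n k : ℂ))
    (I := fun k => RX (nMinus k.castSucc)) (T := normalOp n)
    (fun k => isDiffOpAlong_RX (nMinus k.castSucc))
    (isDiffOpAlong_RX (nMinus (Fin.last (n + 1)))) (Finset.range (N / 2 + 1))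
    (fun j => 2 * (N / 2 - j) + N % 2) (dCoeff n N lam) fun j hj => ?_
  have := Finset.mem_range.1 hj
  omega

/-! ### Compact realizations -/

section Compact

variable {S : Subgroup ℝˣ} {m : ℕ}

theorem mul_orbitPull_injective (S : Subgroup ℝˣ) (hm : 3 ≤ m) (lam : ℂ) {F F' : CEin S m}
    (h : stretchPow hm lam * orbitPull S hm F = stretchPow hm lam * orbitPull S hm F') :
    F = F' :=
  orbitPull_injective S hm ((isUnit_stretchPow hm lam).mul_left_cancel h)

/-- The map `F ↦ (g ↦ |g (e₀ + e₃)|^λ F([g (e₀ + e₃)]))`, up to normalization the inverse of the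
restriction to `K`. -/
def extendToInd (hS : Units.posSubgroup ℝ ≤ S) (hm : 3 ≤ m) (lam : ℂ) :
    CEin S m →ₗ[ℂ] Ind S m lam where
  toFun F := ⟨stretchPow hm lam * orbitPull S hm F, mul_orbitPull_mem_Ind hS hm lam F⟩
  map_add' F F' := Subtype.ext (by
    change _ * orbitPull S hm (F + F') = _ * orbitPull S hm F + _ * orbitPull S hm F'
    rw [map_add, mul_add])
  map_smul' c F := Subtype.ext (by
    change _ * orbitPull S hm (c • F) = c • (_ * orbitPull S hm F)
    rw [map_smul, mul_smul_comm])

theorem extendToInd_bijective (hS : Units.posSubgroup ℝ ≤ S)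
    (hS' : ∀ c ∈ S, (c : ℝ) < 0 → (-1 : ℝˣ) ∈ S) (hm : 3 ≤ m) (lam : ℂ) :
    Function.Bijective (extendToInd hS hm lam) := by
  refine ⟨fun F F' h => mul_orbitPull_injective S hm lam (congrArg Subtype.val h), fun u => ?_⟩
  obtain ⟨F, hF⟩ := exists_of_mem_Ind hS' hm u.2
  exact ⟨F, Subtype.ext hF⟩

/-- The isomorphism of an induced representation with its compact realization. -/
def compactIso (hS : Units.posSubgroup ℝ ≤ S) (hS' : ∀ c ∈ S, (c : ℝ) < 0 → (-1 : ℝˣ) ∈ S)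
    (hm : 3 ≤ m) (lam : ℂ) : Ind S m lam ≃ₗ[ℂ] CEin S m :=
  (LinearEquiv.ofBijective (extendToInd hS hm lam) (extendToInd_bijective hS hS' hm lam)).symm

variable (hS : Units.posSubgroup ℝ ≤ S) (hS' : ∀ c ∈ S, (c : ℝ) < 0 → (-1 : ℝˣ) ∈ S)

theorem mul_orbitPull_compactIso (hm : 3 ≤ m) (lam : ℂ) (u : Ind S m lam) :
    stretchPow hm lam * orbitPull S hm (compactIso hS hS' hm lam u) = u :=
  congrArg Subtype.val (LinearEquiv.apply_symm_apply
    (LinearEquiv.ofBijective (extendToInd hS hm lam) (extendToInd_bijective hS hS' hm lam)) u)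

theorem logStretch_of_mem_K (hm : 3 ≤ m) {k : G m} (hk : k ∈ K m) :
    (logStretch hm : G m → ℂ) k = 0 := by
  have h1 : euclNorm (mat k *ᵥ ePlus m) = euclNorm (ePlus m) := by
    rw [euclNorm, euclNorm, Matrix.dotProduct_mulVec, ← Matrix.mulVec_transpose,
      Matrix.mulVec_mulVec, show (mat k)ᵀ * mat k = 1 from hk, Matrix.one_mulVec]
  rw [logStretch_apply, h1, div_self (euclNorm_pos (ePlus_ne_zero hm)).ne', Real.log_one,
    Complex.ofReal_zero]

/-- The cocycle property of the stretching factor; it matches left translation with the multiplier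
in `compactRep`. -/
theorem logStretch_mul (S : Subgroup ℝˣ) (hm : 3 ≤ m) (g x : G m) :
    (logStretch hm : G m → ℂ) (g * x) =
      Real.log (stretch g (Ein.mk S (x • basePoint hm))) + (logStretch hm : G m → ℂ) x := by
  rw [logStretch_eq S, logStretch_eq S, stretch_mul, smul_mk,
    Real.log_mul (stretch_pos _ _).ne' (stretch_pos _ _).ne', Complex.ofReal_add]

theorem isCompactRealization_compactIso (hm : 3 ≤ m) (lam : ℂ) :
    IsCompactRealization S m lam (compactIso hS hS' hm lam) := by
  refine ⟨fun u k hk v hv => ?_, fun g u => ?_⟩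
  · have h1 : v = k • basePoint hm := Subtype.ext hv
    have h2 := congrArg (fun w : CG m => (w : G m → ℂ) k)
      (mul_orbitPull_compactIso hS hS' hm lam u)
    rw [h1, ← h2]
    change _ = (stretchPow hm lam : G m → ℂ) k * _
    rw [stretchPow_apply, logStretch_of_mem_K hm hk, mul_zero, Complex.exp_zero, one_mul]
    rfl
  · refine mul_orbitPull_injective S hm lam ?_
    rw [mul_orbitPull_compactIso]
    ext x
    have h2 := congrArg (fun w : CG m => (w : G m → ℂ) (g⁻¹ * x))
      (mul_orbitPull_compactIso hS hS' hm lam u)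
    refine h2.symm.trans ?_
    obtain ⟨F, hF⟩ : ∃ F, F = compactIso hS hS' hm lam u := ⟨_, rfl⟩
    rw [← hF]
    change (stretchPow hm lam : G m → ℂ) (g⁻¹ * x) *
        (F : Ein S m → ℂ) (Ein.mk S ((g⁻¹ * x) • basePoint hm)) =
      (stretchPow hm lam : G m → ℂ) x * ((F : Ein S m → ℂ) (g⁻¹ • Ein.mk S (x • basePoint hm)) *
        Complex.exp (lam * Real.log (stretch g⁻¹ (Ein.mk S (x • basePoint hm)))))
    rw [stretchPow_apply, stretchPow_apply, logStretch_mul S, mul_smul, smul_mk, mul_add,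
      Complex.exp_add]
    ring

end Compact

/-! ### The equivariant families -/

section Family

variable {S : Subgroup ℝˣ} {n : ℕ}

theorem vecIncl_dotProduct (v : Fin (n + 1) → ℝ) : vecIncl v ⬝ᵥ vecIncl v = v ⬝ᵥ v := by
  rw [dotProduct, Fin.sum_univ_castSucc, vecIncl_last, mul_zero, add_zero]
  simp only [vecIncl_castSucc]
  rfl

/-- The Euclidean norm does not change when a zero coordinate is appended. -/
theorem restrictG_stretchPow (hn : 3 ≤ n) (hn' : 3 ≤ n + 1) (lam : ℂ) :
    restrictG n (stretchPow hn' lam) = stretchPow hn lam := by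
  ext g
  change (stretchPow hn' lam : G (n + 1) → ℂ) (incl n g) = _
  rw [stretchPow_apply, stretchPow_apply, logStretch_apply, logStretch_apply, ← vecIncl_ePlus hn,
    mat_incl_mulVec]
  simp only [euclNorm, vecIncl_dotProduct]

theorem orbitPull_pullEin (hn : 3 ≤ n) (hn' : 3 ≤ n + 1) (F : CEin S (n + 1)) :
    orbitPull S hn (pullEin S n F) = restrictG n (orbitPull S hn' F) := by
  ext g
  change (F : Ein S (n + 1) → ℂ) (Ein.mk S (coneIncl (g • basePoint hn))) =
    (F : Ein S (n + 1) → ℂ) (Ein.mk S (incl n g • basePoint hn'))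
  refine congrArg (fun v => (F : Ein S (n + 1) → ℂ) (Ein.mk S v)) (Subtype.ext ?_)
  change vecIncl (mat g *ᵥ ePlus n) = mat (incl n g) *ᵥ ePlus (n + 1)
  rw [← vecIncl_ePlus hn, mat_incl_mulVec]

/-- The operators `i^* ∘ 𝒟_N^0(λ)` between induced representations. -/
def dInd (hn : 3 ≤ n) {N : ℕ} (hSN : ∀ c ∈ S, |(c : ℝ)| = 1 → (c : ℝ) ^ N = 1) (lam : ℂ) :
    Ind S (n + 1) lam →ₗ[ℂ] Ind S n (lam - N) :=
  LinearMap.restrict ((restrictG n).toLinearMap ∘ₗ RU (n + 1) (D0 n N lam))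
    fun _ hu => restrictG_D0_mem_Ind hn hSN hu

theorem dInd_indRep (hn : 3 ≤ n) {N : ℕ} (hSN : ∀ c ∈ S, |(c : ℝ)| = 1 → (c : ℝ) ^ N = 1)
    (lam : ℂ) (g : G n) (u : Ind S (n + 1) lam) :
    dInd hn hSN lam (indRep S (n + 1) lam (incl n g) u) =
      indRep S n (lam - N) g (dInd hn hSN lam u) := by
  refine Subtype.ext (Subtype.ext (funext fun x => ?_))
  have h1 := congrArg (fun B => (B (u : CG (n + 1)) : G (n + 1) → ℂ) (incl n x))
    (leftTrans_D0 (incl n g)⁻¹ N lam).eq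
  refine h1.symm.trans ?_
  change (RU (n + 1) (D0 n N lam) u : G (n + 1) → ℂ) ((incl n g)⁻¹ * incl n x) =
    (RU (n + 1) (D0 n N lam) u : G (n + 1) → ℂ) (incl n (g⁻¹ * x))
  rw [map_mul, map_inv]

/-- Writing `𝒟_N^0(λ) s_λ = s_λ E(λ)` with `E` polynomial and cancelling `s_{λ-N}` leaves the factor
`s_N`, which does not depend on `λ`. -/
theorem isPolynomialFamily_of_key (hn : 3 ≤ n) (hn' : 3 ≤ n + 1) {N : ℕ}
    {D : ℂ → CEin S (n + 1) →ₗ[ℂ] CEin S n}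
    (hD : ∀ lam F, stretchPow hn (lam - N) * orbitPull S hn (D lam F) =
      restrictG n (RU (n + 1) (D0 n N lam) (stretchPow hn' lam * orbitPull S hn' F))) :
    IsPolynomialFamily D := by
  obtain ⟨E, hE, h⟩ := isConjPolynomial_D0 hn' N
  have h1 : ∀ lam F, orbitPull S hn (D lam F) =
      stretchPow hn N * restrictG n (E lam (orbitPull S hn' F)) := by
    intro lam F
    have h2 := hD lam F
    rw [h, map_mul, restrictG_stretchPow hn hn'] at h2
    have h3 : stretchPow hn lam = stretchPow hn (lam - N) * stretchPow hn N := by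
      rw [← stretchPow_add, sub_add_cancel]
    rw [h3, mul_assoc] at h2
    exact (isUnit_stretchPow hn (lam - N)).mul_left_cancel h2
  refine IsPolynomialFamily.of_injective (ψ := (orbitPull S hn).toLinearMap)
    (orbitPull_injective S hn) ?_
  have h4 : (fun lam => (orbitPull S hn).toLinearMap ∘ₗ D lam) = fun lam =>
      (LinearMap.mulLeft ℂ (stretchPow hn N) ∘ₗ (restrictG n).toLinearMap) ∘ₗ (E lam ∘ₗ
        (orbitPull S hn').toLinearMap) :=
    funext fun lam => LinearMap.ext (h1 lam)
  rw [h4]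
  exact IsPolynomialFamily.comp (isPolynomialFamily_const _)
    (hE.comp (isPolynomialFamily_const _))

theorem definesEquivariantFamily (hn : 3 ≤ n) (hS : Units.posSubgroup ℝ ≤ S)
    (hS' : ∀ c ∈ S, (c : ℝ) < 0 → (-1 : ℝˣ) ∈ S) {N : ℕ}
    (hSN : ∀ c ∈ S, |(c : ℝ)| = 1 → (c : ℝ) ^ N = 1) : DefinesEquivariantFamily S n N := by
  have hn' : 3 ≤ n + 1 := by omega
  obtain ⟨δ, hδ⟩ : ∃ δ, δ = fun lam => compactIso hS hS' hn' lam := ⟨_, rfl⟩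
  obtain ⟨δ', hδ'⟩ : ∃ δ', δ' = fun lam => compactIso hS hS' hn lam := ⟨_, rfl⟩
  have hr : ∀ lam, IsCompactRealization S (n + 1) lam (δ lam) := by
    rw [hδ]
    exact isCompactRealization_compactIso hS hS' hn'
  have hr' : ∀ lam, IsCompactRealization S n lam (δ' lam) := by
    rw [hδ']
    exact isCompactRealization_compactIso hS hS' hn
  have hp : ∀ lam u, stretchPow hn' lam * orbitPull S hn' (δ lam u) = u := by
    rw [hδ]
    exact mul_orbitPull_compactIso hS hS' hn'
  have hp' : ∀ lam u, stretchPow hn lam * orbitPull S hn (δ' lam u) = u := by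
    rw [hδ']
    exact mul_orbitPull_compactIso hS hS' hn
  clear hδ hδ'
  let Dc : ℂ → CEin S (n + 1) →ₗ[ℂ] CEin S n := fun lam =>
    (δ' (lam - N)).toLinearMap ∘ₗ dInd hn hSN lam ∘ₗ (δ lam).symm.toLinearMap
  have hDc : ∀ lam u, Dc lam (δ lam u) = δ' (lam - N) (dInd hn hSN lam u) := fun lam u =>
    congrArg (fun w => δ' (lam - N) (dInd hn hSN lam w)) ((δ lam).symm_apply_apply u)
  -- This lift of `Dc` to the group yields both the bound on the order and the polynomial
  -- dependence.
  have key : ∀ lam F, stretchPow hn (lam - N) * orbitPull S hn (Dc lam F) =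
      restrictG n (RU (n + 1) (D0 n N lam) (stretchPow hn' lam * orbitPull S hn' F)) := by
    intro lam F
    have h1 := hp lam ((δ lam).symm F)
    rw [LinearEquiv.apply_symm_apply] at h1
    rw [h1]
    exact hp' (lam - N) (dInd hn hSN lam ((δ lam).symm F))
  refine ⟨δ, δ', dInd hn hSN, Dc, hr, hr', fun _ _ => rfl, hDc, fun lam g F => ?_,
    fun lam => ?_, ?_⟩
  · obtain ⟨u, rfl⟩ := (δ lam).surjective F
    refine Eq.trans ?_ ((congrArg (δ' (lam - N)) (dInd_indRep hn hSN lam g u)).trans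
      (((hr' (lam - N)).2 g (dInd hn hSN lam u)).trans
        (congrArg (compactRep S n (lam - N) g) (hDc lam u).symm)))
    exact (congrArg (Dc lam) ((hr lam).2 (incl n g) u).symm).trans (hDc lam _)
  · exact IsDiffOpAlong.transport (p := orbitPull S hn') (q := orbitPull S hn)
      (φ' := restrictG n) (orbitPull_pullEin hn hn') (isUnit_stretchPow hn (lam - N))
      (orbitPull_injective S hn) (isDiffOpAlong_D0 n N lam) (key lam)
  · exact isPolynomialFamily_of_key hn hn' key

end Family

end EinsteinFamilies

end

/-! ### The two cases, lines and rays. -/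

theorem theorem1p3 (n : ℕ) (hn : 4 ≤ n) :
    -- lines in the light cone, `P = M A N⁺`, even order
    (∀ N : ℕ, Even N → EinsteinFamilies.DefinesEquivariantFamily ⊤ n N) ∧
    -- rays in the light cone, `P̂ = M̂ A N⁺`, all orders
    (∀ N : ℕ, EinsteinFamilies.DefinesEquivariantFamily (Units.posSubgroup ℝ) n N) := by
  refine ⟨fun N hN => EinsteinFamilies.definesEquivariantFamily (by omega) le_top
    (fun _ _ _ => Subgroup.mem_top _) fun c _ hc => ?_,
    fun N => EinsteinFamilies.definesEquivariantFamily (by omega) le_rfl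
      (fun c hc h => absurd ((Units.mem_posSubgroup c).1 hc) h.not_gt) fun c hc h => ?_⟩
  -- For lines `c = ±1`, and evenness of `N` removes the sign.
  · rw [← hN.pow_abs, hc, one_pow]
  -- For rays `c` is positive, hence equal to `1`.
  · rw [← abs_of_pos ((Units.mem_posSubgroup c).1 hc), h, one_pow]
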